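/- A triply periodic network in $\mathbb R^3$ with lattice $\Lambda$ (a discrete subgroup of $\mathbb R^3$ of rank $3$) is a connected simple graph $N$ on which $\Lambda$ acts by automorphisms, mapped to $\mathbb R^3$ with straight edges of positive length such that $\Lambda$ acts by translations, such that the star of each vertex is mapped injectively (the map is an immersion), and such that the quotient graph $N/\Lambda$, possibly with loops and multiple edges, is finite. Let $L$ be the total length of the edges of $N/\Lambda$ and $V$ the volume of $\mathbb R^3/\Lambda$. An srs network is a triply periodic network all of whose vertices have degree $3$, such that at each vertex the three unit vectors along the incident edges sum to zero, whose quotient $N/\Lambda$ is the complete graph $K_4$, whose edges all have the same length, and whose lattice $\Lambda$ is body-centred cubic, that is, the image under a linear similarity of the lattice generated by $(-1,1,1)$, $(1,-1,1)$, $(1,1,-1)$. Theorem. Every triply periodic network $N$ in $\mathbb R^3$ satisfies $$\frac{L^3}{V}\ \geq\ \frac{27}{\sqrt2}.$$ Equality holds if and only if $N$ is an srs network up to vertices of degree $2$, that is, $N$ arises from an srs network with the same lattice $\Lambda$ by inserting vertices of degree $2$ with opposite incident edges. Moreover, srs networks exist, and any two of them (together with their lattices) correspond under a similarity of $\mathbb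 R^3$. -/

import Mathlib

noncomputable section

/-- Two edges of a graph on `V` are equivalent when a lattice vector carries one to the other. -/
def edgeOrbitSetoid {n : ℕ} (Λ : Submodule ℤ (EuclideanSpace ℝ (Fin n))) {V : Type*}
    [AddAction Λ V] (G : SimpleGraph V) : Setoid G.edgeSet where
  r e e' := ∃ g : Λ, Sym2.map (fun x => g +ᵥ x) (e : Sym2 V) = e'
  iseqv :=
    { refl := fun e => ⟨0, by simp⟩
      symm := by
        rintro e e' ⟨g, hg⟩
        exact ⟨-g, by rw [← hg, Sym2.map_map]; simp⟩
      trans := by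
        rintro e e' e'' ⟨g, hg⟩ ⟨h, hh⟩
        refine ⟨h + g, ?_⟩
        rw [← hh, ← hg, Sym2.map_map]
        simp [add_vadd] }

/-- An `n`-periodic network in `ℝⁿ` with lattice `Λ`: a connected simple graph with vertex set `V`,
on which `Λ` acts by automorphisms, drawn in `ℝⁿ` with straight edges such that `Λ` acts by
translations. Edges have positive length, the star of each vertex is embedded (so the drawing is an
immersion), and the quotient by `Λ` has finitely many vertices and edges. -/
structure PeriodicNetwork {n : ℕ} (Λ : Submodule ℤ (EuclideanSpace ℝ (Fin n))) (V : Type*)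
    [AddAction Λ V] where
  graph : SimpleGraph V
  pos : V → EuclideanSpace ℝ (Fin n)
  connected : graph.Connected
  adj_vadd : ∀ (g : Λ) (x y : V), graph.Adj x y → graph.Adj (g +ᵥ x) (g +ᵥ y)
  pos_vadd : ∀ (g : Λ) (x : V), pos (g +ᵥ x) = pos x + (g : EuclideanSpace ℝ (Fin n))
  pos_ne : ∀ x y : V, graph.Adj x y → pos x ≠ pos y
  star_embedded : ∀ x y z : V, graph.Adj x y → graph.Adj x z → y ≠ z →
    segment ℝ (pos x) (pos y) ∩ segment ℝ (pos x) (pos z) = {pos x}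
  finite_vertices : Finite (AddAction.orbitRel.Quotient Λ V)
  finite_edges : Finite (Quotient (edgeOrbitSetoid Λ graph))

namespace PeriodicNetwork

variable {n : ℕ} {Λ : Submodule ℤ (EuclideanSpace ℝ (Fin n))} {V : Type*} [AddAction Λ V]

/-- Vertices of the quotient graph. -/
abbrev QVertex (_N : PeriodicNetwork Λ V) : Type _ := AddAction.orbitRel.Quotient Λ V

/-- Edges of the quotient graph (which may have loops and multiple edges). -/
abbrev QEdge (N : PeriodicNetwork Λ V) : Type _ := Quotient (edgeOrbitSetoid Λ N.graph)

/-- The unordered pair of endpoints of an edge of the quotient graph. -/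
def endpoints (N : PeriodicNetwork Λ V) : N.QEdge → Sym2 N.QVertex :=
  Quotient.lift
    (fun e : N.graph.edgeSet =>
      Sym2.map (fun x : V => (Quotient.mk'' x : N.QVertex)) (e : Sym2 V))
    (by
      rintro e e' ⟨g, hg⟩
      simp only [← hg, Sym2.map_map, Function.comp_def]
      congr 1
      funext x
      exact (Quotient.sound' (AddAction.mem_orbit x g)).symm)

/-- The distance of the positions of two vertices, as a function of the unordered pair. -/
def pairLength (N : PeriodicNetwork Λ V) : Sym2 V → ℝ :=
  Sym2.lift ⟨fun x y => dist (N.pos x) (N.pos y), fun _ _ => dist_comm _ _⟩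

/-- The length of an edge of the quotient graph. -/
def qEdgeLength (N : PeriodicNetwork Λ V) : N.QEdge → ℝ :=
  Quotient.lift (fun e : N.graph.edgeSet => N.pairLength (e : Sym2 V))
    (by
      rintro ⟨e, he⟩ ⟨e', he'⟩ ⟨g, hg⟩
      simp only at hg ⊢
      subst hg
      induction e using Sym2.ind with
      | _ x y => simp [pairLength, N.pos_vadd])

/-- The length `L` of the quotient network. -/
def length (N : PeriodicNetwork Λ V) : ℝ := ∑ᶠ q : N.QEdge, N.qEdgeLength q

/-- All vertices have degree 3, and the unit vectors along the edges at each vertex sum to 0. -/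
def IsSteiner (N : PeriodicNetwork Λ V) : Prop :=
  ∀ x : V, (N.graph.neighborSet x).ncard = 3 ∧
    ∑ᶠ y ∈ N.graph.neighborSet x, (‖N.pos x - N.pos y‖)⁻¹ • (N.pos x - N.pos y) = 0

/-- The quotient graph is the complete graph on four vertices: there are no loops, and
any two distinct vertices are joined by exactly one edge. -/
def QuotientIsK4 (N : PeriodicNetwork Λ V) : Prop :=
  Nat.card N.QVertex = 4 ∧ Function.Injective N.endpoints ∧
    Set.range N.endpoints = {s | ¬ s.IsDiag}

/-- All edges have the same length. -/
def IsEquilateral (N : PeriodicNetwork Λ V) : Prop :=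
  ∃ l : ℝ, ∀ x y : V, N.graph.Adj x y → dist (N.pos x) (N.pos y) = l

/-- `N` arises from the network `M` with the same lattice by inserting vertices of degree 2 with
opposite incident edges. The map `ι` includes the vertices of `M` into those of `N`; two vertices
of `M` are adjacent iff they are distinct and are joined in `N` by a path whose interior vertices
are all inserted ones. -/
def IsSubdivisionOf {W : Type*} [AddAction Λ W] (N : PeriodicNetwork Λ V)
    (M : PeriodicNetwork Λ W) : Prop :=
  ∃ ι : W → V, Function.Injective ι ∧
    (∀ (g : Λ) (w : W), ι (g +ᵥ w) = g +ᵥ ι w) ∧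
    (∀ w : W, N.pos (ι w) = M.pos w) ∧
    (∀ v : V, v ∉ Set.range ι → ∃ a b : V, N.graph.neighborSet v = {a, b} ∧
      N.pos v ∈ openSegment ℝ (N.pos a) (N.pos b)) ∧
    (∀ w w' : W, M.graph.Adj w w' ↔ w ≠ w' ∧ ∃ p : N.graph.Walk (ι w) (ι w'), p.IsPath ∧
      ∀ v ∈ p.support, v ∈ Set.range ι → v = ι w ∨ v = ι w')

/-- `N` and `N'` correspond under a similarity `x ↦ c • A x + b` of `ℝⁿ`, compatibly with their
graphs, lattices and lattice actions. -/
def IsSimilarTo {Λ' : Submodule ℤ (EuclideanSpace ℝ (Fin n))} {V' : Type*} [AddAction Λ' V']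
    (N : PeriodicNetwork Λ V) (N' : PeriodicNetwork Λ' V') : Prop :=
  ∃ (c : ℝ) (A : EuclideanSpace ℝ (Fin n) ≃ₗᵢ[ℝ] EuclideanSpace ℝ (Fin n))
    (b : EuclideanSpace ℝ (Fin n)) (ψ : N.graph ≃g N'.graph),
    0 < c ∧ (Λ' : Set (EuclideanSpace ℝ (Fin n))) = (fun x => c • A x) '' Λ ∧
    (∀ x : V, N'.pos (ψ x) = c • A (N.pos x) + b) ∧
    (∀ (g : Λ) (g' : Λ') (x : V),
      (g' : EuclideanSpace ℝ (Fin n)) = c • A (g : EuclideanSpace ℝ (Fin n)) →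
        ψ (g +ᵥ x) = g' +ᵥ ψ x)

end PeriodicNetwork

/-- The standard body-centred cubic lattice: the integer vectors whose
coordinates are all even or all odd. -/
def bccLattice : Submodule ℤ (EuclideanSpace ℝ (Fin 3)) :=
  Submodule.span ℤ {!₂[-1, 1, 1], !₂[1, -1, 1], !₂[1, 1, -1]}

/-- `Λ` is body-centred cubic: it is the image of the standard one under a linear similarity. -/
def IsBodyCentredCubic (Λ : Submodule ℤ (EuclideanSpace ℝ (Fin 3))) : Prop :=
  ∃ (c : ℝ) (A : EuclideanSpace ℝ (Fin 3) ≃ₗᵢ[ℝ] EuclideanSpace ℝ (Fin 3)),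
    0 < c ∧ (Λ : Set (EuclideanSpace ℝ (Fin 3))) = (fun x => c • A x) '' bccLattice

/-- An srs network: a Steiner network with quotient `K₄`, all of whose edges have the same length,
and whose lattice is body-centred cubic. -/
def PeriodicNetwork.IsSrs {Λ : Submodule ℤ (EuclideanSpace ℝ (Fin 3))} {V : Type*}
    [AddAction Λ V] (N : PeriodicNetwork Λ V) : Prop :=
  N.IsSteiner ∧ N.QuotientIsK4 ∧ N.IsEquilateral ∧ IsBodyCentredCubic Λ

end

/-! The real flows on the finite graph N/Λ form its first homology, and `flux` sends a flow to the
sum of the edge vectors weighted by it. Closed walks have flux in Λ, and every lattice vector arises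
from one, so `flux` maps onto ℝ³. Choose a minimal set of edges whose flows still map onto ℝ³. On
these flows `flux` is an isomorphism, so the value of the flow on a dart d becomes a linear
functional x ↦ ⟨γ d, x⟩ (`exists_covectors`). Since the support of every flow contains a cycle with
coefficients 0, ±1 and flux in Λ, pivoting shows that the γ d are unimodular: in suitable
coordinates, with dual vectors β in Λ, all entries and minors needed are at most 1 in absolute
value. A unimodular system of rank three embeds into the root system A₃ = D₃ (`exists_root_matrix`),
so there are an automorphism A of ℝ³ and integer vectors u d, each zero or of norm √2, with ½ ∑ ⟨u
d, y⟩ vec d = A y.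

Write A = O P with O orthogonal and P positive with eigenvalues σᵢ. Taking traces, ∑ σᵢ = ½ ∑ ⟨O (u
d), vec d⟩ ≤ √2 L by Cauchy-Schwarz. By the parity of D₃ roots, A/2 maps the standard bcc lattice,
of covolume 4, into Λ, so V ≤ 4 · (∏ σᵢ) / 8 = (∏ σᵢ) / 2. The inequality of arithmetic and
geometric means gives 27 ∏ σᵢ ≤ (∑ σᵢ)³ ≤ 2√2 L³, hence the bound (`length_estimate`).

In the equality case everything is tight. The σᵢ agree, Λ is the image of the bcc lattice under a
similarity, every vec d is a positive multiple of the root O (u d), the weighted roots form a tight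
frame, and the first Betti number is at most 3 (`IsRigid`). Tightness of the frame gives every pair
±r of roots the same positive weight, so all 12 roots occur. Vertices of degree two are straight and
can be omitted without changing L or Λ (`smooth`), after which rigidity applies again. Now all
degrees are at least 3, and the counts 3v ≤ D ≤ 2v + 4 and D ≥ 12 of vertices and darts leave only v
= 4 and D = 12, with each root used exactly once; balancing then excludes loops and double edges, so
the quotient is K₄ (`IsRigid.isSrs`).

Conversely, the balancing and equal length conditions on K₄ determine the Gram matrix of the edge
vectors (`exists_similarity`). So every srs network is similar to one explicit model, for which L³ /
V is computed directly. -/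

noncomputable section
open scoped Classical

/-! ### Darts of the quotient graph -/

namespace PeriodicNetwork

variable {n : ℕ} {Λ : Submodule ℤ (EuclideanSpace ℝ (Fin n))} {V : Type*} [AddAction Λ V]
variable (N : PeriodicNetwork Λ V)

/-- Two darts are equivalent when a lattice vector carries one to the other. -/
def dartSetoid : Setoid N.graph.Dart where
  r d d' := ∃ g : Λ, g +ᵥ d.fst = d'.fst ∧ g +ᵥ d.snd = d'.snd
  iseqv :=
    { refl := fun d => ⟨0, by simp⟩
      symm := by
        rintro d d' ⟨g, h1, h2⟩
        exact ⟨-g, by simp [← h1, ← h2]⟩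
      trans := by
        rintro d d' d'' ⟨g, h1, h2⟩ ⟨h, h3, h4⟩
        exact ⟨h + g, by simp [← h1, ← h2, ← h3, ← h4, add_vadd]⟩ }

/-- Darts (oriented edges) of the quotient graph. -/
def QDart : Type _ := Quotient N.dartSetoid

variable {N}

/-- The class of the dart from `x` to `y`. -/
def mkDart {x y : V} (h : N.graph.Adj x y) : N.QDart := Quotient.mk N.dartSetoid ⟨(x, y), h⟩

/-- The class of the vertex `x`. -/
def mkV (N : PeriodicNetwork Λ V) (x : V) : N.QVertex := Quotient.mk'' x

theorem mkV_eq_iff {x y : V} : N.mkV x = N.mkV y ↔ ∃ g : Λ, g +ᵥ x = y := by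
  unfold mkV
  rw [Quotient.eq'']
  constructor
  · rintro ⟨g, hg⟩
    exact ⟨-g, by simp [← hg]⟩
  · rintro ⟨g, hg⟩
    exact ⟨-g, by simp [← hg]⟩

@[simp] theorem mkV_vadd (g : Λ) (x : V) : N.mkV (g +ᵥ x) = N.mkV x :=
  (mkV_eq_iff.2 ⟨g, rfl⟩).symm

theorem mkV_surjective : Function.Surjective N.mkV := fun q => by
  induction q using Quotient.inductionOn' with
  | _ x => exact ⟨x, rfl⟩

theorem mkDart_eq_iff {x y x' y' : V} {h : N.graph.Adj x y} {h' : N.graph.Adj x' y'} :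
    mkDart h = mkDart h' ↔ ∃ g : Λ, g +ᵥ x = x' ∧ g +ᵥ y = y' :=
  Quotient.eq

/-- Positions are translated by the acting lattice vector, so the action is free. The map `pos`
itself need not be injective. -/
theorem vadd_left_cancel_of_eq {g h : Λ} {x : V} (N : PeriodicNetwork Λ V)
    (e : g +ᵥ x = h +ᵥ x) : g = h := by
  have := congrArg N.pos e
  rw [N.pos_vadd, N.pos_vadd] at this
  exact Subtype.ext (add_left_cancel this)

theorem vadd_eq_self {g : Λ} {x : V} (N : PeriodicNetwork Λ V) (e : g +ᵥ x = x) : g = 0 :=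
  N.vadd_left_cancel_of_eq (h := 0) (by simpa using e)

theorem QDart.ind {P : N.QDart → Prop}
    (h : ∀ (x y : V) (hxy : N.graph.Adj x y), P (mkDart hxy)) (d : N.QDart) : P d :=
  Quotient.inductionOn d fun ⟨⟨x, y⟩, hxy⟩ => h x y hxy

/-- The initial vertex. -/
def src : N.QDart → N.QVertex :=
  Quotient.lift (fun d => N.mkV d.fst) fun _ _ ⟨g, h, _⟩ => mkV_eq_iff.2 ⟨g, h⟩

/-- The final vertex. -/
def tgt : N.QDart → N.QVertex :=
  Quotient.lift (fun d => N.mkV d.snd) fun _ _ ⟨g, _, h⟩ => mkV_eq_iff.2 ⟨g, h⟩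

/-- Reversal of darts. -/
def rev : N.QDart → N.QDart :=
  Quotient.lift (fun d => mkDart d.adj.symm) fun _ _ ⟨g, h, h'⟩ => mkDart_eq_iff.2 ⟨g, h', h⟩

/-- The vector from the initial to the final vertex. -/
def vec : N.QDart → EuclideanSpace ℝ (Fin n) :=
  Quotient.lift (fun d => N.pos d.snd - N.pos d.fst) fun _ _ ⟨g, h, h'⟩ => by
    simp [← h, ← h', N.pos_vadd]

/-- The underlying edge. -/
def edge : N.QDart → N.QEdge :=
  Quotient.lift (fun d => Quotient.mk _ ⟨d.edge, d.edge_mem⟩) fun d d' ⟨g, h, h'⟩ =>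
    Quotient.sound ⟨g, by
      change Sym2.map _ (Sym2.mk d.fst d.snd) = Sym2.mk d'.fst d'.snd
      rw [Sym2.map_mk, h, h']⟩

section simps
variable {x y : V} (h : N.graph.Adj x y)
@[simp] theorem src_mkDart : src (mkDart h) = N.mkV x := rfl
@[simp] theorem tgt_mkDart : tgt (mkDart h) = N.mkV y := rfl
@[simp] theorem rev_mkDart : rev (mkDart h) = mkDart h.symm := rfl
@[simp] theorem vec_mkDart : vec (mkDart h) = N.pos y - N.pos x := rfl
theorem edge_mkDart : edge (mkDart h) = Quotient.mk _ ⟨s(x, y), h⟩ := rfl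
end simps

@[simp] theorem rev_rev (d : N.QDart) : rev (rev d) = d := by
  induction d using QDart.ind; rfl
@[simp] theorem src_rev (d : N.QDart) : src (rev d) = tgt d := by
  induction d using QDart.ind; rfl
@[simp] theorem tgt_rev (d : N.QDart) : tgt (rev d) = src d := by
  induction d using QDart.ind; rfl
@[simp] theorem vec_rev (d : N.QDart) : vec (rev d) = - vec d := by
  induction d using QDart.ind; simp
@[simp] theorem edge_rev (d : N.QDart) : edge (rev d) = edge d := by
  induction d using QDart.ind with
  | _ x y h => simp [edge_mkDart, Sym2.eq_swap]

theorem rev_involutive : Function.Involutive (rev : N.QDart → N.QDart) := rev_rev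

theorem vec_ne_zero (d : N.QDart) : vec d ≠ 0 := by
  induction d using QDart.ind with
  | _ x y h => simpa [sub_eq_zero] using (N.pos_ne x y h).symm

/-- A lattice translation that swaps the ends of an edge would make the edge vector its own
negative. So there are no inversions, and every edge of the quotient carries exactly two darts, also
when it is a loop. -/
theorem rev_ne (d : N.QDart) : rev d ≠ d := fun h => by
  have h2 := vec_rev d
  rw [h] at h2
  have h3 : (2 : ℝ) • vec d = 0 := by rw [two_smul]; nth_rewrite 1 [h2]; simp
  exact vec_ne_zero d (by simpa using h3)

theorem edge_surjective : Function.Surjective (edge : N.QDart → N.QEdge) := by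
  intro e
  induction e using Quotient.inductionOn with
  | _ e =>
    obtain ⟨e, he⟩ := e
    induction e using Sym2.ind with
    | _ x y => exact ⟨mkDart (N := N) he, rfl⟩

theorem edge_eq_iff {d d' : N.QDart} : edge d = edge d' ↔ d' = d ∨ d' = rev d := by
  constructor
  · induction d using QDart.ind with
    | _ x y h =>
    induction d' using QDart.ind with
    | _ x' y' h' =>
    intro e
    obtain ⟨g, hg⟩ := Quotient.exact e
    change Sym2.map _ s(x, y) = s(x', y') at hg
    rw [Sym2.map_mk, Sym2.eq_iff] at hg
    rcases hg with ⟨h1, h2⟩ | ⟨h1, h2⟩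
    · exact Or.inl (mkDart_eq_iff.2 ⟨g, h1, h2⟩).symm
    · exact Or.inr (mkDart_eq_iff.2 ⟨g, h2, h1⟩).symm
  · rintro (rfl | rfl) <;> simp

instance : Finite N.QDart := by
  have := N.finite_edges
  refine Set.finite_univ_iff.1 (Set.Finite.of_finite_fibers (edge : N.QDart → N.QEdge)
    (Set.toFinite _) fun e _ => ?_)
  obtain ⟨d, rfl⟩ := edge_surjective e
  refine (Set.toFinite {d, rev d}).subset fun d' hd' => ?_
  exact edge_eq_iff.1 (Eq.symm hd'.2)

instance : Fintype N.QDart := Fintype.ofFinite _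

theorem norm_vec (d : N.QDart) : N.qEdgeLength (edge d) = ‖vec d‖ := by
  induction d using QDart.ind with
  | _ x y h =>
    rw [vec_mkDart, ← dist_eq_norm, dist_comm]; rfl

theorem sum_rev {M : Type*} [AddCommMonoid M] (f : N.QDart → M) :
    ∑ d, f (rev d) = ∑ d, f d :=
  Equiv.sum_comp rev_involutive.toPerm f

theorem two_length : 2 * N.length = ∑ d : N.QDart, ‖vec d‖ := by
  have := N.finite_edges
  have := Fintype.ofFinite N.QEdge
  rw [length, finsum_eq_sum_of_fintype, ← Finset.sum_fiberwise (g := (edge : N.QDart → N.QEdge)),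
    Finset.mul_sum]
  refine Finset.sum_congr rfl fun e _ => ?_
  obtain ⟨d, rfl⟩ := edge_surjective e
  have : (Finset.univ.filter fun d' : N.QDart => edge d' = edge d) = {d, rev d} := by
    ext d'
    simp only [Finset.mem_filter, Finset.mem_univ, true_and, Finset.mem_insert,
      Finset.mem_singleton]
    rw [eq_comm, edge_eq_iff]
  rw [this, Finset.sum_pair (rev_ne d).symm, norm_vec, vec_rev, norm_neg, two_mul]

/-- The darts at a vertex of the network correspond to those at its class in the quotient. -/
def neighborEquiv (x : V) : N.graph.neighborSet x ≃ {d : N.QDart // src d = N.mkV x} :=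
  Equiv.ofBijective (fun y => ⟨mkDart y.2, rfl⟩) <| by
    constructor
    · rintro ⟨y, hy⟩ ⟨y', hy'⟩ e
      obtain ⟨g, h1, h2⟩ := mkDart_eq_iff.1 (Subtype.ext_iff.1 e)
      have : g = 0 := N.vadd_eq_self h1
      subst this
      simpa using h2
    · rintro ⟨d, hd⟩
      induction d using QDart.ind with
      | _ x' y' h =>
        obtain ⟨g, rfl⟩ := mkV_eq_iff.1 hd
        exact ⟨⟨g +ᵥ y', N.adj_vadd _ _ _ h⟩, Subtype.ext (mkDart_eq_iff.2 ⟨-g, by simp⟩)⟩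

instance (x : V) : Finite (N.graph.neighborSet x) := Finite.of_equiv _ (neighborEquiv x).symm

theorem ncard_neighborSet (x : V) :
    (N.graph.neighborSet x).ncard = (Finset.univ.filter fun d : N.QDart => src d = N.mkV x).card := by
  rw [← Nat.card_coe_set_eq, Nat.card_congr (neighborEquiv x), Nat.card_eq_fintype_card,
    Fintype.card_subtype]

theorem exists_dart_of_src {x : V} {d : N.QDart} (h : src d = N.mkV x) :
    ∃ (y : V) (hy : N.graph.Adj x y), d = mkDart hy := by
  obtain ⟨y, hy⟩ := (neighborEquiv x).surjective ⟨d, h⟩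
  exact ⟨y, y.2, (Subtype.ext_iff.1 hy).symm⟩

theorem mkDart_injective {x y y' : V} {h : N.graph.Adj x y} {h' : N.graph.Adj x y'}
    (e : mkDart h = mkDart h') : y = y' := by
  have := (neighborEquiv x).injective (a₁ := ⟨y, h⟩) (a₂ := ⟨y', h'⟩) (Subtype.ext e)
  exact Subtype.ext_iff.1 this

theorem finsum_neighborSet {M : Type*} [AddCommMonoid M] (x : V) (f : N.QDart → M) (f' : V → M)
    (hf : ∀ (y : V) (h : N.graph.Adj x y), f (mkDart h) = f' y) :
    ∑ᶠ y ∈ N.graph.neighborSet x, f' y = ∑ d with src d = N.mkV x, f d := by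
  rw [finsum_mem_eq_finite_toFinset_sum _ (Set.toFinite _)]
  refine Finset.sum_bij' (fun y hy => mkDart (N := N) (x := x) (y := y) (by simpa using hy))
    (fun d hd => ((neighborEquiv x).symm ⟨d, by simpa using hd⟩ : V)) ?_ ?_ ?_ ?_ ?_
  · intro y hy; simp
  · intro d hd
    simp
  · intro y hy
    have : (⟨mkDart (N := N) (x := x) (y := y) (by simpa using hy), rfl⟩ :
      {d : N.QDart // src d = N.mkV x}) = neighborEquiv x ⟨y, by simpa using hy⟩ := rfl
    rw [this, Equiv.symm_apply_apply]
  · intro d hd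
    exact congrArg Subtype.val ((neighborEquiv x).apply_symm_apply ⟨d, by simpa using hd⟩)
  · intro y hy
    exact (hf y _).symm

/-- A nonempty set of vertices closed under adjacency is everything. -/
theorem eq_univ_of_closed (N : PeriodicNetwork Λ V) {A : Set V} {x : V} (hx : x ∈ A)
    (h : ∀ a b, a ∈ A → N.graph.Adj a b → b ∈ A) (y : V) : y ∈ A := by
  obtain ⟨p⟩ := N.connected.preconnected x y
  induction p with
  | nil => exact hx
  | cons hab _ ih => exact ih (h _ _ hx hab)

end PeriodicNetwork

/-! ### Flows on the quotient graph, their flux, and the covectors -/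

namespace PeriodicNetwork

variable {n : ℕ} {Λ : Submodule ℤ (EuclideanSpace ℝ (Fin n))} {V : Type*} [AddAction Λ V]
variable {N : PeriodicNetwork Λ V}

/-- Representatives of the vertex orbits split the edge vectors into a coboundary and a function
with values in Λ. The coboundary cancels around cycles, which is why cycles have flux in Λ. -/
theorem exists_potential (N : PeriodicNetwork Λ V) :
    ∃ (p : N.QVertex → EuclideanSpace ℝ (Fin n)) (τ : N.QDart → Λ),
      ∀ d, vec d = p (tgt d) - p (src d) + τ d := by
  obtain ⟨r, hr⟩ := (mkV_surjective (N := N)).hasRightInverse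
  have : ∀ x : V, ∃ g : Λ, g +ᵥ r (N.mkV x) = x := fun x => mkV_eq_iff.1 (hr _)
  choose g hg using this
  have : ∀ d : N.QDart, ∃ t : Λ, vec d = N.pos (r (tgt d)) - N.pos (r (src d)) + t := by
    intro d
    induction d using QDart.ind with
    | _ x y h =>
      refine ⟨g y - g x, ?_⟩
      have h1 := congrArg N.pos (hg x)
      have h2 := congrArg N.pos (hg y)
      rw [N.pos_vadd] at h1 h2
      simp only [vec_mkDart, tgt_mkDart, src_mkDart, Submodule.coe_sub]
      rw [← h1, ← h2]
      abel
  choose τ hτ using this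
  exact ⟨fun q => N.pos (r q), τ, hτ⟩

/-- Real flows on the quotient graph. -/
def flows (N : PeriodicNetwork Λ V) : Submodule ℝ (N.QDart → ℝ) where
  carrier := {z | (∀ d, z (rev d) = - z d) ∧ ∀ q, ∑ d with src d = q, z d = 0}
  zero_mem' := by simp
  add_mem' := by
    rintro a b ⟨h1, h2⟩ ⟨h3, h4⟩
    refine ⟨fun d => ?_, fun q => ?_⟩
    · simp [h1, h3]; ring
    · simp [Finset.sum_add_distrib, h2, h4]
  smul_mem' := by
    rintro c a ⟨h1, h2⟩
    refine ⟨fun d => ?_, fun q => ?_⟩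
    · simp [h1]
    · simp [← Finset.mul_sum, h2]

/-- The pairing of a flow with the edge vectors. -/
def flux (N : PeriodicNetwork Λ V) : (N.QDart → ℝ) →ₗ[ℝ] EuclideanSpace ℝ (Fin n) where
  toFun z := (1 / 2 : ℝ) • ∑ d, z d • vec d
  map_add' a b := by simp [add_smul, Finset.sum_add_distrib]
  map_smul' c a := by
    simp only [Pi.smul_apply, smul_eq_mul, mul_smul, ← Finset.smul_sum, RingHom.id_apply]
    rw [smul_comm]

theorem flux_apply (z : N.QDart → ℝ) : N.flux z = (1 / 2 : ℝ) • ∑ d, z d • vec d := rfl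

/-- The signed indicator function of a set of darts. -/
def circ (P : Finset N.QDart) (d : N.QDart) : ℝ :=
  (if d ∈ P then 1 else 0) - (if rev d ∈ P then 1 else 0)

theorem circ_rev (P : Finset N.QDart) (d : N.QDart) : circ P (rev d) = - circ P d := by
  simp [circ]

theorem sum_circ (P : Finset N.QDart) (q : N.QVertex) :
    ∑ d with src d = q, circ P d =
      ∑ d ∈ P, ((if src d = q then 1 else 0) - (if tgt d = q then 1 else 0)) := by
  rw [Finset.sum_filter]
  have h1 : ∑ d : N.QDart, (if src d = q then circ P d else 0) =
      ∑ d : N.QDart, (if d ∈ P then (if src d = q then (1 : ℝ) else 0) else 0) -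
      ∑ d : N.QDart, (if rev d ∈ P then (if src d = q then (1 : ℝ) else 0) else 0) := by
    rw [← Finset.sum_sub_distrib]
    refine Finset.sum_congr rfl fun d _ => ?_
    unfold circ
    split_ifs <;> simp
  rw [h1, ← sum_rev (fun d => if rev d ∈ P then (if src d = q then (1 : ℝ) else 0) else 0)]
  simp [Finset.sum_sub_distrib]

theorem flux_circ (P : Finset N.QDart) : N.flux (circ P) = ∑ d ∈ P, vec d := by
  have h1 : ∑ d : N.QDart, circ P d • vec d = ∑ d : N.QDart, (if d ∈ P then vec d else 0) -
      ∑ d : N.QDart, (if rev d ∈ P then vec d else 0) := by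
    rw [← Finset.sum_sub_distrib]
    refine Finset.sum_congr rfl fun d _ => ?_
    unfold circ
    split_ifs <;> simp
  rw [flux_apply, h1, ← sum_rev (fun d => if rev d ∈ P then vec d else 0)]
  simp only [rev_rev, vec_rev]
  rw [← Finset.sum_filter, ← Finset.sum_filter, Finset.sum_neg_distrib, sub_neg_eq_add,
    ← two_smul ℝ, smul_smul]
  simp

section cycles

variable {P : Finset N.QDart} {next : N.QDart → N.QDart}

/-- A permutation `next` of P that joins each dart to one starting at its end exhibits P as a union
of cycles. Every vertex is then entered as often as it is left. -/
theorem sum_src_eq_sum_tgt {M : Type*} [AddCommMonoid M] (hb : Set.BijOn next P P)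
    (hs : ∀ d ∈ P, src (next d) = tgt d) (f : N.QVertex → M) :
    ∑ d ∈ P, f (src d) = ∑ d ∈ P, f (tgt d) := by
  rw [← Finset.sum_nbij next hb.mapsTo hb.injOn hb.surjOn (g := fun d => f (src d))
    (f := fun d => f (src (next d))) fun _ _ => rfl]
  exact Finset.sum_congr rfl fun d hd => by rw [hs d hd]

theorem circ_mem_flows (hb : Set.BijOn next P P) (hs : ∀ d ∈ P, src (next d) = tgt d) :
    circ P ∈ N.flows := by
  refine ⟨circ_rev P, fun q => ?_⟩
  rw [sum_circ, Finset.sum_sub_distrib,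
    sum_src_eq_sum_tgt hb hs (fun q' => if q' = q then (1 : ℝ) else 0), sub_self]

theorem sum_vec_mem (hb : Set.BijOn next P P) (hs : ∀ d ∈ P, src (next d) = tgt d) :
    ∑ d ∈ P, vec d ∈ Λ := by
  obtain ⟨p, τ, h⟩ := exists_potential N
  simp only [h, Finset.sum_add_distrib, Finset.sum_sub_distrib]
  rw [sum_src_eq_sum_tgt hb hs, sub_self, zero_add]
  exact Submodule.sum_mem _ fun d _ => (τ d).2

end cycles

/-- The support of every nonzero flow contains a cycle. -/
theorem exists_cycle_flow {z : N.QDart → ℝ} (hz : z ∈ N.flows) (h0 : z ≠ 0) :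
    ∃ y ∈ N.flows, y ≠ 0 ∧ (∀ d, z d = 0 → y d = 0) ∧ (∀ d, y d = 0 ∨ y d = 1 ∨ y d = -1) ∧
      N.flux y ∈ Λ := by
  -- The reverse of d leaves the final vertex of d with a negative value, so by conservation some
  -- dart leaves it with a positive value.
  have hstep : ∀ d : N.QDart, 0 < z d → ∃ e, 0 < z e ∧ src e = tgt d := by
    intro d hd
    by_contra hcon
    push Not at hcon
    have h1 := hz.2 (tgt d)
    have h2 : ∑ e with src e = tgt d, z e < 0 := by
      refine Finset.sum_neg' (fun e he => ?_) ⟨rev d, by simp, ?_⟩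
      · by_contra hlt
        exact hcon e (not_le.1 hlt) (by simpa using he)
      · rw [hz.1]; linarith
    linarith
  have hstep' : ∀ d : N.QDart, ∃ e, 0 < z d → 0 < z e ∧ src e = tgt d := fun d => by
    by_cases hd : 0 < z d
    · exact (hstep d hd).imp fun e he _ => he
    · exact ⟨d, fun h => absurd h hd⟩
  choose next hn using hstep'
  have hn1 : ∀ d, 0 < z d → 0 < z (next d) := fun d hd => (hn d hd).1
  have hn2 : ∀ d, 0 < z d → src (next d) = tgt d := fun d hd => (hn d hd).2
  have hiter : ∀ (k : ℕ) (d : N.QDart), 0 < z d → 0 < z (next^[k] d) := by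
    intro k
    induction k with
    | zero => intro d hd; exact hd
    | succ k ih => intro d hd; exact ih _ (hn1 d hd)
  obtain ⟨d0, hd0⟩ : ∃ d, 0 < z d := by
    obtain ⟨d, hd⟩ := Function.ne_iff.1 h0
    rcases lt_or_gt_of_ne hd with h | h
    · exact ⟨rev d, by rw [hz.1]; simpa using h⟩
    · exact ⟨d, h⟩
  -- All periodic darts of `next` are taken at once. They may form several cycles, which does no
  -- harm since only the values 0, ±1 and the flux matter.
  set P : Finset N.QDart := Finset.univ.filter fun d => 0 < z d ∧ d ∈ Function.periodicPts next
    with hP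
  have memP : ∀ d, d ∈ P ↔ 0 < z d ∧ d ∈ Function.periodicPts next := by simp [hP]
  have hb : Set.BijOn next P P := by
    refine ⟨fun d hd => ?_, fun d hd d' hd' e => ?_, fun d hd => ?_⟩
    · rw [Finset.mem_coe, memP] at hd ⊢
      exact ⟨hn1 d hd.1, (Function.bijOn_periodicPts next).mapsTo hd.2⟩
    · rw [Finset.mem_coe, memP] at hd hd'
      exact (Function.bijOn_periodicPts next).injOn hd.2 hd'.2 e
    · rw [Finset.mem_coe, memP] at hd
      obtain ⟨hd, k, hk, hper⟩ := hd
      obtain ⟨k, rfl⟩ : ∃ m, k = m + 1 := ⟨k - 1, by omega⟩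
      refine ⟨next^[k] d, ?_, ?_⟩
      · rw [Finset.mem_coe, memP]
        exact ⟨hiter k d hd, k + 1, hk, hper.apply_iterate k⟩
      · exact (Function.iterate_succ_apply' next k d).symm.trans hper
  have hs : ∀ d ∈ P, src (next d) = tgt d := fun d hd => hn2 d ((memP d).1 hd).1
  -- An orbit of `next` in the finite set of darts repeats, so it reaches a periodic dart.
  obtain ⟨d1, hd1⟩ : P.Nonempty := by
    obtain ⟨i, j, hij, e⟩ := Finite.exists_ne_map_eq_of_infinite fun k : ℕ => next^[k] d0
    wlog hlt : i < j generalizing i j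
    · exact this j i hij.symm e.symm (by omega)
    refine ⟨next^[i] d0, (memP _).2 ⟨hiter i d0 hd0, j - i, by omega, ?_⟩⟩
    change next^[j - i] (next^[i] d0) = next^[i] d0
    rw [← Function.iterate_add_apply, Nat.sub_add_cancel hlt.le]
    exact e.symm
  have hpos : ∀ d ∈ P, 0 < z d := fun d hd => ((memP d).1 hd).1
  -- Only one of d and `rev d` can have a positive value, so no cancellation occurs in `circ P`.
  have hrev : ∀ d ∈ P, rev d ∉ P := fun d hd hd' => by
    have h1 := hpos _ hd
    have h2 := hpos _ hd'
    rw [hz.1] at h2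
    linarith
  refine ⟨circ P, circ_mem_flows hb hs, fun h => ?_, fun d hd => ?_, fun d => ?_, ?_⟩
  · have := congrFun h d1
    simp [circ, hd1, hrev d1 hd1] at this
  · have h1 : d ∉ P := fun h => (hpos d h).ne' hd
    have h2 : rev d ∉ P := fun h => (hpos _ h).ne' (by rw [hz.1, hd, neg_zero])
    simp [circ, h1, h2]
  · unfold circ
    by_cases h1 : d ∈ P
    · simp [h1, hrev d h1]
    · by_cases h2 : rev d ∈ P <;> simp [h1, h2]
  · rw [flux_circ]; exact sum_vec_mem hb hs

/-- A walk defines a 1-chain whose boundary is the difference of its ends and whose flux telescopes.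
If the ends lie in one orbit, the chain is a flow. -/
theorem exists_chain {x y : V} (p : N.graph.Walk x y) :
    ∃ z : N.QDart → ℝ, (∀ d, z (rev d) = - z d) ∧
      (∀ q, ∑ d with src d = q, z d =
        (if N.mkV x = q then 1 else 0) - (if N.mkV y = q then 1 else 0)) ∧
      N.flux z = N.pos y - N.pos x := by
  induction p with
  | nil => exact ⟨0, by simp, by simp, by simp⟩
  | @cons a b c h p ih =>
    obtain ⟨z, h1, h2, h3⟩ := ih
    refine ⟨circ {mkDart h} + z, fun d => ?_, fun q => ?_, ?_⟩
    · simp [h1, circ_rev]; ring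
    · simp only [Pi.add_apply, Finset.sum_add_distrib, h2, sum_circ, Finset.sum_singleton,
        src_mkDart, tgt_mkDart]
      by_cases ha : N.mkV a = q <;> by_cases hb : N.mkV b = q <;>
        by_cases hc : N.mkV c = q <;> simp [ha, hb, hc]
    · rw [map_add, h3, flux_circ]
      simp

theorem exists_flow_of_mem (N : PeriodicNetwork Λ V) (g : Λ) :
    ∃ z ∈ N.flows, N.flux z = (g : EuclideanSpace ℝ (Fin n)) := by
  obtain ⟨x⟩ := N.connected.nonempty
  obtain ⟨p⟩ := N.connected.preconnected x (g +ᵥ x)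
  obtain ⟨z, h1, h2, h3⟩ := exists_chain p
  exact ⟨z, ⟨h1, fun q => by simp [h2]⟩, by simp [h3, N.pos_vadd]⟩

theorem map_flux_flows (N : PeriodicNetwork Λ V)
    (hΛ : Submodule.span ℝ (Λ : Set (EuclideanSpace ℝ (Fin n))) = ⊤) :
    N.flows.map N.flux = ⊤ := by
  rw [eq_top_iff, ← hΛ, Submodule.span_le]
  intro g hg
  obtain ⟨z, hz, h⟩ := exists_flow_of_mem N ⟨g, hg⟩
  exact ⟨z, hz, h⟩

/-- A system of covectors, given by coordinates on a minimal sufficient space of flows. -/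
theorem exists_covectors (N : PeriodicNetwork Λ V)
    (hΛ : Submodule.span ℝ (Λ : Set (EuclideanSpace ℝ (Fin n))) = ⊤) :
    ∃ γ : N.QDart → EuclideanSpace ℝ (Fin n),
      (∀ x, (fun d => inner ℝ (γ d) x) ∈ N.flows) ∧
      (∀ x, N.flux (fun d => inner ℝ (γ d) x) = x) ∧
      (∀ z ∈ N.flows, (∀ d, γ d = 0 → z d = 0) → ∀ d, z d = inner ℝ (γ d) (N.flux z)) := by
  -- Sets of darts, closed under reversal, that carry enough flows to produce every vector as flux.
  -- A minimal one carries no nonzero flow of flux zero.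
  set p : Finset N.QDart → Prop := fun S => (∀ d ∈ S, rev d ∈ S) ∧
    ∀ x, ∃ z ∈ N.flows, (∀ d, d ∉ S → z d = 0) ∧ N.flux z = x with hp
  have hne : ({S | p S} : Set (Finset N.QDart)).Nonempty := by
    refine ⟨Finset.univ, by simp, fun x => ?_⟩
    have : x ∈ N.flows.map N.flux := by rw [map_flux_flows N hΛ]; trivial
    obtain ⟨z, hz, h⟩ := this
    exact ⟨z, hz, by simp, h⟩
  obtain ⟨S, hS⟩ := (Set.toFinite {S | p S}).exists_minimal hne
  obtain ⟨hrev, hsurj⟩ : p S := hS.prop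
  have hinj : ∀ z ∈ N.flows, (∀ d, d ∉ S → z d = 0) → N.flux z = 0 → z = 0 := by
    intro z hz hzS h0
    by_contra hne0
    obtain ⟨d0, hd0⟩ := Function.ne_iff.1 hne0
    have hd0' : z d0 ≠ 0 := hd0
    have hd0S : d0 ∈ S := by
      by_contra h
      exact hd0' (hzS d0 h)
    have hS' : p ((S.erase d0).erase (rev d0)) := by
      refine ⟨fun d hd => ?_, fun x => ?_⟩
      · simp only [Finset.mem_erase] at hd ⊢
        refine ⟨fun h => hd.2.1 (rev_involutive.injective h), fun h => hd.1 ?_, hrev d hd.2.2⟩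
        rw [← h, rev_rev]
      · obtain ⟨w, hw, hwS, hwx⟩ := hsurj x
        -- As z has flux zero, this keeps the flux of w, while it clears the value at d0 and, by
        -- antisymmetry, at its reverse. So d0 could be removed from S.
        refine ⟨w - (w d0 / z d0) • z, N.flows.sub_mem hw (N.flows.smul_mem _ hz),
          fun d hd => ?_, by rw [map_sub, map_smul, h0, hwx]; simp⟩
        by_cases h : d = d0
        · subst h; simp [hd0']
        by_cases h' : d = rev d0
        · subst h'
          simp only [Pi.sub_apply, Pi.smul_apply, smul_eq_mul, hw.1, hz.1]
          field_simp
          ring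
        · have : d ∉ S := fun hdS => hd (by simp [h, h', hdS])
          simp [hwS d this, hzS d this]
    have := hS.le_of_le hS' ((Finset.erase_subset _ _).trans (Finset.erase_subset _ _)) hd0S
    simp at this
  let F : Submodule ℝ (N.QDart → ℝ) := N.flows ⊓
    { carrier := {z | ∀ d, d ∉ S → z d = 0}
      zero_mem' := by simp
      add_mem' := fun {a b} ha hb d hd => by simp [ha d hd, hb d hd]
      smul_mem' := fun c a ha d hd => by simp [ha d hd] }
  have hF : ∀ z, z ∈ F ↔ z ∈ N.flows ∧ ∀ d, d ∉ S → z d = 0 := fun z => Iff.rfl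
  let e : F ≃ₗ[ℝ] EuclideanSpace ℝ (Fin n) := LinearEquiv.ofBijective (N.flux.domRestrict F) <| by
    constructor
    · rw [← LinearMap.ker_eq_bot, LinearMap.ker_eq_bot']
      rintro ⟨z, hz⟩ h
      exact Subtype.ext (hinj z hz.1 hz.2 h)
    · intro x
      obtain ⟨z, hz, hzS, h⟩ := hsurj x
      exact ⟨⟨z, hz, hzS⟩, h⟩
  have he : ∀ z : F, e z = N.flux z := fun z => rfl
  -- The covector γ d represents the functional sending x to the value at d of the unique flow on S
  -- with flux x. It vanishes for d outside S.
  let γ : N.QDart → EuclideanSpace ℝ (Fin n) := fun d =>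
    (InnerProductSpace.toDual ℝ _).symm
      (LinearMap.toContinuousLinearMap (LinearMap.proj d ∘ₗ F.subtype ∘ₗ e.symm.toLinearMap))
  have hγ : ∀ x, (fun d => inner ℝ (γ d) x) = (e.symm x : N.QDart → ℝ) := by
    intro x
    funext d
    simp [γ]
  have hγS : ∀ d, d ∉ S → γ d = 0 := by
    intro d hd
    refine ext_inner_right ℝ fun x => ?_
    rw [inner_zero_left]
    exact (congrFun (hγ x) d).trans ((e.symm x).2.2 d hd)
  refine ⟨γ, fun x => ?_, fun x => ?_, fun z hz hz0 d => ?_⟩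
  · rw [hγ]; exact (e.symm x).2.1
  · rw [hγ, ← he, e.apply_symm_apply]
  · have hzF : z ∈ F := (hF z).2 ⟨hz, fun d hd => hz0 d (hγS d hd)⟩
    have h1 := congrFun (hγ (e ⟨z, hzF⟩)) d
    rw [e.symm_apply_apply] at h1
    exact h1.symm

end PeriodicNetwork

/-! ### Unimodular systems of rank three and the root system D₃ -/

section roots

/-- Pairs of coordinates of a unimodular system have a common sign pattern. -/
theorem exists_common_sign {D : Type*} (x y : D → ℤ) (hx : ∀ d, x d = 0 ∨ x d = 1 ∨ x d = -1)
    (hy : ∀ d, y d = 0 ∨ y d = 1 ∨ y d = -1)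
    (h : ∀ d e, |x d * y e - y d * x e| ≤ 1) :
    ∃ s : ℤ, (s = 1 ∨ s = -1) ∧ ∀ d, x d * y d = 0 ∨ x d * y d = s := by
  -- If the products at d and at e were 1 and -1, the corresponding 2 × 2 minor would be ±2.
  by_cases h1 : ∃ d, x d * y d = 1
  · obtain ⟨d, hd⟩ := h1
    refine ⟨1, Or.inl rfl, fun e => ?_⟩
    have := h d e
    rcases hx d with a | a | a <;> rcases hy d with b | b | b <;> rcases hx e with a' | a' | a' <;>
      rcases hy e with b' | b' | b' <;> simp [a, b, a', b'] at hd this ⊢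
  · refine ⟨-1, Or.inr rfl, fun e => ?_⟩
    push Not at h1
    have := h1 e
    rcases hx e with a' | a' | a' <;>
      rcases hy e with b' | b' | b' <;> simp [a', b'] at this ⊢

/-- Three nonzero numbers cannot have pairwise negative products, so the vector is 0, ±eᵢ or ±(eᵢ -
eⱼ). The coordinates x + y, x + z, y + z turn the nonzero ones into roots. -/
theorem root_of_pattern_neg {x y z : ℤ} (hx : x = 0 ∨ x = 1 ∨ x = -1) (hy : y = 0 ∨ y = 1 ∨ y = -1)
    (hz : z = 0 ∨ z = 1 ∨ z = -1) (hxy : x * y = 0 ∨ x * y = -1) (hxz : x * z = 0 ∨ x * z = -1)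
    (hyz : y * z = 0 ∨ y * z = -1) :
    (x + y) ^ 2 + (x + z) ^ 2 + (y + z) ^ 2 = 0 ∨ (x + y) ^ 2 + (x + z) ^ 2 + (y + z) ^ 2 = 2 := by
  rcases hx with rfl | rfl | rfl <;> rcases hy with rfl | rfl | rfl <;>
    rcases hz with rfl | rfl | rfl <;> simp at hxy hxz hyz ⊢

/-- Up to sign the vector has entries 0 and 1, and the hypothesis `h` excludes (1, 0, 1). The
remaining nonzero vectors have consecutive ones, as positive roots of A₃ do in simple roots, and the
coordinates y, x - y + z, z - x identify A₃ with D₃. -/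
theorem root_of_pattern_pos {x y z : ℤ} (hx : x = 0 ∨ x = 1 ∨ x = -1) (hy : y = 0 ∨ y = 1 ∨ y = -1)
    (hz : z = 0 ∨ z = 1 ∨ z = -1) (hxy : x * y = 0 ∨ x * y = 1) (hxz : x * z = 0 ∨ x * z = 1)
    (hyz : y * z = 0 ∨ y * z = 1) (h : ¬ (x * z = 1 ∧ y = 0)) :
    y ^ 2 + (x - y + z) ^ 2 + (z - x) ^ 2 = 0 ∨ y ^ 2 + (x - y + z) ^ 2 + (z - x) ^ 2 = 2 := by
  rcases hx with rfl | rfl | rfl <;> rcases hy with rfl | rfl | rfl <;>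
    rcases hz with rfl | rfl | rfl <;> simp at hxy hxz hyz h ⊢

/-- A unimodular system of integer vectors of rank three embeds into the root system `D₃`. -/
theorem exists_root_matrix {D : Type*} (x y z : D → ℤ) (hx : ∀ d, x d = 0 ∨ x d = 1 ∨ x d = -1)
    (hy : ∀ d, y d = 0 ∨ y d = 1 ∨ y d = -1) (hz : ∀ d, z d = 0 ∨ z d = 1 ∨ z d = -1)
    (hxy : ∀ d e, |x d * y e - y d * x e| ≤ 1) (hxz : ∀ d e, |x d * z e - z d * x e| ≤ 1)
    (hyz : ∀ d e, |y d * z e - z d * y e| ≤ 1)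
    (ht : ∀ d e f, z d = 0 → y e = 0 → x f = 0 → x d * z e * y f + y d * x e * z f ≠ 2 ∧
      x d * z e * y f + y d * x e * z f ≠ -2) :
    ∃ R : Matrix (Fin 3) (Fin 3) ℤ, R.det ≠ 0 ∧ ∀ d, ∃ u : Fin 3 → ℤ,
      (∀ j, u j = x d * R 0 j + y d * R 1 j + z d * R 2 j) ∧
      (u 0 ^ 2 + u 1 ^ 2 + u 2 ^ 2 = 0 ∨ u 0 ^ 2 + u 1 ^ 2 + u 2 ^ 2 = 2) := by
  obtain ⟨s, hs, hs'⟩ := exists_common_sign x y hx hy hxy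
  obtain ⟨t, ht1, ht'⟩ := exists_common_sign x z hx hz hxz
  obtain ⟨w, hw, hw'⟩ := exists_common_sign y z hy hz hyz
  have hss : s * s = 1 := by rcases hs with rfl | rfl <;> rfl
  have htt : t * t = 1 := by rcases ht1 with rfl | rfl <;> rfl
  have hsne : s ≠ 0 := fun h => by simp [h] at hss
  have htne : t ≠ 0 := fun h => by simp [h] at htt
  have scale : ∀ (e : ℤ), (e = 1 ∨ e = -1) → ∀ a : ℤ, (a = 0 ∨ a = 1 ∨ a = -1) →
      (e * a = 0 ∨ e * a = 1 ∨ e * a = -1) := by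
    rintro e (rfl | rfl) a (rfl | rfl | rfl) <;> simp
  -- Changing the signs of y and z makes the three pairwise products all nonpositive if s t w = -1,
  -- and all nonnegative if s t w = 1.
  by_cases hprod : w = - (s * t)
  · have hns : -s = 1 ∨ -s = -1 := by rcases hs with rfl | rfl <;> simp
    have hnt : -t = 1 ∨ -t = -1 := by rcases ht1 with rfl | rfl <;> simp
    refine ⟨!![1, 1, 0; -s, 0, -s; 0, -t, -t], ?_, fun d => ⟨_, fun j => rfl, ?_⟩⟩
    · simp [Matrix.det_fin_three]
      rcases hs with rfl | rfl <;> rcases ht1 with rfl | rfl <;> norm_num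
    · have := root_of_pattern_neg (hx d) (scale _ hns _ (hy d)) (scale _ hnt _ (hz d))
        (by rcases hs' d with h | h
            · left; linear_combination (-s) * h
            · right; linear_combination (-s) * h - hss)
        (by rcases ht' d with h | h
            · left; linear_combination (-t) * h
            · right; linear_combination (-t) * h - htt)
        (by rcases hw' d with h | h
            · left; linear_combination (s * t) * h
            · right; linear_combination (s * t) * h + s * t * hprod - t * t * hss - htt)
      simp
      convert this using 2 <;> ring
  · have hw1 : w = s * t := by
      rcases hs with rfl | rfl <;> rcases ht1 with rfl | rfl <;> rcases hw with rfl | rfl <;>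
        simp at hprod ⊢
    have p1 : ∀ d, x d * (s * y d) = 0 ∨ x d * (s * y d) = 1 := fun d => by
      rcases hs' d with h | h
      · left; linear_combination s * h
      · right; linear_combination s * h + hss
    have p2 : ∀ d, x d * (t * z d) = 0 ∨ x d * (t * z d) = 1 := fun d => by
      rcases ht' d with h | h
      · left; linear_combination t * h
      · right; linear_combination t * h + htt
    have p3 : ∀ d, s * y d * (t * z d) = 0 ∨ s * y d * (t * z d) = 1 := fun d => by
      rcases hw' d with h | h
      · left; linear_combination s * t * h
      · right; linear_combination s * t * h + s * t * hw1 + t * t * hss + htt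
    have q1 := fun d => scale _ hs _ (hy d)
    have q2 := fun d => scale _ ht1 _ (hz d)
    -- After the sign change, if one of the three vectors with exactly two ones does not occur, then
    -- `root_of_pattern_pos` applies with the missing zero placed in the middle.
    by_cases hy0 : ∀ d, ¬ (x d * (t * z d) = 1 ∧ s * y d = 0)
    · refine ⟨!![0, 1, -1; s, -s, 0; 0, t, t], ?_, fun d => ⟨_, fun j => rfl, ?_⟩⟩
      · simp [Matrix.det_fin_three]
        rcases hs with rfl | rfl <;> rcases ht1 with rfl | rfl <;> norm_num
      · have := root_of_pattern_pos (hx d) (q1 d) (q2 d) (p1 d) (p2 d) (p3 d) (hy0 d)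
        simp
        convert this using 2 <;> ring
    by_cases hx0 : ∀ d, ¬ (s * y d * (t * z d) = 1 ∧ x d = 0)
    · refine ⟨!![1, -1, 0; 0, s, -s; 0, t, t], ?_, fun d => ⟨_, fun j => rfl, ?_⟩⟩
      · simp [Matrix.det_fin_three]
        rcases hs with rfl | rfl <;> rcases ht1 with rfl | rfl <;> norm_num
      · have := root_of_pattern_pos (q1 d) (hx d) (q2 d) (by rw [mul_comm]; exact p1 d) (p3 d)
          (p2 d) (hx0 d)
        simp
        convert this using 2 <;> ring
    by_cases hz0 : ∀ d, ¬ (x d * (s * y d) = 1 ∧ t * z d = 0)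
    · refine ⟨!![0, 1, -1; 0, s, s; t, -t, 0], ?_, fun d => ⟨_, fun j => rfl, ?_⟩⟩
      · simp [Matrix.det_fin_three]
        rcases hs with rfl | rfl <;> rcases ht1 with rfl | rfl <;> norm_num
      · have := root_of_pattern_pos (hx d) (q2 d) (q1 d) (p2 d) (p1 d)
          (by rw [mul_comm]; exact p3 d) (hz0 d)
        simp
        convert this using 2 <;> ring
    -- If (1, 1, 0), (1, 0, 1) and (0, 1, 1) all occur up to sign, their determinant is ±2, against
    -- `ht`.
    exfalso
    push Not at hy0 hx0 hz0
    obtain ⟨e, he1, he2⟩ := hy0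
    obtain ⟨f, hf1, hf2⟩ := hx0
    obtain ⟨d, hd1, hd2⟩ := hz0
    have key := ht d e f ((mul_eq_zero.1 hd2).resolve_left htne)
      ((mul_eq_zero.1 he2).resolve_left hsne) hf2
    have nz : ∀ a b : ℤ, a * b = 1 → b * a = 1 ∧ (a = 1 ∧ b = 1 ∨ a = -1 ∧ b = -1) :=
      fun a b h => ⟨by rw [mul_comm]; exact h, Int.mul_eq_one_iff_eq_one_or_neg_one.1 h⟩
    obtain ⟨_, hd⟩ := nz _ _ hd1
    obtain ⟨_, he⟩ := nz _ _ he1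
    obtain ⟨_, hf⟩ := nz _ _ hf1
    have e1 : s * (s * y d) = y d := by rw [← mul_assoc, hss, one_mul]
    have e2 : t * (t * z e) = z e := by rw [← mul_assoc, htt, one_mul]
    have e3 : s * (s * y f) = y f := by rw [← mul_assoc, hss, one_mul]
    have e4 : t * (t * z f) = z f := by rw [← mul_assoc, htt, one_mul]
    rw [← e1, ← e2, ← e3, ← e4] at key
    rcases hd with ⟨a, b⟩ | ⟨a, b⟩ <;> rcases he with ⟨a', b'⟩ | ⟨a', b'⟩ <;>
      rcases hf with ⟨a'', b''⟩ | ⟨a'', b''⟩ <;> rw [a, b, a', b', a'', b''] at key <;>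
      rcases hs with rfl | rfl <;> rcases ht1 with rfl | rfl <;> norm_num at key

end roots

/-! ### Unimodularity of the covectors -/

namespace PeriodicNetwork

variable {Λ : Submodule ℤ (EuclideanSpace ℝ (Fin 3))} {V : Type*} [AddAction Λ V]
variable {N : PeriodicNetwork Λ V}

/-- `γ` is a system of covectors as provided by `exists_covectors`. -/
structure IsCovectorSystem (N : PeriodicNetwork Λ V)
    (γ : N.QDart → EuclideanSpace ℝ (Fin 3)) : Prop where
  mem_flows : ∀ x, (fun d => inner ℝ (γ d) x) ∈ N.flows
  flux_eq : ∀ x, N.flux (fun d => inner ℝ (γ d) x) = x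
  eq_inner : ∀ z ∈ N.flows, (∀ d, γ d = 0 → z d = 0) → ∀ d, z d = inner ℝ (γ d) (N.flux z)

variable {γ : N.QDart → EuclideanSpace ℝ (Fin 3)}

/-- By `hβ` the flow of β has minimal support, so a cycle inside this support is proportional to it.
The normalization at `a` makes the factor ±1, so β inherits the coefficients 0, ±1 and the
membership in Λ. -/
theorem IsCovectorSystem.elementary (h : IsCovectorSystem N γ) {β : EuclideanSpace ℝ (Fin 3)}
    {a : N.QDart} (ha : inner ℝ (γ a) β = 1)
    (hβ : ∀ x, (∀ d, inner ℝ (γ d) β = 0 → inner ℝ (γ d) x = 0) → ∃ c : ℝ, x = c • β) :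
    β ∈ Λ ∧ ∀ d, inner ℝ (γ d) β = 0 ∨ inner ℝ (γ d) β = 1 ∨ inner ℝ (γ d) β = -1 := by
  obtain ⟨y, hy, hy0, hsupp, hval, hΛ⟩ := exists_cycle_flow (h.mem_flows β)
    (fun h0 => by have := congrFun h0 a; simp [ha] at this)
  have hyγ := h.eq_inner y hy fun d hd => hsupp d (by simp [hd])
  obtain ⟨c, hc⟩ := hβ (N.flux y) fun d hd => by rw [← hyγ]; exact hsupp d hd
  have hyc : ∀ d, y d = c * inner ℝ (γ d) β := fun d => by
    rw [hyγ, hc, inner_smul_right]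
  have hc0 : c ≠ 0 := by
    rintro rfl
    exact hy0 (funext fun d => by simp [hyc])
  have hca : c = 1 ∨ c = -1 := by
    have := hyc a
    rw [ha, mul_one] at this
    rw [← this]
    exact (hval a).resolve_left (by rwa [this])
  rcases hca with rfl | rfl
  · refine ⟨by rwa [hc, one_smul] at hΛ, fun d => ?_⟩
    simpa [hyc] using hval d
  · refine ⟨?_, fun d => ?_⟩
    · have : β = - N.flux y := by rw [hc]; simp
      rw [this]; exact Submodule.neg_mem _ hΛ
    · rcases hval d with h | h | h <;> rw [hyc] at h
      · left; linarith
      · right; right; linarith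
      · right; left; linarith

/-- The vectors `β` are dual to the covectors at the darts `t`. -/
def IsDual (γ : N.QDart → EuclideanSpace ℝ (Fin 3)) (t : Fin 3 → N.QDart)
    (β : Fin 3 → EuclideanSpace ℝ (Fin 3)) : Prop :=
  ∀ i j, inner ℝ (γ (t i)) (β j) = if i = j then (1 : ℝ) else 0

theorem IsDual.linearIndependent {t : Fin 3 → N.QDart} {β : Fin 3 → EuclideanSpace ℝ (Fin 3)}
    (h : IsDual γ t β) : LinearIndependent ℝ β := by
  rw [Fintype.linearIndependent_iff]
  intro g hg i
  have := congrArg (inner ℝ (γ (t i))) hg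
  simpa [inner_sum, inner_smul_right, h i] using this

theorem IsDual.expand {t : Fin 3 → N.QDart} {β : Fin 3 → EuclideanSpace ℝ (Fin 3)}
    (h : IsDual γ t β) (x : EuclideanSpace ℝ (Fin 3)) :
    x = ∑ i, inner ℝ (γ (t i)) x • β i := by
  let b := basisOfLinearIndependentOfCardEqFinrank h.linearIndependent (by simp)
  have hb : ∀ i, b i = β i := fun i => by simp [b]
  have h1 : ∀ i, inner ℝ (γ (t i)) x = b.repr x i := fun i => by
    conv_lhs => rw [← b.sum_repr x]
    simp [inner_sum, inner_smul_right, hb, h i]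
  conv_lhs => rw [← b.sum_repr x]
  simp [h1, hb]

theorem IsCovectorSystem.of_isDual (h : IsCovectorSystem N γ) {t : Fin 3 → N.QDart}
    {β : Fin 3 → EuclideanSpace ℝ (Fin 3)} (hd : IsDual γ t β) (i : Fin 3) :
    β i ∈ Λ ∧ ∀ d, inner ℝ (γ d) (β i) = 0 ∨ inner ℝ (γ d) (β i) = 1 ∨
      inner ℝ (γ d) (β i) = -1 := by
  refine h.elementary (a := t i) (by simp [hd i]) fun x hx => ⟨inner ℝ (γ (t i)) x, ?_⟩
  conv_lhs => rw [hd.expand x]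
  rw [Finset.sum_eq_single i]
  · intro j _ hj
    rw [hx (t j) (by simp [hd j, hj]), zero_smul]
  · simp

/-- The pivot step: the covector at d replaces the i-th one of the basis, and the dual basis changes
accordingly. -/
theorem IsDual.exchange {t : Fin 3 → N.QDart} {β : Fin 3 → EuclideanSpace ℝ (Fin 3)}
    (h : IsDual γ t β) {d : N.QDart} {i : Fin 3} (hd : inner ℝ (γ d) (β i) ≠ (0 : ℝ)) :
    IsDual γ (Function.update t i d) (fun j => if j = i then (inner ℝ (γ d) (β i) : ℝ)⁻¹ • β i
      else β j - ((inner ℝ (γ d) (β j) : ℝ) / inner ℝ (γ d) (β i)) • β i) := by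
  intro k j
  by_cases hk : k = i
  · subst hk
    by_cases hj : j = k
    · subst hj
      simp [inner_smul_right, hd]
    · simp [hj, Ne.symm hj, inner_sub_right, inner_smul_right, hd]
  · by_cases hj : j = i
    · subst hj
      simp [hk, inner_smul_right, h k]
    · simp [hk, hj, inner_sub_right, inner_smul_right, h k]

/-- The left hand side is an entry of the system after the pivot, and entries with respect to every
dual basis are 0 or ±1. -/
theorem IsCovectorSystem.exchange_entry (h : IsCovectorSystem N γ) {t : Fin 3 → N.QDart}
    {β : Fin 3 → EuclideanSpace ℝ (Fin 3)} (hd : IsDual γ t β) {d : N.QDart} (e : N.QDart)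
    {i j : Fin 3} (hij : i ≠ j) (hne : inner ℝ (γ d) (β i) ≠ (0 : ℝ)) :
    |(inner ℝ (γ e) (β j) : ℝ) -
      inner ℝ (γ d) (β j) / inner ℝ (γ d) (β i) * inner ℝ (γ e) (β i)| ≤ 1 := by
  have := (h.of_isDual (hd.exchange hne) j).2 e
  simp only [hij.symm, if_false, inner_sub_right, inner_smul_right] at this
  rcases this with h | h | h <;> rw [h] <;> simp

/-- A 2 × 2 minor is the pivot entry times an entry after the pivot, and both are at most 1 in
absolute value. -/
theorem IsCovectorSystem.minor_le (h : IsCovectorSystem N γ) {t : Fin 3 → N.QDart}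
    {β : Fin 3 → EuclideanSpace ℝ (Fin 3)} (hd : IsDual γ t β) (d e : N.QDart)
    {i j : Fin 3} (hij : i ≠ j) :
    |(inner ℝ (γ d) (β i) : ℝ) * inner ℝ (γ e) (β j) -
      inner ℝ (γ d) (β j) * inner ℝ (γ e) (β i)| ≤ 1 := by
  have habs : ∀ d i, |(inner ℝ (γ d) (β i) : ℝ)| ≤ 1 := fun d i => by
    rcases (h.of_isDual hd i).2 d with h | h | h <;> rw [h] <;> simp
  by_cases hne : inner ℝ (γ d) (β i) = (0 : ℝ)
  · rw [hne, zero_mul, zero_sub, abs_neg, abs_mul]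
    exact mul_le_one₀ (habs _ _) (abs_nonneg _) (habs _ _)
  · have h1 := h.exchange_entry hd e hij hne
    have h2 : (inner ℝ (γ d) (β i) : ℝ) * inner ℝ (γ e) (β j) -
        inner ℝ (γ d) (β j) * inner ℝ (γ e) (β i) = inner ℝ (γ d) (β i) *
        ((inner ℝ (γ e) (β j) : ℝ) -
          inner ℝ (γ d) (β j) / inner ℝ (γ d) (β i) * inner ℝ (γ e) (β i)) := by
      field_simp
    rw [h2, abs_mul]
    exact mul_le_one₀ (habs _ _) (abs_nonneg _) h1

/-- Up to sign this is the 3 × 3 determinant of the rows d, e, f with the three prescribed zeros. It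
equals, up to sign, the pivot entry times a 2 × 2 minor after the pivot. -/
theorem IsCovectorSystem.det_ne (h : IsCovectorSystem N γ) {t : Fin 3 → N.QDart}
    {β : Fin 3 → EuclideanSpace ℝ (Fin 3)} (hd : IsDual γ t β) (d e f : N.QDart)
    (h1 : inner ℝ (γ d) (β 2) = (0 : ℝ)) (h2 : inner ℝ (γ e) (β 1) = (0 : ℝ))
    (h3 : inner ℝ (γ f) (β 0) = (0 : ℝ)) :
    |(inner ℝ (γ d) (β 0) : ℝ) * inner ℝ (γ e) (β 2) * inner ℝ (γ f) (β 1) +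
      inner ℝ (γ d) (β 1) * inner ℝ (γ e) (β 0) * inner ℝ (γ f) (β 2)| ≤ 1 := by
  have habs : ∀ d i, |(inner ℝ (γ d) (β i) : ℝ)| ≤ 1 := fun d i => by
    rcases (h.of_isDual hd i).2 d with h | h | h <;> rw [h] <;> simp
  by_cases hne : inner ℝ (γ d) (β 0) = (0 : ℝ)
  · rw [hne, zero_mul, zero_mul, zero_add, abs_mul, abs_mul]
    exact mul_le_one₀ (mul_le_one₀ (habs _ _) (abs_nonneg _) (habs _ _)) (abs_nonneg _) (habs _ _)
  · have := h.minor_le (hd.exchange hne) e f (i := 1) (j := 2) (by decide)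
    simp only [Fin.reduceEq, if_false, inner_sub_right, inner_smul_right, h1, h2, h3] at this
    have h4 : (inner ℝ (γ d) (β 0) : ℝ) * inner ℝ (γ e) (β 2) * inner ℝ (γ f) (β 1) +
      inner ℝ (γ d) (β 1) * inner ℝ (γ e) (β 0) * inner ℝ (γ f) (β 2) =
      - inner ℝ (γ d) (β 0) * ((0 - inner ℝ (γ d) (β 1) / inner ℝ (γ d) (β 0) *
        inner ℝ (γ e) (β 0)) * (inner ℝ (γ f) (β 2) - 0 / inner ℝ (γ d) (β 0) * 0) -
        (inner ℝ (γ e) (β 2) - 0 / inner ℝ (γ d) (β 0) * inner ℝ (γ e) (β 0)) *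
        (inner ℝ (γ f) (β 1) - inner ℝ (γ d) (β 1) / inner ℝ (γ d) (β 0) * 0)) := by
      field_simp
      ring
    rw [h4, abs_mul, abs_neg]
    exact mul_le_one₀ (habs _ _) (abs_nonneg _) this

/-- A vector orthogonal to all covectors belongs to the zero flow, so it is the flux of zero. -/
theorem IsCovectorSystem.span_range (h : IsCovectorSystem N γ) :
    Submodule.span ℝ (Set.range γ) = ⊤ := by
  rw [← Submodule.orthogonal_eq_bot_iff, Submodule.eq_bot_iff]
  intro x hx
  have h0 : (fun d => inner ℝ (γ d) x) = (0 : N.QDart → ℝ) := by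
    funext d
    exact hx _ (Submodule.subset_span ⟨d, rfl⟩)
  have := h.flux_eq x
  rw [h0, map_zero] at this
  exact this.symm

theorem IsCovectorSystem.exists_isDual (h : IsCovectorSystem N γ) :
    ∃ t β, IsDual γ t β := by
  obtain ⟨s, hs, hspan, hli⟩ := exists_linearIndependent ℝ (Set.range γ)
  rw [h.span_range] at hspan
  let b : Module.Basis s ℝ (EuclideanSpace ℝ (Fin 3)) :=
    Module.Basis.mk hli (by rw [Subtype.range_coe, hspan])
  have : Finite s := Module.Finite.finite_basis b
  have : Fintype s := Fintype.ofFinite s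
  have hcard : Fintype.card s = 3 := by
    rw [← Module.finrank_eq_card_basis b]; simp
  let b' := b.reindex (Fintype.equivFinOfCardEq hcard)
  have hb' : ∀ i, ∃ d, γ d = b' i := fun i => by
    have : b' i = ((Fintype.equivFinOfCardEq hcard).symm i : EuclideanSpace ℝ (Fin 3)) := by
      simp [b', b]
    rw [this]
    exact hs ((Fintype.equivFinOfCardEq hcard).symm i).2
  choose t ht using hb'
  let φ : EuclideanSpace ℝ (Fin 3) →ₗ[ℝ] (Fin 3 → ℝ) := LinearMap.pi fun i => innerₛₗ ℝ (b' i)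
  have hφ : ∀ x i, φ x i = inner ℝ (b' i) x := fun x i => rfl
  have hinj : Function.Injective φ := by
    rw [← LinearMap.ker_eq_bot, LinearMap.ker_eq_bot']
    intro x hx
    refine InnerProductSpace.ext_inner_left_basis b' fun i => ?_
    rw [inner_zero_right, ← hφ, hx]; rfl
  have hsurj : Function.Surjective φ :=
    (LinearMap.injective_iff_surjective_of_finrank_eq_finrank (by simp)).1 hinj
  choose β hβ using fun j : Fin 3 => hsurj (Pi.single j 1)
  refine ⟨t, β, fun i j => ?_⟩
  rw [ht, ← hφ, hβ, Pi.single_apply]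

/-- Integral coordinates in which all covectors are roots of `D₃` or zero. -/
theorem IsCovectorSystem.exists_roots (h : IsCovectorSystem N γ) :
    ∃ (β : Fin 3 → EuclideanSpace ℝ (Fin 3)) (R : Matrix (Fin 3) (Fin 3) ℤ)
      (u : N.QDart → Fin 3 → ℤ), LinearIndependent ℝ β ∧ (∀ i, β i ∈ Λ) ∧ R.det ≠ 0 ∧
      (∀ i, Even (R i 0 + R i 1 + R i 2)) ∧
      (∀ d j, (u d j : ℝ) = ∑ i, inner ℝ (γ d) (β i) * (R i j : ℝ)) ∧
      ∀ d, u d 0 ^ 2 + u d 1 ^ 2 + u d 2 ^ 2 = 0 ∨ u d 0 ^ 2 + u d 1 ^ 2 + u d 2 ^ 2 = 2 := by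
  obtain ⟨t, β, hd⟩ := h.exists_isDual
  have hint : ∀ i d, ∃ c : ℤ, (c : ℝ) = inner ℝ (γ d) (β i) ∧ (c = 0 ∨ c = 1 ∨ c = -1) := by
    intro i d
    rcases (h.of_isDual hd i).2 d with h | h | h
    · exact ⟨0, by simp [h], by simp⟩
    · exact ⟨1, by simp [h], by simp⟩
    · exact ⟨-1, by simp [h], by simp⟩
  choose c hc hc' using hint
  have hm : ∀ {i j : Fin 3}, i ≠ j → ∀ d e, |c i d * c j e - c j d * c i e| ≤ 1 := by
    intro i j hij d e
    have := h.minor_le hd d e hij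
    rw [← hc, ← hc, ← hc, ← hc] at this
    exact_mod_cast this
  obtain ⟨R, hR, hu⟩ := exists_root_matrix (c 0) (c 1) (c 2) (hc' 0) (hc' 1) (hc' 2)
    (hm (by decide)) (hm (by decide)) (hm (by decide)) (fun d e f h1 h2 h3 => by
      have := h.det_ne hd d e f (by rw [← hc, h1]; simp) (by rw [← hc, h2]; simp)
        (by rw [← hc, h3]; simp)
      simp only [← hc] at this
      have h4 : |c 0 d * c 2 e * c 1 f + c 1 d * c 0 e * c 2 f| ≤ 1 := by exact_mod_cast this
      rw [abs_le] at h4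
      omega)
  choose u hu1 hu2 using hu
  -- The covectors at t are the coordinate functionals, so the rows of R are themselves roots (or
  -- zero). This gives the even row sums, since a square has the parity of its root.
  have hR' : ∀ i j, u (t i) j = R i j := fun i j => by
    have hδ : ∀ k, c k (t i) = if i = k then 1 else 0 := fun k => by
      have := (hc k (t i)).trans (hd i k)
      exact_mod_cast this
    rw [hu1, hδ, hδ, hδ]
    fin_cases i <;> simp
  refine ⟨β, R, u, hd.linearIndependent, fun i => (h.of_isDual hd i).1, hR, fun i => ?_,
    fun d j => ?_, hu2⟩
  · have h2 : Even (R i 0 ^ 2 + R i 1 ^ 2 + R i 2 ^ 2) := by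
      rw [← hR', ← hR', ← hR']
      rcases hu2 (t i) with h | h <;> rw [h] <;> decide
    simpa [Int.even_add, Int.even_pow] using h2
  · rw [hu1, Fin.sum_univ_three, ← hc, ← hc, ← hc]
    push_cast
    ring

end PeriodicNetwork

/-! ### Singular values and the inequality of arithmetic and geometric means -/

section polar

/-- Singular value decomposition of a linear automorphism. -/
theorem LinearEquiv.exists_singular_values {n : ℕ} [NeZero n]
    (T : EuclideanSpace ℝ (Fin n) ≃ₗ[ℝ] EuclideanSpace ℝ (Fin n)) :
    ∃ (O : EuclideanSpace ℝ (Fin n) ≃ₗᵢ[ℝ] EuclideanSpace ℝ (Fin n))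
      (f : OrthonormalBasis (Fin n) ℝ (EuclideanSpace ℝ (Fin n))) (σ : Fin n → ℝ),
      (∀ i, 0 < σ i) ∧ (∀ i, T (f i) = σ i • O (f i)) ∧
      |LinearMap.det (T : EuclideanSpace ℝ (Fin n) →ₗ[ℝ] EuclideanSpace ℝ (Fin n))| =
        ∏ i, σ i := by
  let A : EuclideanSpace ℝ (Fin n) →ₗ[ℝ] EuclideanSpace ℝ (Fin n) := T
  have hS : (LinearMap.adjoint A ∘ₗ A).IsSymmetric := A.isSymmetric_adjoint_mul_self
  have hn : Module.finrank ℝ (EuclideanSpace ℝ (Fin n)) = n := by simp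
  let f := hS.eigenvectorBasis hn
  -- The basis f diagonalizes the adjoint of T composed with T, so its image under T is orthogonal.
  -- Normalizing this image gives the second orthonormal basis.
  have hf : ∀ i j, inner ℝ (T (f i)) (T (f j)) = if i = j then hS.eigenvalues hn j else 0 := by
    intro i j
    have h1 : inner ℝ (T (f i)) (T (f j)) = inner ℝ (f i) ((LinearMap.adjoint A ∘ₗ A) (f j)) := by
      rw [LinearMap.comp_apply, LinearMap.adjoint_inner_right]; rfl
    rw [h1, hS.apply_eigenvectorBasis hn, inner_smul_right]
    change _ * inner ℝ (f i) (f j) = _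
    rw [orthonormal_iff_ite.1 f.orthonormal i j]
    split_ifs <;> simp
  have hne : ∀ i, T (f i) ≠ 0 := fun i => by
    simpa using f.orthonormal.ne_zero i
  have hg : Orthonormal ℝ fun i => (‖T (f i)‖)⁻¹ • T (f i) := by
    refine ⟨fun i => ?_, fun i j hij => ?_⟩
    · rw [norm_smul, norm_inv, norm_norm, inv_mul_cancel₀ (norm_ne_zero_iff.2 (hne i))]
    · change inner ℝ (‖T (f i)‖⁻¹ • T (f i)) (‖T (f j)‖⁻¹ • T (f j)) = (0 : ℝ)
      rw [inner_smul_left, inner_smul_right, hf, if_neg hij, mul_zero, mul_zero]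
  let b := basisOfLinearIndependentOfCardEqFinrank hg.linearIndependent (by simp)
  have hb : ∀ i, b i = (‖T (f i)‖)⁻¹ • T (f i) := fun i => by simp [b]
  let g : OrthonormalBasis (Fin n) ℝ (EuclideanSpace ℝ (Fin n)) :=
    b.toOrthonormalBasis (by
      have : (b : Fin n → _) = fun i => (‖T (f i)‖)⁻¹ • T (f i) := funext hb
      rw [this]; exact hg)
  have hgi : ∀ i, g i = (‖T (f i)‖)⁻¹ • T (f i) := fun i => by
    simp [g, hb]
  have hT : ∀ i, T (f i) = ‖T (f i)‖ • g i := fun i => by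
    rw [hgi, smul_smul, mul_inv_cancel₀ (norm_ne_zero_iff.2 (hne i)), one_smul]
  refine ⟨f.equiv g (Equiv.refl _), f, fun i => ‖T (f i)‖, fun i => norm_pos_iff.2 (hne i),
    fun i => by simpa using hT i, ?_⟩
  have h1 := f.toBasis.det_comp A f
  have h2 : (A ∘ f) = fun i => ‖T (f i)‖ • g i := funext hT
  rw [h2, AlternatingMap.map_smul_univ] at h1
  have h3 : f.toBasis.det f = 1 := by
    rw [← f.coe_toBasis, Module.Basis.det_self]
  rw [h3, mul_one] at h1
  rw [← h1, smul_eq_mul, abs_mul, ← Real.norm_eq_abs (f.toBasis.det g),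
    f.det_to_matrix_orthonormalBasis g, mul_one, abs_of_nonneg]
  exact Finset.prod_nonneg fun i _ => norm_nonneg _

/-- The difference of the two sides is a combination of squares with positive coefficients, which
also settles the case of equality. -/
theorem mul_three_le_add_pow {a b c : ℝ} (ha : 0 < a) (hb : 0 < b) (hc : 0 < c) :
    27 * (a * b * c) ≤ (a + b + c) ^ 3 ∧
      ((a + b + c) ^ 3 ≤ 27 * (a * b * c) → a = b ∧ b = c) := by
  have key : (a + b + c) ^ 3 - 27 * (a * b * c) =
      (a + b + c) / 2 * ((a - b) ^ 2 + (b - c) ^ 2 + (c - a) ^ 2) +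
      3 * (a * (b - c) ^ 2 + b * (c - a) ^ 2 + c * (a - b) ^ 2) := by ring
  have h1 : 0 ≤ (a + b + c) / 2 * ((a - b) ^ 2 + (b - c) ^ 2 + (c - a) ^ 2) := by positivity
  have h2 : 0 ≤ a * (b - c) ^ 2 := by positivity
  have h3 : 0 ≤ b * (c - a) ^ 2 := by positivity
  have h4 : 0 ≤ c * (a - b) ^ 2 := by positivity
  refine ⟨by linarith, fun h => ?_⟩
  have h5 : a * (b - c) ^ 2 = 0 := by linarith
  have h6 : c * (a - b) ^ 2 = 0 := by linarith
  have h7 := (mul_eq_zero.1 h5).resolve_left ha.ne'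
  have h8 := (mul_eq_zero.1 h6).resolve_left hc.ne'
  rw [sq_eq_zero_iff, sub_eq_zero] at h7 h8
  exact ⟨h8, h7⟩

end polar

/-! ### Covolumes of images and of sublattices -/

section covolume

variable {n : ℕ}

theorem covolume_eq_abs_det (L : Submodule ℤ (EuclideanSpace ℝ (Fin n)))
    [DiscreteTopology L] [IsZLattice ℝ L] (b : Module.Basis (Fin n) ℤ L) :
    ZLattice.covolume L =
      |(EuclideanSpace.basisFun (Fin n) ℝ).toBasis.det (fun i => (b i : EuclideanSpace ℝ (Fin n)))| := by
  rw [ZLattice.covolume_eq_det_mul_measureReal L _ b (EuclideanSpace.basisFun (Fin n) ℝ).toBasis,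
    MeasureTheory.measureReal_def,
    MeasureTheory.measure_congr (ZSpan.fundamentalDomain_ae_parallelepiped _ _)]
  simp only [OrthonormalBasis.coe_toBasis, OrthonormalBasis.volume_parallelepiped]
  simp
  rfl

theorem exists_lattice_basis (L : Submodule ℤ (EuclideanSpace ℝ (Fin n)))
    [DiscreteTopology L] [IsZLattice ℝ L] : Nonempty (Module.Basis (Fin n) ℤ L) := by
  have := ZLattice.module_free ℝ L
  have := ZLattice.module_finite ℝ L
  exact ⟨Module.finBasisOfFinrankEq ℤ L (by rw [ZLattice.rank ℝ L]; simp)⟩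

/-- Covolume of the image of a lattice. -/
theorem covolume_comap_symm (L : Submodule ℤ (EuclideanSpace ℝ (Fin n)))
    [DiscreteTopology L] [IsZLattice ℝ L]
    (T : EuclideanSpace ℝ (Fin n) ≃L[ℝ] EuclideanSpace ℝ (Fin n)) :
    ZLattice.covolume (ZLattice.comap ℝ L T.symm.toLinearMap) =
      |LinearMap.det (T : EuclideanSpace ℝ (Fin n) →ₗ[ℝ] EuclideanSpace ℝ (Fin n))| *
        ZLattice.covolume L := by
  obtain ⟨b⟩ := exists_lattice_basis L
  rw [covolume_eq_abs_det L b, ← abs_mul, ← Module.Basis.det_comp,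
    covolume_eq_abs_det _ (b.ofZLatticeComap ℝ L T.symm.toLinearEquiv)]
  congr 2

theorem covolume_image {L L' : Submodule ℤ (EuclideanSpace ℝ (Fin n))}
    [DiscreteTopology L] [IsZLattice ℝ L]
    (T : EuclideanSpace ℝ (Fin n) ≃L[ℝ] EuclideanSpace ℝ (Fin n))
    (h : (L' : Set (EuclideanSpace ℝ (Fin n))) = T '' L) :
    ZLattice.covolume L' =
      |LinearMap.det (T : EuclideanSpace ℝ (Fin n) →ₗ[ℝ] EuclideanSpace ℝ (Fin n))| *
        ZLattice.covolume L := by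
  rw [← covolume_comap_symm]
  congr 1
  refine SetLike.coe_injective ?_
  rw [h, ZLattice.coe_comap]
  exact T.image_eq_preimage_symm _

/-- The covolume of a sublattice is at least that of the lattice; in case of equality they agree. -/
theorem covolume_sublattice {L₁ L₂ : Submodule ℤ (EuclideanSpace ℝ (Fin n))}
    [DiscreteTopology L₁] [IsZLattice ℝ L₁] [DiscreteTopology L₂] [IsZLattice ℝ L₂]
    (h : L₁ ≤ L₂) : ZLattice.covolume L₂ ≤ ZLattice.covolume L₁ ∧
      (ZLattice.covolume L₁ ≤ ZLattice.covolume L₂ → L₁ = L₂) := by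
  have h1 := ZLattice.covolume_div_covolume_eq_relIndex' L₁ L₂ h
  have p1 := ZLattice.covolume_pos L₁
  have p2 := ZLattice.covolume_pos L₂
  rw [div_eq_iff p2.ne'] at h1
  have hk : L₁.toAddSubgroup.relIndex L₂.toAddSubgroup ≠ 0 := fun h0 => by
    rw [h0] at h1; simp at h1; exact p1.ne' h1
  have hk1 : (1 : ℝ) ≤ L₁.toAddSubgroup.relIndex L₂.toAddSubgroup := by
    exact_mod_cast Nat.one_le_iff_ne_zero.2 hk
  refine ⟨by nlinarith, fun hle => le_antisymm h ?_⟩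
  have : (L₁.toAddSubgroup.relIndex L₂.toAddSubgroup : ℝ) = 1 := by
    refine le_antisymm ?_ hk1
    by_contra hlt
    push Not at hlt
    nlinarith
  have h2 : L₁.toAddSubgroup.relIndex L₂.toAddSubgroup = 1 := by exact_mod_cast this
  exact AddSubgroup.relIndex_eq_one.1 h2

end covolume

/-! ### The standard body-centred cubic lattice -/

section bcc

/-- The standard generators of the body-centred cubic lattice. -/
def bccVec : Fin 3 → EuclideanSpace ℝ (Fin 3) := ![!₂[-1, 1, 1], !₂[1, -1, 1], !₂[1, 1, -1]]

theorem bccLattice_eq_span : bccLattice = Submodule.span ℤ (Set.range bccVec) := by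
  unfold bccLattice bccVec
  congr 1
  ext x
  simp [Matrix.range_cons, or_comm, or_left_comm]

theorem det_bccVec : (EuclideanSpace.basisFun (Fin 3) ℝ).toBasis.det bccVec = 4 := by
  rw [Module.Basis.det_apply, Matrix.det_fin_three]
  simp [Module.Basis.toMatrix_apply, bccVec]
  norm_num

/-- The standard basis of the body-centred cubic lattice. -/
def bccBasis : Module.Basis (Fin 3) ℝ (EuclideanSpace ℝ (Fin 3)) :=
  Module.Basis.mk (v := bccVec)
    (((EuclideanSpace.basisFun (Fin 3) ℝ).toBasis.is_basis_iff_det).2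
      (by rw [det_bccVec]; norm_num)).1
    (((EuclideanSpace.basisFun (Fin 3) ℝ).toBasis.is_basis_iff_det).2
      (by rw [det_bccVec]; norm_num)).2.ge

theorem coe_bccBasis : (bccBasis : Fin 3 → EuclideanSpace ℝ (Fin 3)) = bccVec := by
  funext i; simp [bccBasis]

theorem bccLattice_eq_span_basis : bccLattice = Submodule.span ℤ (Set.range bccBasis) := by
  rw [coe_bccBasis, bccLattice_eq_span]

instance : DiscreteTopology bccLattice := by
  rw [bccLattice_eq_span_basis]; infer_instance

instance : IsZLattice ℝ bccLattice := by
  refine ⟨?_⟩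
  have h := (inferInstance : IsZLattice ℝ (Submodule.span ℤ (Set.range bccBasis))).span_top
  rwa [← bccLattice_eq_span_basis] at h

theorem covolume_bccLattice : ZLattice.covolume bccLattice = 4 := by
  have key : ∀ L : Submodule ℤ (EuclideanSpace ℝ (Fin 3)), ∀ [DiscreteTopology L] [IsZLattice ℝ L],
      L = Submodule.span ℤ (Set.range bccBasis) → ZLattice.covolume L = 4 := by
    rintro L _ _ rfl
    rw [covolume_eq_abs_det _ (bccBasis.restrictScalars ℤ)]
    have : (fun i => ((bccBasis.restrictScalars ℤ) i : EuclideanSpace ℝ (Fin 3))) = bccVec := by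
      funext i
      rw [Module.Basis.restrictScalars_apply, coe_bccBasis]
    rw [this, det_bccVec]
    norm_num
  exact key _ bccLattice_eq_span_basis

end bcc

/-! ### The first Betti number of the quotient graph -/

namespace PeriodicNetwork

variable {n : ℕ} {Λ : Submodule ℤ (EuclideanSpace ℝ (Fin n))} {V : Type*} [AddAction Λ V]

theorem card_QDart_le_two_mul (N : PeriodicNetwork Λ V) :
    Fintype.card N.QDart ≤ 2 * Nat.card N.QEdge := by
  have := N.finite_edges
  have := Fintype.ofFinite N.QEdge
  have h := Finset.card_le_mul_card_image (s := (Finset.univ : Finset N.QDart)) (f := edge) 2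
    (fun e _ => by
      obtain ⟨d, rfl⟩ := edge_surjective e
      have : (Finset.univ.filter fun d' : N.QDart => edge d' = edge d) ⊆ {d, rev d} := by
        intro d' hd'
        have := edge_eq_iff.1 (Finset.mem_filter.1 hd').2.symm
        simpa using this
      exact (Finset.card_le_card this).trans Finset.card_le_two)
  rw [Nat.card_eq_fintype_card]
  exact h.trans (Nat.mul_le_mul_left 2 (Finset.card_le_univ _))

/-- The first Betti number is at least the Euler characteristic estimate. -/
theorem card_QDart_le (N : PeriodicNetwork Λ V) :
    Fintype.card N.QDart + 2 ≤ 2 * Module.finrank ℝ N.flows + 2 * Nat.card N.QVertex := by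
  have := N.finite_vertices
  have := N.finite_edges
  have := Fintype.ofFinite N.QVertex
  have := Fintype.ofFinite N.QEdge
  obtain ⟨s, hs⟩ := (edge_surjective (N := N)).hasRightInverse
  -- An orientation of each edge, which identifies functions on edges with antisymmetric functions
  -- on darts. The kernel of the divergence then consists of flows.
  let ε : N.QDart → ℝ := fun d => if d = s (edge d) then 1 else -1
  have hε : ∀ d, ε (rev d) = - ε d := by
    intro d
    have h1 : s (edge d) = d ∨ s (edge d) = rev d := by
      have := edge_eq_iff.1 (hs (edge d)).symm
      exact this
    have hne := rev_ne d
    rcases h1 with h | h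
    · simp [ε, h, hne]
    · simp [ε, h, hne.symm]
  have hε0 : ∀ d, ε d ≠ 0 := fun d => by
    by_cases h : d = s (edge d)
    · simp only [ε]; rw [if_pos h]; norm_num
    · simp only [ε]; rw [if_neg h]; norm_num
  let Θ : (N.QEdge → ℝ) →ₗ[ℝ] (N.QDart → ℝ) :=
    { toFun := fun w d => w (edge d) * ε d
      map_add' := fun a b => by funext d; simp [add_mul]
      map_smul' := fun c a => by funext d; simp [mul_assoc] }
  let div : (N.QDart → ℝ) →ₗ[ℝ] (N.QVertex → ℝ) :=
    { toFun := fun z q => ∑ d with src d = q, z d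
      map_add' := fun a b => by funext q; simp [Finset.sum_add_distrib]
      map_smul' := fun c a => by funext q; simp [Finset.mul_sum] }
  have hanti : ∀ w d, Θ w (rev d) = - Θ w d := fun w d => by
    change w (edge (rev d)) * ε (rev d) = - (w (edge d) * ε d)
    rw [hε, edge_rev]; ring
  have hΘ : Function.Injective Θ := by
    intro w w' h
    funext e
    obtain ⟨d, rfl⟩ := edge_surjective e
    exact mul_right_cancel₀ (hε0 d) (congrFun h d)
  have hrn := LinearMap.finrank_range_add_finrank_ker (div ∘ₗ Θ)
  have hker : Module.finrank ℝ (LinearMap.ker (div ∘ₗ Θ)) ≤ Module.finrank ℝ N.flows := by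
    refine LinearMap.finrank_le_finrank_of_injective
      (f := Θ.restrict (p := LinearMap.ker (div ∘ₗ Θ)) (q := N.flows) fun w hw =>
        ⟨hanti w, fun q => congrFun (LinearMap.mem_ker.1 hw) q⟩) ?_
    rintro ⟨w, hw⟩ ⟨w', hw'⟩ h
    exact Subtype.ext (hΘ (congrArg Subtype.val h))
  -- Divergences of antisymmetric functions sum to zero, so a point mass is not attained.
  have hrange : Module.finrank ℝ (LinearMap.range (div ∘ₗ Θ)) < Module.finrank ℝ (N.QVertex → ℝ) := by
    refine Submodule.finrank_lt fun htop => ?_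
    obtain ⟨x⟩ := N.connected.nonempty
    obtain ⟨w, hw⟩ := LinearMap.range_eq_top.1 htop (Pi.single (N.mkV x) 1)
    have h1 : ∑ q, (div ∘ₗ Θ) w q = 0 := by
      have h2 : ∑ q, (div ∘ₗ Θ) w q = ∑ d, Θ w d :=
        Finset.sum_fiberwise Finset.univ (src : N.QDart → N.QVertex) (Θ w)
      have h3 := sum_rev (Θ w)
      simp only [hanti, Finset.sum_neg_distrib] at h3
      rw [h2]; linarith
    rw [hw] at h1
    simp at h1
  have hcard := N.card_QDart_le_two_mul
  rw [Nat.card_eq_fintype_card] at hcard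
  rw [Module.finrank_fintype_fun_eq_card] at hrange hrn
  rw [Nat.card_eq_fintype_card]
  omega

end PeriodicNetwork

/-- An integer vector as a point of Euclidean space. -/
def toE (u : Fin 3 → ℤ) : EuclideanSpace ℝ (Fin 3) := WithLp.toLp 2 fun j => (u j : ℝ)

@[simp] theorem toE_apply (u : Fin 3 → ℤ) (j : Fin 3) : toE u j = u j := rfl

theorem inner_toE (u : Fin 3 → ℤ) (y : EuclideanSpace ℝ (Fin 3)) :
    inner ℝ (toE u) y = ∑ j, (u j : ℝ) * y j := by
  simp [PiLp.inner_apply, toE, mul_comm]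

theorem norm_toE_sq (u : Fin 3 → ℤ) :
    ‖toE u‖ ^ 2 = ((u 0 ^ 2 + u 1 ^ 2 + u 2 ^ 2 : ℤ) : ℝ) := by
  rw [← real_inner_self_eq_norm_sq, inner_toE, Fin.sum_univ_three]
  simp
  ring

/-! ### The estimate and the rigidity of its equality case -/

namespace PeriodicNetwork

variable {Λ : Submodule ℤ (EuclideanSpace ℝ (Fin 3))} {V : Type*} [AddAction Λ V]
variable {N : PeriodicNetwork Λ V}

/-- The structure of a network with the minimal value of `L³ / V`: after a rotation `O`, each edge
vector is a multiple of a root `u d` of `D₃`, these roots form a flow, and weighted by `t` they form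
a tight frame. -/
structure IsRigid (N : PeriodicNetwork Λ V)
    (O : EuclideanSpace ℝ (Fin 3) ≃ₗᵢ[ℝ] EuclideanSpace ℝ (Fin 3))
    (t : N.QDart → ℝ) (u : N.QDart → Fin 3 → ℤ) : Prop where
  u_rev : ∀ d, u (rev d) = - u d
  u_sum : ∀ q, ∑ d with src d = q, u d = 0
  u_root : ∀ d, u d 0 ^ 2 + u d 1 ^ 2 + u d 2 ^ 2 = 2
  vec_eq : ∀ d, vec d = t d • O (toE (u d))
  t_pos : ∀ d, 0 < t d
  frame : ∃ κ : ℝ, 0 < κ ∧ ∀ i j : Fin 3, ∑ d, t d * (u d i * u d j) = if i = j then κ else 0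
  bcc : IsBodyCentredCubic Λ
  card_le : Fintype.card N.QDart ≤ 2 * Nat.card N.QVertex + 4

theorem length_pos (N : PeriodicNetwork Λ V) [DiscreteTopology Λ] [hΛ : IsZLattice ℝ Λ] :
    0 < N.length := by
  have h : 0 < ∑ d : N.QDart, ‖vec d‖ := by
    refine Finset.sum_pos (fun d _ => norm_pos_iff.2 (vec_ne_zero d)) ?_
    by_contra hne
    rw [Finset.not_nonempty_iff_eq_empty] at hne
    obtain ⟨γ, h1, h2, h3⟩ := exists_covectors N hΛ.span_top
    have h4 := h2 (EuclideanSpace.single 0 1)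
    rw [flux_apply, hne, Finset.sum_empty, smul_zero] at h4
    have := congrArg (fun x : EuclideanSpace ℝ (Fin 3) => x 0) h4
    simp at this
  have := N.two_length
  linarith

/-- The estimate together with the rigidity of the equality case. -/
theorem length_estimate (N : PeriodicNetwork Λ V) [DiscreteTopology Λ] [hΛ : IsZLattice ℝ Λ] :
    27 / √2 ≤ N.length ^ 3 / ZLattice.covolume Λ ∧
      (N.length ^ 3 / ZLattice.covolume Λ = 27 / √2 → ∃ O t u, N.IsRigid O t u) := by
  obtain ⟨γ, hγ1, hγ2, hγ3⟩ := exists_covectors N hΛ.span_top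
  have hγ : IsCovectorSystem N γ := ⟨hγ1, hγ2, hγ3⟩
  obtain ⟨β, R, u, hβ, hβΛ, hR, hReven, hu, hroot⟩ := hγ.exists_roots
  have hs2 : √2 * √2 = (2 : ℝ) := Real.mul_self_sqrt (by norm_num)
  have hs0 : (0 : ℝ) < √2 := by positivity
  -- The coordinate change from the root coordinates to ℝ³, made so that ⟨u d, y⟩ = ⟨γ d, A₀ y⟩. Its
  -- flux formula `hflux` comes from the one for γ.
  let A₀ : EuclideanSpace ℝ (Fin 3) →ₗ[ℝ] EuclideanSpace ℝ (Fin 3) :=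
    { toFun := fun y => ∑ i, (∑ j, (R i j : ℝ) * y j) • β i
      map_add' := fun x y => by simp [mul_add, Finset.sum_add_distrib, add_smul]
      map_smul' := fun c x => by
        simp only [PiLp.smul_apply, smul_eq_mul, mul_left_comm _ c, ← Finset.mul_sum, mul_smul,
          ← Finset.smul_sum, RingHom.id_apply] }
  have hA₀ : ∀ y, A₀ y = ∑ i, (∑ j, (R i j : ℝ) * y j) • β i := fun y => rfl
  have hinj : Function.Injective A₀ := by
    rw [← LinearMap.ker_eq_bot, LinearMap.ker_eq_bot']
    intro y hy
    have h1 := Fintype.linearIndependent_iff.1 hβ _ ((hA₀ y).symm.trans hy)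
    have h2 : (R.map (Int.cast : ℤ → ℝ)).mulVec (fun j => y j) = 0 := by
      funext i
      simpa [Matrix.mulVec, dotProduct] using h1 i
    have h3 : (R.map (Int.cast : ℤ → ℝ)).det ≠ 0 := by
      rw [← Int.cast_det]; exact_mod_cast hR
    have h4 := Matrix.eq_zero_of_mulVec_eq_zero h3 h2
    ext j
    exact congrFun h4 j
  let A := LinearEquiv.ofInjectiveEndo A₀ hinj
  have hA : ∀ y, A y = A₀ y := fun y => rfl
  have hU : ∀ d y, inner ℝ (toE (u d)) y = inner ℝ (γ d) (A₀ y) := by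
    intro d y
    rw [inner_toE, hA₀, inner_sum]
    simp only [hu, inner_smul_right, Finset.sum_mul]
    rw [Finset.sum_comm]
    refine Finset.sum_congr rfl fun i _ => Finset.sum_congr rfl fun j _ => by ring
  have hflux : ∀ y, (1 / 2 : ℝ) • ∑ d, (inner ℝ (toE (u d)) y : ℝ) • vec d = A₀ y := by
    intro y
    simp only [hU]
    exact hγ.flux_eq (A₀ y)
  have hnorm : ∀ d, ‖toE (u d)‖ ≤ √2 := fun d => by
    refine Real.le_sqrt_of_sq_le ?_
    rw [norm_toE_sq]
    rcases hroot d with h | h <;> rw [h] <;> norm_num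
  obtain ⟨O, f, σ, hσ, hAf, hdet⟩ := A.exists_singular_values
  -- The singular value σ i is ⟨O (f i), A (f i)⟩. Inserting the flux formula and summing over the
  -- orthonormal basis f gives the trace of the polar factor.
  have hσsum : ∑ i, σ i = 1 / 2 * ∑ d, (inner ℝ (O (toE (u d))) (vec d) : ℝ) := by
    have h1 : ∀ i, σ i = 1 / 2 * ∑ d, (inner ℝ (toE (u d)) (f i) : ℝ) * inner ℝ (O (f i)) (vec d) := by
      intro i
      have h2 : inner ℝ (O (f i)) (A (f i)) = σ i := by
        rw [hAf, inner_smul_right, O.inner_map_map]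
        simp
      rw [← h2, hA, ← hflux, inner_smul_right, inner_sum]
      simp only [inner_smul_right]
    rw [Finset.sum_congr rfl fun i _ => h1 i, ← Finset.mul_sum, Finset.sum_comm]
    congr 1
    refine Finset.sum_congr rfl fun d _ => ?_
    conv_rhs => rw [← f.sum_repr (toE (u d)), map_sum, sum_inner]
    refine Finset.sum_congr rfl fun i _ => ?_
    rw [map_smul, inner_smul_left, f.repr_apply_apply, real_inner_comm]
    simp
  have hterm : ∀ d, (inner ℝ (O (toE (u d))) (vec d) : ℝ) ≤ √2 * ‖vec d‖ := fun d => by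
    refine (real_inner_le_norm _ _).trans ?_
    rw [O.norm_map]
    exact mul_le_mul_of_nonneg_right (hnorm d) (norm_nonneg _)
  have hsum_right : 1 / 2 * ∑ d : N.QDart, √2 * ‖vec d‖ = √2 * N.length := by
    rw [← Finset.mul_sum, ← two_length]; ring
  have hσle : ∑ i, σ i ≤ √2 * N.length := by
    rw [hσsum, ← hsum_right]
    exact mul_le_mul_of_nonneg_left (Finset.sum_le_sum fun d _ => hterm d) (by norm_num)
  -- The factor 1/2 still keeps the image of the bcc lattice inside Λ, because the rows of R have
  -- even sums.
  let T : EuclideanSpace ℝ (Fin 3) ≃L[ℝ] EuclideanSpace ℝ (Fin 3) :=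
    ((LinearEquiv.smulOfNeZero ℝ _ (1 / 2 : ℝ) (by norm_num)).trans A).toContinuousLinearEquiv
  have hT : ∀ y, T y = (1 / 2 : ℝ) • A₀ y := fun y => by
    change A₀ ((1 / 2 : ℝ) • y) = _
    rw [map_smul]
  have hdetT : |LinearMap.det (T : EuclideanSpace ℝ (Fin 3) →ₗ[ℝ] EuclideanSpace ℝ (Fin 3))| =
      (∏ i, σ i) / 8 := by
    have h1 : (T : EuclideanSpace ℝ (Fin 3) →ₗ[ℝ] EuclideanSpace ℝ (Fin 3)) =
        (1 / 2 : ℝ) • (A : EuclideanSpace ℝ (Fin 3) →ₗ[ℝ] EuclideanSpace ℝ (Fin 3)) :=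
      LinearMap.ext hT
    rw [h1, LinearMap.det_smul, abs_mul, hdet, finrank_euclideanSpace_fin,
      abs_of_nonneg (by positivity)]
    ring
  have hTmem : ∀ w ∈ bccLattice, T w ∈ Λ := by
    intro w hw
    rw [bccLattice_eq_span] at hw
    induction hw using Submodule.span_induction with
    | mem x hx =>
      obtain ⟨k, rfl⟩ := hx
      choose m hm using hReven
      -- Pairing row i of R with `bccVec k` gives the row sum minus 2 R i k, that is, 2 (m i - R i
      -- k).
      have h1 : T (bccVec k) = ∑ i, (m i - R i k) • β i := by
        rw [hT, hA₀, Finset.smul_sum]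
        refine Finset.sum_congr rfl fun i _ => ?_
        rw [smul_smul, ← Int.cast_smul_eq_zsmul ℝ]
        congr 1
        have h2 : ((R i 0 : ℝ) + R i 1 + R i 2) = m i + m i := by exact_mod_cast hm i
        rw [Fin.sum_univ_three]
        push_cast
        fin_cases k <;> simp [bccVec] <;> linarith
      rw [h1]
      exact Submodule.sum_mem _ fun i _ => Submodule.smul_mem _ _ (hβΛ i)
    | zero => simp
    | add x y _ _ hx hy => rw [map_add]; exact Submodule.add_mem _ hx hy
    | smul a x _ hx => rw [map_zsmul]; exact Submodule.smul_mem _ _ hx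
  have hle : ZLattice.comap ℝ bccLattice T.symm.toLinearMap ≤ Λ := by
    intro x hx
    have h1 : T.symm x ∈ bccLattice := hx
    have h2 := hTmem _ h1
    rwa [T.apply_symm_apply] at h2
  have hcov : ZLattice.covolume (ZLattice.comap ℝ bccLattice T.symm.toLinearMap) =
      (∏ i, σ i) / 2 := by
    rw [covolume_comap_symm, hdetT, covolume_bccLattice]; ring
  obtain ⟨hV, hVeq⟩ := covolume_sublattice hle
  rw [hcov] at hV hVeq
  rw [Fin.sum_univ_three] at hσle hσsum
  rw [Fin.prod_univ_three] at hV hVeq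
  obtain ⟨hagm, hagm_eq⟩ := mul_three_le_add_pow (hσ 0) (hσ 1) (hσ 2)
  have hL := N.length_pos
  have hVpos := ZLattice.covolume_pos Λ
  have hcube : (σ 0 + σ 1 + σ 2) ^ 3 ≤ 2 * √2 * N.length ^ 3 := by
    have := pow_le_pow_left₀ (by linarith [hσ 0, hσ 1, hσ 2]) hσle 3
    refine this.trans (le_of_eq ?_)
    linear_combination √2 * N.length ^ 3 * hs2
  refine ⟨?_, fun heq => ?_⟩
  · rw [div_le_div_iff₀ hs0 hVpos]
    linarith
  rw [div_eq_div_iff hVpos.ne' hs0.ne'] at heq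
  -- Equality makes every link of V ≤ ∏ σ / 2, 27 ∏ σ ≤ (∑ σ)³ ≤ 2√2 L³ tight. Each gives one piece
  -- of rigidity: the lattice, the equal singular values, the directions of the edges.
  obtain ⟨hσ01, hσ12⟩ := hagm_eq (by linarith)
  have hΛeq := hVeq (by linarith)
  have hσeq : ∀ i, σ i = σ 0 := fun i => by fin_cases i <;> simp [hσ01, hσ12]
  have hAO : ∀ y, A₀ y = σ 0 • O y := by
    have : A₀ = σ 0 • (O.toLinearEquiv : EuclideanSpace ℝ (Fin 3) →ₗ[ℝ] EuclideanSpace ℝ (Fin 3)) := by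
      refine f.toBasis.ext fun i => ?_
      rw [f.coe_toBasis, ← hA, hAf, hσeq]
      rfl
    intro y
    rw [this]; rfl
  have hsumeq : σ 0 + σ 1 + σ 2 = √2 * N.length := by
    refine le_antisymm hσle ?_
    refine le_of_pow_le_pow_left₀ (n := 3) (by norm_num) (by linarith [hσ 0, hσ 1, hσ 2]) ?_
    have : (√2 * N.length) ^ 3 = 2 * √2 * N.length ^ 3 := by
      linear_combination √2 * N.length ^ 3 * hs2
    rw [this]
    linarith
  have hterm_eq : ∀ d, (inner ℝ (O (toE (u d))) (vec d) : ℝ) = √2 * ‖vec d‖ := by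
    have h1 : ∑ d, (inner ℝ (O (toE (u d))) (vec d) : ℝ) = ∑ d : N.QDart, √2 * ‖vec d‖ := by
      linarith
    intro d
    exact (Finset.sum_eq_sum_iff_of_le fun d _ => hterm d).1 h1 d (Finset.mem_univ d)
  have hvpos : ∀ d : N.QDart, 0 < ‖vec d‖ := fun d => norm_pos_iff.2 (vec_ne_zero d)
  -- If u d were zero, its term in the trace formula would vanish, whereas equality requires √2
  -- times the positive length.
  have hroot2 : ∀ d, u d 0 ^ 2 + u d 1 ^ 2 + u d 2 ^ 2 = 2 := by
    intro d
    refine (hroot d).resolve_left fun h => ?_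
    have h1 : toE (u d) = 0 := by
      rw [← norm_eq_zero, ← sq_eq_zero_iff, norm_toE_sq, h]; simp
    have h2 := hterm_eq d
    rw [h1, map_zero, inner_zero_left] at h2
    exact (mul_pos hs0 (hvpos d)).ne h2
  have hnorm2 : ∀ d, ‖O (toE (u d))‖ = √2 := fun d => by
    rw [O.norm_map, ← Real.sqrt_sq (norm_nonneg (toE (u d))), norm_toE_sq, hroot2]
    norm_num
  have hvec : ∀ d, vec d = (‖vec d‖ / √2) • O (toE (u d)) := by
    intro d
    have h1 : (inner ℝ (O (toE (u d))) (vec d) : ℝ) = ‖O (toE (u d))‖ * ‖vec d‖ := by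
      rw [hterm_eq, hnorm2]
    have h2 := inner_eq_norm_mul_iff_real.1 h1
    rw [hnorm2] at h2
    rw [div_eq_inv_mul, mul_smul, h2, smul_smul, inv_mul_cancel₀ hs0.ne', one_smul]
  have hu0 : ∀ d, γ d ≠ 0 := by
    intro d h
    have h1 := hroot2 d
    have h2 : ∀ j, u d j = 0 := fun j => by
      have := hu d j
      rw [h] at this
      simpa using this
    rw [h2, h2, h2] at h1
    norm_num at h1
  have huflow : ∀ j, (fun d => (u d j : ℝ)) ∈ N.flows := by
    intro j
    have : (fun d => (u d j : ℝ)) = fun d => inner ℝ (γ d) (A₀ (EuclideanSpace.single j 1)) := by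
      funext d
      rw [← hU, inner_toE]
      simp
    rw [this]
    exact hγ.mem_flows _
  refine ⟨O, fun d => ‖vec d‖ / √2, u, ?_, ?_, hroot2, hvec, fun d => div_pos (hvpos d) hs0,
    ⟨2 * σ 0, by linarith [hσ 0], fun i j => ?_⟩, ⟨σ 0 / 2, O, by linarith [hσ 0], ?_⟩, ?_⟩
  · intro d
    funext j
    have := (huflow j).1 d
    simp only at this
    exact_mod_cast this
  · intro q
    funext j
    have := (huflow j).2 q
    simp only [Finset.sum_apply, Pi.zero_apply]
    beta_reduce at this
    exact_mod_cast this
  -- Matrix entries of A₀ = σ 0 • O relative to the frame O. The flux formula turns them into the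
  -- frame identity, with κ = 2 σ 0.
  · have h1 : (inner ℝ (O (EuclideanSpace.single i 1)) (A₀ (EuclideanSpace.single j 1)) : ℝ) =
        if i = j then σ 0 else 0 := by
      rw [hAO, inner_smul_right, O.inner_map_map]
      simp [EuclideanSpace.inner_single_left, PiLp.single_apply]
    rw [← hflux, inner_smul_right, inner_sum] at h1
    have h2 : ∀ d, (inner ℝ (O (EuclideanSpace.single i 1))
        ((inner ℝ (toE (u d)) (EuclideanSpace.single j 1) : ℝ) • vec d) : ℝ) =
        ‖vec d‖ / √2 * (u d i * u d j) := by
      intro d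
      rw [inner_smul_right]
      nth_rewrite 1 [hvec]
      rw [inner_smul_right, O.inner_map_map]
      simp [EuclideanSpace.inner_single_left, EuclideanSpace.inner_single_right]
      ring
    rw [Finset.sum_congr rfl fun d _ => h2 d] at h1
    split_ifs with hij
    · rw [if_pos hij] at h1; linarith
    · rw [if_neg hij] at h1; linarith
  · rw [← hΛeq, ZLattice.coe_comap]
    have h1 : (fun x => (σ 0 / 2) • O x) = T := by
      funext x
      rw [hT, hAO, smul_smul]
      congr 1
      ring
    rw [h1]
    exact (T.image_eq_preimage_symm _).symm
  · have h1 := N.card_QDart_le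
    -- No covector vanishes, so every flow is determined by its flux and the first Betti number is
    -- at most 3.
    have h2 : Module.finrank ℝ N.flows ≤ 3 := by
      have : Function.Injective (N.flux.domRestrict N.flows) := by
        rw [← LinearMap.ker_eq_bot, LinearMap.ker_eq_bot']
        rintro ⟨z, hz⟩ h
        have h3 : N.flux z = 0 := h
        refine Subtype.ext (funext fun d => ?_)
        change z d = 0
        rw [hγ.eq_inner z hz (fun d hd => absurd hd (hu0 d)) d, h3, inner_zero_right]
      have h4 := LinearMap.finrank_le_finrank_of_injective this
      rwa [finrank_euclideanSpace_fin] at h4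
    omega

end PeriodicNetwork

/-! ### Strings, and the omission of vertices of degree two -/

namespace PeriodicNetwork

variable {n : ℕ} {Λ : Submodule ℤ (EuclideanSpace ℝ (Fin n))} {V : Type*} [AddAction Λ V]
variable {W : Type*} [AddAction Λ W]

/-- `ι` parametrizes an invariant nonempty set of vertices such that all other vertices have degree
`2` and opposite incident edges. -/
structure IsBranchMap (N : PeriodicNetwork Λ V) (ι : W → V) : Prop where
  nonempty : Nonempty W
  injective : Function.Injective ι
  map_vadd : ∀ (g : Λ) (w : W), ι (g +ᵥ w) = g +ᵥ ι w
  deg_two : ∀ v : V, v ∉ Set.range ι → ∃ a b : V, N.graph.neighborSet v = {a, b} ∧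
    N.pos v ∈ openSegment ℝ (N.pos a) (N.pos b)

/-- `N.IsString B x y z`: starting with the dart from `x` to `y` and going straight on at vertices
not in `B`, the first vertex of `B` that is reached is `z`. -/
inductive IsString (N : PeriodicNetwork Λ V) (B : Set V) : V → V → V → Prop
  | base {x y : V} : N.graph.Adj x y → y ∈ B → IsString N B x y y
  | step {x y y' z : V} : N.graph.Adj x y → y ∉ B → N.graph.Adj y y' → y' ≠ x →
      IsString N B y y' z → IsString N B x y z

variable {N : PeriodicNetwork Λ V} {ι : W → V} {B : Set V}

theorem IsString.adj {x y z : V} (h : N.IsString B x y z) : N.graph.Adj x y := by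
  cases h <;> assumption

theorem IsString.mem {x y z : V} (h : N.IsString B x y z) : z ∈ B := by
  induction h with
  | base _ h => exact h
  | step _ _ _ _ _ ih => exact ih

theorem IsString.eq_of_mem {x y z : V} (h : N.IsString B x y z) (hy : y ∈ B) : z = y := by
  cases h with
  | base => rfl
  | step _ h' => exact absurd hy h'

theorem IsBranchMap.mem_vadd (h : IsBranchMap N ι) {g : Λ} {x : V} :
    g +ᵥ x ∈ Set.range ι ↔ x ∈ Set.range ι := by
  constructor
  · rintro ⟨w, hw⟩
    exact ⟨-g +ᵥ w, by rw [h.map_vadd, hw]; simp⟩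
  · rintro ⟨w, rfl⟩
    exact ⟨g +ᵥ w, h.map_vadd g w⟩

theorem IsBranchMap.isString_vadd (h : IsBranchMap N ι) (g : Λ) {x y z : V}
    (hs : N.IsString (Set.range ι) x y z) :
    N.IsString (Set.range ι) (g +ᵥ x) (g +ᵥ y) (g +ᵥ z) := by
  induction hs with
  | base hxy hy => exact .base (N.adj_vadd g _ _ hxy) (h.mem_vadd.2 hy)
  | step hxy hy hyy hne _ ih =>
    exact .step (N.adj_vadd g _ _ hxy) (fun hm => hy (h.mem_vadd.1 hm)) (N.adj_vadd g _ _ hyy)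
      (fun e => hne (vadd_left_cancel g e)) ih

/-- The opposite incident edges force two distinct neighbours, since otherwise y would have the
position of its only neighbour. So there is exactly one way to go on, and it is straight. -/
theorem IsBranchMap.exists_other (h : IsBranchMap N ι) {x y : V} (hxy : N.graph.Adj x y)
    (hy : y ∉ Set.range ι) : ∃ z, z ≠ x ∧ N.graph.Adj y z ∧
      (∀ w, N.graph.Adj y w → w = x ∨ w = z) ∧
      ∃ s : ℝ, 0 < s ∧ N.pos z - N.pos y = s • (N.pos y - N.pos x) := by
  obtain ⟨a, b, hab, α, β, hα, hβ, hαβ, hpos⟩ := h.deg_two y hy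
  have hadj : ∀ w, N.graph.Adj y w ↔ w = a ∨ w = b := fun w => by
    rw [← SimpleGraph.mem_neighborSet, hab]; simp
  have hne : a ≠ b := by
    rintro rfl
    rw [← add_smul, hαβ, one_smul] at hpos
    exact N.pos_ne y a ((hadj a).2 (Or.inl rfl)) hpos.symm
  have key : ∀ (α β : ℝ) (p q r : EuclideanSpace ℝ (Fin n)), 0 < β → α + β = 1 →
      α • p + β • q = r → q - r = (α / β) • (r - p) := by
    rintro α β p q r hβ hs rfl
    obtain rfl : α = 1 - β := by linarith
    have : q = β⁻¹ • (β • q) := by rw [smul_smul, inv_mul_cancel₀ hβ.ne', one_smul]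
    have h2 : ((1 - β) / β) * β = 1 - β := by field_simp
    simp only [smul_sub, smul_add, smul_smul, h2]
    have h3 : ((1 - β) / β) * (1 - β) = (1 - β) / β - (1 - β) := by field_simp
    rw [h3]
    module
  rcases (hadj x).1 hxy.symm with rfl | rfl
  · exact ⟨b, hne.symm, (hadj b).2 (Or.inr rfl), fun w hw => (hadj w).1 hw, α / β,
      div_pos hα hβ, key _ _ _ _ _ hβ hαβ hpos⟩
  · exact ⟨a, hne, (hadj a).2 (Or.inl rfl), fun w hw => ((hadj w).1 hw).symm, β / α,
      div_pos hβ hα, key _ _ _ _ _ hα (by rw [add_comm]; exact hαβ)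
        (by rw [add_comm]; exact hpos)⟩

theorem IsBranchMap.isString_unique (h : IsBranchMap N ι) {x y z z' : V}
    (hs : N.IsString (Set.range ι) x y z) (hs' : N.IsString (Set.range ι) x y z') : z = z' := by
  induction hs with
  | base _ hy => exact (hs'.eq_of_mem hy).symm
  | step hxy hy hyy hne _ ih =>
    cases hs' with
    | base _ hy' => exact absurd hy' hy
    | step _ _ hyy' hne' hs' =>
      obtain ⟨v, _, _, hv, _⟩ := h.exists_other hxy hy
      have h1 := (hv _ hyy).resolve_left hne
      have h2 := (hv _ hyy').resolve_left hne'
      subst h1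
      rw [h2] at hs'
      exact ih hs'

theorem IsBranchMap.isString_pos (h : IsBranchMap N ι) {x y z : V}
    (hs : N.IsString (Set.range ι) x y z) :
    ∃ t : ℝ, 1 ≤ t ∧ N.pos z - N.pos x = t • (N.pos y - N.pos x) := by
  induction hs with
  | base => exact ⟨1, le_rfl, by simp⟩
  | @step x y y' z hxy hy hyy hne _ ih =>
    obtain ⟨t, ht, htz⟩ := ih
    obtain ⟨v, _, _, hv, s, hs, hsv⟩ := h.exists_other hxy hy
    rw [← (hv _ hyy).resolve_left hne] at hsv
    refine ⟨1 + t * s, by nlinarith, ?_⟩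
    have : N.pos z - N.pos x = (N.pos z - N.pos y) + (N.pos y - N.pos x) := by abel
    rw [this, htz, hsv, add_smul, one_smul, smul_smul, add_comm]

/-- The string already read backwards is carried along as `hw` and extended by one edge at each
step. -/
theorem isString_reverse_aux {x y z w : V} (hs : N.IsString B x y z)
    (hw : N.IsString B y x w) : ∃ y', N.IsString B z y' w := by
  induction hs with
  | base => exact ⟨_, hw⟩
  | step hxy hy hyy hne _ ih => exact ih (.step hyy.symm hy hxy.symm hne.symm hw)

theorem IsString.reverse {x y z : V} (hs : N.IsString B x y z) (hx : x ∈ B) :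
    ∃ y', N.IsString B z y' x :=
  isString_reverse_aux hs (.base hs.adj.symm hx)

/-- Edges at a common vertex with the same direction agree. -/
theorem smul_eq_zero_of_star {x y y' : V} (h : N.graph.Adj x y) (h' : N.graph.Adj x y')
    (hne : y ≠ y') {s s' : ℝ} (hs : 0 ≤ s) (hs' : 0 ≤ s')
    (e : s • (N.pos y - N.pos x) = s' • (N.pos y' - N.pos x)) :
    s • (N.pos y - N.pos x) = 0 := by
  set c : ℝ := (1 + s + s')⁻¹ with hc
  have hc0 : 0 < c := by positivity
  have hcs : c * (1 + s + s') = 1 := inv_mul_cancel₀ (by positivity)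
  have hmem : N.pos x + (c * s) • (N.pos y - N.pos x) ∈
      segment ℝ (N.pos x) (N.pos y) ∩ segment ℝ (N.pos x) (N.pos y') := by
    constructor
    · rw [segment_eq_image']
      exact ⟨c * s, ⟨by positivity, by nlinarith⟩, rfl⟩
    · rw [segment_eq_image']
      refine ⟨c * s', ⟨by positivity, by nlinarith⟩, ?_⟩
      simp only [mul_smul, e]
  rw [N.star_embedded x y y' h h' hne, Set.mem_singleton_iff, add_eq_left, mul_smul] at hmem
  exact (smul_eq_zero.1 hmem).resolve_left hc0.ne'

theorem sub_pos_ne_zero {x y : V} (h : N.graph.Adj x y) : N.pos y - N.pos x ≠ 0 :=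
  sub_ne_zero.2 (N.pos_ne x y h).symm

/-- Strings are straight, so two strings from x to z leave x in the same direction, which the
embedded star forbids for distinct edges. Hence smoothing creates no multiple edges of the periodic
graph. -/
theorem IsBranchMap.isString_unique_start (h : IsBranchMap N ι) {x y y' z : V}
    (hs : N.IsString (Set.range ι) x y z) (hs' : N.IsString (Set.range ι) x y' z) : y = y' := by
  by_contra hne
  obtain ⟨t, ht, e⟩ := h.isString_pos hs
  obtain ⟨t', ht', e'⟩ := h.isString_pos hs'
  have := smul_eq_zero_of_star hs.adj hs'.adj hne (by linarith) (by linarith) (e.symm.trans e')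
  exact (smul_ne_zero (by linarith) (sub_pos_ne_zero hs.adj)) this

/-- A string is a positive multiple of its first edge, so it cannot close up in ℝⁿ. Hence smoothing
creates no loops. -/
theorem IsBranchMap.isString_ne (h : IsBranchMap N ι) {x y z : V}
    (hs : N.IsString (Set.range ι) x y z) : N.pos x ≠ N.pos z := by
  obtain ⟨t, ht, e⟩ := h.isString_pos hs
  intro hz
  rw [hz, sub_self] at e
  rw [← hz] at e
  exact (smul_ne_zero (by linarith) (sub_pos_ne_zero hs.adj)) e.symm

section opposite

/-- The other dart at the initial vertex, if this vertex is not a branch vertex. -/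
theorem IsBranchMap.exists_opp (h : IsBranchMap N ι) : ∃ opp : N.QDart → N.QDart,
    (∀ d, opp (opp d) = d) ∧ (∀ d, src (opp d) = src d) ∧
    ∀ (x y : V) (hxy : N.graph.Adj x y), y ∉ Set.range ι →
      ∃ (z : V) (hyz : N.graph.Adj y z), opp (mkDart hxy.symm) = mkDart hyz ∧ z ≠ x ∧
        (∀ w, N.graph.Adj y w → w = x ∨ w = z) ∧
        ∃ s : ℝ, 0 < s ∧ N.pos z - N.pos y = s • (N.pos y - N.pos x) := by
  have key : ∀ d : N.QDart, ∃ d', ((∃ w, N.mkV (ι w) = src d) → d' = d) ∧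
      ((¬ ∃ w, N.mkV (ι w) = src d) → d' ≠ d ∧ src d' = src d ∧
        ∀ e, src e = src d → e = d ∨ e = d') := by
    intro d
    by_cases hd : ∃ w, N.mkV (ι w) = src d
    · exact ⟨d, fun _ => rfl, fun h' => absurd hd h'⟩
    induction d using QDart.ind with
    | _ y x hyx =>
      have hy : y ∉ Set.range ι := by rintro ⟨w, rfl⟩; exact hd ⟨w, rfl⟩
      obtain ⟨z, hzx, hyz, hw, _⟩ := h.exists_other hyx.symm hy
      refine ⟨mkDart hyz, fun h' => absurd h' hd, fun _ => ⟨fun e => hzx (mkDart_injective e), rfl,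
        fun e he => ?_⟩⟩
      obtain ⟨v, hv, rfl⟩ := exists_dart_of_src (x := y) he
      rcases hw v hv with rfl | rfl
      · exact Or.inl rfl
      · exact Or.inr rfl
  choose opp h1 h2 using key
  have hsrc : ∀ d, src (opp d) = src d := fun d => by
    by_cases hd : ∃ w, N.mkV (ι w) = src d
    · rw [h1 d hd]
    · exact (h2 d hd).2.1
  refine ⟨opp, fun d => ?_, hsrc, fun x y hxy hy => ?_⟩
  · by_cases hd : ∃ w, N.mkV (ι w) = src d
    · rw [h1 d hd, h1 d hd]
    · have hd' : ¬ ∃ w, N.mkV (ι w) = src (opp d) := by rwa [hsrc]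
      have a1 := (h2 d hd).2.2 (opp (opp d)) (by rw [hsrc, hsrc])
      exact a1.resolve_right (h2 _ hd').1
  · have hd : ¬ ∃ w, N.mkV (ι w) = src (mkDart hxy.symm) := by
      rintro ⟨w, hw⟩
      obtain ⟨g, hg⟩ := mkV_eq_iff.1 hw
      exact hy ⟨g +ᵥ w, by rw [h.map_vadd, hg]⟩
    obtain ⟨z, hzx, hyz, hw, hs⟩ := h.exists_other hxy hy
    refine ⟨z, hyz, ?_, hzx, hw, hs⟩
    exact (((h2 _ hd).2.2 (mkDart hyz) rfl).resolve_left fun e => hzx (mkDart_injective e)).symm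

theorem IsBranchMap.not_mem_iff (h : IsBranchMap N ι) {x : V} :
    (∃ w, N.mkV (ι w) = N.mkV x) ↔ x ∈ Set.range ι := by
  constructor
  · rintro ⟨w, hw⟩
    obtain ⟨g, hg⟩ := mkV_eq_iff.1 hw
    exact ⟨g +ᵥ w, by rw [h.map_vadd, hg]⟩
  · rintro ⟨w, rfl⟩
    exact ⟨w, rfl⟩

/-- Only finitely many darts exist modulo Λ, so an endless string would repeat modulo Λ. By
connectedness its vertices would be everything, but there is a branch vertex. -/
theorem IsBranchMap.exists_isString (h : IsBranchMap N ι) {x y : V} (hxy : N.graph.Adj x y) :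
    ∃ z, N.IsString (Set.range ι) x y z := by
  obtain ⟨opp, hopp, hsrc, hopp'⟩ := h.exists_opp
  by_contra hcon
  let S : Set N.QDart := {d | ∃ (x y : V) (hxy : N.graph.Adj x y), d = mkDart hxy ∧
    ¬ ∃ z, N.IsString (Set.range ι) x y z}
  have hS : ∀ d ∈ S, (∀ v, tgt d = N.mkV v → v ∉ Set.range ι) ∧ opp (rev d) ∈ S := by
    rintro d ⟨x, y, hxy, rfl, hz⟩
    have hy : y ∉ Set.range ι := fun hy => hz ⟨y, .base hxy hy⟩
    refine ⟨fun v hv hvB => hy (h.not_mem_iff.1 ?_), ?_⟩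
    · obtain ⟨w, hw⟩ := h.not_mem_iff.2 hvB
      exact ⟨w, hw.trans hv.symm⟩
    · obtain ⟨y', hyy, e, hne, _⟩ := hopp' x y hxy hy
      exact ⟨y, y', hyy, e, fun ⟨z, hs⟩ => hz ⟨z, .step hxy hy hyy hne hs⟩⟩
  -- Going one step straight on is injective on the finite set S of darts with endless strings,
  -- hence surjective. So both neighbours of a vertex reached by S are again reached.
  let nxt : S → S := fun d => ⟨opp (rev d.1), (hS d.1 d.2).2⟩
  have hinj : Function.Injective nxt := fun d d' e => by
    have h1 : opp (rev d.1) = opp (rev d'.1) := congrArg Subtype.val e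
    have h2 := congrArg opp h1
    rw [hopp, hopp] at h2
    exact Subtype.ext (rev_involutive.injective h2)
  have hsurj := Finite.surjective_of_injective hinj
  have hall := N.eq_univ_of_closed (A := {v | ∃ d ∈ S, tgt d = N.mkV v}) (x := y)
    ⟨mkDart hxy, ⟨x, y, hxy, rfl, hcon⟩, rfl⟩ (by
      rintro a b ⟨d, hd, hda⟩ hab
      have haB := (hS d hd).1 a hda
      obtain ⟨c, hc, hce⟩ := exists_dart_of_src (x := a) (d := rev d) (by rw [src_rev, hda])
      obtain ⟨c', hc', e, _, hw, _⟩ := hopp' c a hc.symm haB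
      rcases hw b hab with rfl | rfl
      · obtain ⟨⟨d', hd'⟩, e'⟩ := hsurj ⟨d, hd⟩
        have e'' : opp (rev d') = d := congrArg Subtype.val e'
        refine ⟨d', hd', ?_⟩
        have h3 := congrArg src e''
        rw [hsrc, src_rev] at h3
        rw [h3, ← tgt_rev, hce]
        rfl
      · refine ⟨opp (rev d), (hS d hd).2, ?_⟩
        rw [hce, e]
        rfl)
  obtain ⟨w⟩ := h.nonempty
  obtain ⟨d, hd, hdw⟩ := hall (ι w)
  exact (hS d hd).1 _ hdw ⟨w, rfl⟩

end opposite

/-- The graph on the branch vertices whose edges are the strings of `N`. -/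
def stringGraph (h : IsBranchMap N ι) : SimpleGraph W where
  Adj w w' := ∃ y, N.IsString (Set.range ι) (ι w) y (ι w')
  symm := ⟨fun _ _ ⟨_, hs⟩ => hs.reverse ⟨_, rfl⟩⟩
  loopless := ⟨fun _ ⟨_, hs⟩ => h.isString_ne hs rfl⟩

theorem IsBranchMap.eq_of_vadd (h : IsBranchMap N ι) {w w₁ w' w₁' : W} {y y₁ : V} {g : Λ}
    (hs : N.IsString (Set.range ι) (ι w) y (ι w')) (hs₁ : N.IsString (Set.range ι) (ι w₁) y₁ (ι w₁'))
    (hg : g +ᵥ ι w = ι w₁) (hy : g +ᵥ y = y₁) : g +ᵥ w = w₁ ∧ g +ᵥ w' = w₁' := by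
  have h1 : g +ᵥ w = w₁ := h.injective (by rw [h.map_vadd, hg])
  refine ⟨h1, h.injective ?_⟩
  have h2 := h.isString_vadd g hs
  rw [hg, hy] at h2
  rw [h.map_vadd]
  exact h.isString_unique h2 hs₁

/-- The network obtained by omitting the vertices that are not branch vertices. -/
def smooth (h : IsBranchMap N ι) : PeriodicNetwork Λ W where
  graph := stringGraph h
  pos w := N.pos (ι w)
  connected := by
    have hne := h.nonempty
    refine ⟨fun w₀ w => ?_⟩
    -- The property propagated along N is that all branch vertices at x, or at the end of a string
    -- starting from x, are reachable from w₀. It makes sense also at vertices that are not branch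
    -- vertices.
    have hall := N.eq_univ_of_closed (x := ι w₀)
      (A := {x | (∀ w, ι w = x → (stringGraph h).Reachable w₀ w) ∧
        ∀ y w, N.IsString (Set.range ι) x y (ι w) → (stringGraph h).Reachable w₀ w})
      ⟨fun w hw => by rw [h.injective hw],
        fun y w hs => SimpleGraph.Adj.reachable ⟨y, hs⟩⟩ (by
        rintro a b ⟨ha1, ha2⟩ hab
        by_cases hb : b ∈ Set.range ι
        · obtain ⟨v, rfl⟩ := hb
          have hr := ha2 _ v (.base hab ⟨v, rfl⟩)
          exact ⟨fun w hw => by rwa [h.injective hw],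
            fun y w hs => hr.trans (SimpleGraph.Adj.reachable ⟨y, hs⟩)⟩
        · refine ⟨fun w hw => absurd ⟨w, hw⟩ hb, fun y w hs => ?_⟩
          obtain ⟨c, hca, hbc, hw, _⟩ := h.exists_other hab hb
          rcases hw y hs.adj with rfl | rfl
          · by_cases ha : y ∈ Set.range ι
            · exact ha1 w (hs.eq_of_mem ha)
            · cases hs with
              | base _ ha' => exact absurd ha' ha
              | step _ _ _ _ hs' => exact ha2 _ w hs'
          · exact ha2 _ w (.step hab hb hbc hca hs))
    exact (hall (ι w)).1 w rfl
  adj_vadd g w w' := by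
    rintro ⟨y, hs⟩
    refine ⟨g +ᵥ y, ?_⟩
    rw [h.map_vadd, h.map_vadd]
    exact h.isString_vadd g hs
  pos_vadd g w := by rw [h.map_vadd, N.pos_vadd]
  pos_ne w w' := by
    rintro ⟨y, hs⟩
    exact h.isString_ne hs
  star_embedded := by
    rintro w w₁ w₂ ⟨y₁, hs₁⟩ ⟨y₂, hs₂⟩ hne
    refine Set.Subset.antisymm ?_ (Set.singleton_subset_iff.2
      ⟨left_mem_segment ℝ _ _, left_mem_segment ℝ _ _⟩)
    rintro p ⟨hp1, hp2⟩
    rw [segment_eq_image'] at hp1 hp2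
    obtain ⟨a, ha, rfl⟩ := hp1
    obtain ⟨b, hb, hab⟩ := hp2
    obtain ⟨t₁, ht₁, e₁⟩ := h.isString_pos hs₁
    obtain ⟨t₂, ht₂, e₂⟩ := h.isString_pos hs₂
    have hy : y₁ ≠ y₂ := by
      rintro rfl
      exact hne (h.injective (h.isString_unique hs₁ hs₂))
    simp only [Set.mem_singleton_iff, add_eq_left, e₁, e₂, smul_smul, add_right_inj] at hab ⊢
    exact smul_eq_zero_of_star hs₁.adj hs₂.adj hy (mul_nonneg ha.1 (by linarith))
      (mul_nonneg hb.1 (by linarith)) hab.symm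
  finite_vertices := by
    have := N.finite_vertices
    refine Finite.of_injective (β := N.QVertex)
      (fun q : AddAction.orbitRel.Quotient Λ W => N.mkV (ι (Quotient.out q))) fun q q' e => ?_
    obtain ⟨g, hg⟩ := mkV_eq_iff.1 e
    rw [← h.map_vadd] at hg
    have h1 := h.injective hg
    rw [← Quotient.out_eq q, ← Quotient.out_eq q', Quotient.eq]
    exact ⟨-g, by simp [← h1]⟩
  finite_edges := by
    have key : ∀ E : Quotient (edgeOrbitSetoid Λ (stringGraph h)), ∃ d : N.QDart,
        ∃ (w w' : W) (hw : (stringGraph h).Adj w w') (y : V) (hy : N.graph.Adj (ι w) y),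
          E = Quotient.mk _ ⟨s(w, w'), hw⟩ ∧ d = mkDart hy ∧
          N.IsString (Set.range ι) (ι w) y (ι w') := by
      intro E
      induction E using Quotient.inductionOn with
      | _ e =>
        obtain ⟨e, he⟩ := e
        induction e using Sym2.ind with
        | _ w w' =>
          obtain ⟨y, hs⟩ : (stringGraph h).Adj w w' := he
          exact ⟨_, w, w', ⟨y, hs⟩, y, hs.adj, rfl, rfl, hs⟩
    choose F hF using key
    refine Finite.of_injective F fun E E' e => ?_
    obtain ⟨w, w', hw, y, hy, hE, hd, hs⟩ := hF E
    obtain ⟨w₁, w₁', hw₁, y₁, hy₁, hE₁, hd₁, hs₁⟩ := hF E'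
    rw [hd, hd₁] at e
    obtain ⟨g, hg, hgy⟩ := mkDart_eq_iff.1 e
    obtain ⟨h1, h2⟩ := h.eq_of_vadd hs hs₁ hg hgy
    rw [hE, hE₁]
    refine Quotient.sound ⟨g, ?_⟩
    change Sym2.map _ s(w, w') = s(w₁, w₁')
    rw [Sym2.map_mk, h1, h2]

/-- Omitting vertices of degree two does not change the length. -/
theorem length_smooth (h : IsBranchMap N ι) : (smooth h).length = N.length := by
  obtain ⟨opp, hopp, hsrc, hopp'⟩ := h.exists_opp
  -- The number f d is the distance from the initial vertex of d to the end of its string.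
  have hf : ∀ d : N.QDart, ∃ r : ℝ, ∀ (x y z : V) (hxy : N.graph.Adj x y), d = mkDart hxy →
      N.IsString (Set.range ι) x y z → r = dist (N.pos x) (N.pos z) := by
    intro d
    induction d using QDart.ind with
    | _ x y hxy =>
      obtain ⟨z, hz⟩ := h.exists_isString hxy
      refine ⟨dist (N.pos x) (N.pos z), fun x' y' z' hxy' e hs => ?_⟩
      obtain ⟨g, rfl, rfl⟩ := mkDart_eq_iff.1 e
      rw [h.isString_unique hs (h.isString_vadd g hz), N.pos_vadd, N.pos_vadd, dist_add_right]
  choose f hf using hf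
  let b : N.QVertex → Prop := fun q => ∃ w, N.mkV (ι w) = q
  have hrec : ∀ d, f d = ‖vec d‖ + if b (tgt d) then 0 else f (opp (rev d)) := by
    intro d
    induction d using QDart.ind with
    | _ x y hxy =>
      by_cases hy : y ∈ Set.range ι
      · have hb : b (tgt (mkDart hxy)) := h.not_mem_iff.2 hy
        rw [if_pos hb, hf _ x y y hxy rfl (.base hxy hy), vec_mkDart, add_zero,
          dist_comm, dist_eq_norm]
      · have hb : ¬ b (tgt (mkDart hxy)) := fun hb => hy (h.not_mem_iff.1 hb)
        rw [if_neg hb]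
        obtain ⟨y', hyy, e, hne, _, s, hs, hsv⟩ := hopp' x y hxy hy
        obtain ⟨z, hz⟩ := h.exists_isString hyy
        obtain ⟨t, ht, e'⟩ := h.isString_pos hz
        rw [rev_mkDart, e, hf _ x y z hxy rfl (.step hxy hy hyy hne hz), hf _ y y' z hyy rfl hz,
          vec_mkDart, dist_comm, dist_comm (N.pos y), dist_eq_norm, dist_eq_norm]
        have : N.pos z - N.pos x = (N.pos y - N.pos x) + (N.pos z - N.pos y) := by abel
        rw [this]
        refine SameRay.norm_add ?_
        rw [e', hsv, smul_smul]
        exact SameRay.sameRay_nonneg_smul_right _ (mul_nonneg (by linarith) hs.le)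
  have hsum : ∑ d : N.QDart, ‖vec d‖ = ∑ d with b (src d), f d := by
    have h1 : ∑ d, f d = ∑ d : N.QDart, ‖vec d‖ + ∑ d, if b (tgt d) then 0 else f (opp (rev d)) := by
      rw [← Finset.sum_add_distrib]
      exact Finset.sum_congr rfl fun d _ => hrec d
    -- Reversal followed by `opp` advances one step along a string. Reindexing by it cancels the
    -- continuation terms, so only strings that start at branch vertices remain.
    have h2 : (∑ d, if b (tgt d) then 0 else f (opp (rev d))) =
        ∑ d : N.QDart, if b (src d) then 0 else f d := by
      rw [← sum_rev]
      simp only [tgt_rev, rev_rev]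
      have hinv : Function.Involutive opp := hopp
      rw [← Equiv.sum_comp hinv.toPerm (fun d : N.QDart => if b (src d) then 0 else f d)]
      refine Finset.sum_congr rfl fun d _ => ?_
      rw [Function.Involutive.coe_toPerm, hsrc]
    have h3 : ∑ d, f d = ∑ d : N.QDart, (if b (src d) then f d else 0) +
        ∑ d : N.QDart, (if b (src d) then 0 else f d) := by
      rw [← Finset.sum_add_distrib]
      refine Finset.sum_congr rfl fun d _ => ?_
      split_ifs <;> simp
    rw [Finset.sum_filter]
    linarith
  have key : ∀ D : (smooth h).QDart, ∃ d : N.QDart,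
      ∃ (w w' : W) (hw : (smooth h).graph.Adj w w') (y : V) (hy : N.graph.Adj (ι w) y),
        D = mkDart hw ∧ d = mkDart hy ∧ N.IsString (Set.range ι) (ι w) y (ι w') := by
    intro D
    induction D using QDart.ind with
    | _ w w' hw =>
      obtain ⟨y, hs⟩ := hw
      exact ⟨_, w, w', ⟨y, hs⟩, y, hs.adj, rfl, rfl, hs⟩
  choose F hF using key
  have hmain : ∑ D : (smooth h).QDart, ‖vec D‖ = ∑ d with b (src d), f d := by
    refine Finset.sum_bij (fun D _ => F D) (fun D _ => ?_) (fun D _ D' _ e => ?_)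
      (fun d hd => ?_) (fun D _ => ?_)
    · obtain ⟨w, w', hw, y, hy, hE, hd, hs⟩ := hF D
      rw [Finset.mem_filter, hd]
      exact ⟨Finset.mem_univ _, w, rfl⟩
    · obtain ⟨w, w', hw, y, hy, hE, hd, hs⟩ := hF D
      obtain ⟨w₁, w₁', hw₁, y₁, hy₁, hE₁, hd₁, hs₁⟩ := hF D'
      rw [hd, hd₁] at e
      obtain ⟨g, hg, hgy⟩ := mkDart_eq_iff.1 e
      rw [hE, hE₁]
      exact mkDart_eq_iff.2 ⟨g, h.eq_of_vadd hs hs₁ hg hgy⟩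
    · obtain ⟨w, hw⟩ := (Finset.mem_filter.1 hd).2
      obtain ⟨y, hy, rfl⟩ := exists_dart_of_src hw.symm
      obtain ⟨z, hz⟩ := h.exists_isString hy
      obtain ⟨w', rfl⟩ := hz.mem
      have hadj : (smooth h).graph.Adj w w' := ⟨y, hz⟩
      refine ⟨mkDart hadj, Finset.mem_univ _, ?_⟩
      obtain ⟨w₁, w₁', hw₁, y₁, hy₁, hE₁, hd₁, hs₁⟩ := hF (mkDart hadj)
      obtain ⟨g, rfl, rfl⟩ := mkDart_eq_iff.1 hE₁
      rw [h.map_vadd, h.map_vadd] at hs₁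
      have h1 := h.isString_unique_start hs₁ (h.isString_vadd g hz)
      rw [hd₁]
      refine (mkDart_eq_iff.2 ⟨g, (h.map_vadd g w).symm, h1.symm⟩).symm
    · obtain ⟨w, w', hw, y, hy, hE, hd, hs⟩ := hF D
      rw [hf (F D) _ _ _ hy hd hs, hE, vec_mkDart, dist_comm, dist_eq_norm]
      rfl
  have e1 := (smooth h).two_length
  have e2 := N.two_length
  rw [hmain, ← hsum] at e1
  linarith

section subdivision

theorem exists_walk_of_isString {x y z : V} (hs : N.IsString B x y z) :
    ∃ p : N.graph.Walk x z, ∀ v ∈ p.support, v ∈ B → v = x ∨ v = z := by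
  induction hs with
  | @base x y hxy _ => exact ⟨hxy.toWalk, by simp⟩
  | step hxy hy _ _ _ ih =>
    obtain ⟨p, hp⟩ := ih
    refine ⟨.cons hxy p, fun v hv hvB => ?_⟩
    rw [SimpleGraph.Walk.support_cons, List.mem_cons] at hv
    rcases hv with rfl | hv
    · exact Or.inl rfl
    · rcases hp v hv hvB with rfl | h
      · exact absurd hvB hy
      · exact Or.inr h

theorem isString_of_walk {y z : V} (p : N.graph.Walk y z) (hp : p.IsPath) (hz : z ∈ B) :
    ∀ x, N.graph.Adj x y → x ∉ p.support → (∀ v ∈ p.support, v ∈ B → v = z) →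
      N.IsString B x y z := by
  induction p with
  | nil => exact fun x hxy _ _ => .base hxy hz
  | @cons y y' z hyy p ih =>
    intro x hxy hx hB
    rw [SimpleGraph.Walk.support_cons, List.mem_cons, not_or] at hx
    rw [SimpleGraph.Walk.cons_isPath_iff] at hp
    have hy : y ∉ B := fun hyB => by
      have := hB y (by simp) hyB
      exact hp.2 (this ▸ p.end_mem_support)
    refine .step hxy hy hyy ?_ (ih hp.1 hz y hyy hp.2 fun v hv => hB v (by simp [hv]))
    rintro rfl
    exact hx.2 p.start_mem_support

/-- A path whose interior avoids the branch vertices never turns back, so it follows the unique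
continuation at each vertex. This matches strings with the adjacency in `IsSubdivisionOf`. -/
theorem IsBranchMap.string_iff_path (h : IsBranchMap N ι) {w w' : W} :
    (∃ y, N.IsString (Set.range ι) (ι w) y (ι w')) ↔ w ≠ w' ∧
      ∃ p : N.graph.Walk (ι w) (ι w'), p.IsPath ∧
        ∀ v ∈ p.support, v ∈ Set.range ι → v = ι w ∨ v = ι w' := by
  constructor
  · rintro ⟨y, hs⟩
    refine ⟨fun e => h.isString_ne hs (by rw [e]), ?_⟩
    obtain ⟨p, hp⟩ := exists_walk_of_isString hs
    exact ⟨p.bypass, p.bypass_isPath, fun v hv => hp v (p.support_bypass_subset_support hv)⟩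
  · rintro ⟨hne, p, hp, hB⟩
    obtain ⟨y, hxy, p, rfl⟩ := SimpleGraph.Walk.exists_eq_cons_of_ne
      (fun e => hne (h.injective e)) p
    rw [SimpleGraph.Walk.cons_isPath_iff] at hp
    refine ⟨y, isString_of_walk p hp.1 (Set.mem_range_self w') _ hxy hp.2 fun v hv hvB => ?_⟩
    refine (hB v (by simp [hv]) hvB).resolve_left ?_
    rintro rfl
    exact hp.2 hv

theorem isSubdivisionOf_smooth (h : IsBranchMap N ι) : N.IsSubdivisionOf (smooth h) :=
  ⟨ι, h.injective, h.map_vadd, fun _ => rfl, h.deg_two, fun _ _ => h.string_iff_path⟩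

/-- The smoothing of N along ι has the graph and the positions of M, so it is M. -/
theorem length_eq_of_isSubdivisionOf {M : PeriodicNetwork Λ W} (h : N.IsSubdivisionOf M) :
    N.length = M.length := by
  obtain ⟨ι, h1, h2, h3, h4, h5⟩ := h
  have hb : IsBranchMap N ι := ⟨M.connected.nonempty, h1, h2, h4⟩
  have : smooth hb = M := by
    have hg : (smooth hb).graph = M.graph := by
      ext w w'
      rw [h5, ← hb.string_iff_path]
      rfl
    have hp : (smooth hb).pos = M.pos := funext h3
    cases M
    unfold smooth at hg hp ⊢
    simp only at hg hp
    subst hg hp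
    rfl
  rw [← this, length_smooth]

end subdivision

end PeriodicNetwork

/-! ### The twelve roots of D₃ -/

section roots

theorem coord_of_root {a b c : ℤ} (h : a ^ 2 + b ^ 2 + c ^ 2 = 2) :
    a ∈ ({-1, 0, 1} : List ℤ) ∧ b ∈ ({-1, 0, 1} : List ℤ) ∧ c ∈ ({-1, 0, 1} : List ℤ) := by
  have key : ∀ x y z : ℤ, x ^ 2 + y ^ 2 + z ^ 2 = 2 → x ∈ ({-1, 0, 1} : List ℤ) := by
    intro x y z h
    have h1 : -2 < x := by nlinarith [sq_nonneg y, sq_nonneg z]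
    have h2 : x < 2 := by nlinarith [sq_nonneg y, sq_nonneg z]
    interval_cases x <;> decide
  exact ⟨key a b c h, key b c a (by linarith), key c a b (by linarith)⟩

-- For roots r and u there are three cases. If u = ±r, the square is 4 and the sum is 0. If u is
-- another root with the same two nonzero coordinates, both terms vanish. Otherwise u shares one
-- nonzero coordinate with r and is nonzero where r vanishes, so both terms are 1.
set_option maxRecDepth 10000 in
theorem root_indicator_aux : ∀ a ∈ ({-1, 0, 1} : List ℤ), ∀ b ∈ ({-1, 0, 1} : List ℤ),
    ∀ c ∈ ({-1, 0, 1} : List ℤ), ∀ x ∈ ({-1, 0, 1} : List ℤ), ∀ y ∈ ({-1, 0, 1} : List ℤ),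
    ∀ z ∈ ({-1, 0, 1} : List ℤ), a ^ 2 + b ^ 2 + c ^ 2 = 2 → x ^ 2 + y ^ 2 + z ^ 2 = 2 →
      (a * x + b * y + c * z) ^ 2 -
        ((1 - a ^ 2) * x ^ 2 + (1 - b ^ 2) * y ^ 2 + (1 - c ^ 2) * z ^ 2) =
      if (x = a ∧ y = b ∧ z = c) ∨ (x = -a ∧ y = -b ∧ z = -c) then 4 else 0 := by
  decide

/-- A quadratic form that separates a root of `D₃` and its negative from the other roots. -/
theorem root_indicator {r u : Fin 3 → ℤ} (hr : r 0 ^ 2 + r 1 ^ 2 + r 2 ^ 2 = 2)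
    (hu : u 0 ^ 2 + u 1 ^ 2 + u 2 ^ 2 = 2) :
    (r 0 * u 0 + r 1 * u 1 + r 2 * u 2) ^ 2 -
        ((1 - r 0 ^ 2) * u 0 ^ 2 + (1 - r 1 ^ 2) * u 1 ^ 2 + (1 - r 2 ^ 2) * u 2 ^ 2) =
      if u = r ∨ u = -r then 4 else 0 := by
  obtain ⟨h1, h2, h3⟩ := coord_of_root hr
  obtain ⟨h4, h5, h6⟩ := coord_of_root hu
  rw [root_indicator_aux _ h1 _ h2 _ h3 _ h4 _ h5 _ h6 hr hu]
  simp [funext_iff, Fin.forall_fin_succ]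

/-- The roots of `D₃`. -/
def rootFinset : Finset (Fin 3 → ℤ) :=
  {![1, 1, 0], ![1, -1, 0], ![-1, 1, 0], ![-1, -1, 0], ![1, 0, 1], ![1, 0, -1], ![-1, 0, 1],
    ![-1, 0, -1], ![0, 1, 1], ![0, 1, -1], ![0, -1, 1], ![0, -1, -1]}

theorem card_rootFinset : rootFinset.card = 12 := by
  unfold rootFinset
  simp [Finset.card_insert_of_notMem, funext_iff, Fin.forall_fin_succ]

theorem root_of_mem {r : Fin 3 → ℤ} (h : r ∈ rootFinset) : r 0 ^ 2 + r 1 ^ 2 + r 2 ^ 2 = 2 := by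
  unfold rootFinset at h
  simp only [Finset.mem_insert, Finset.mem_singleton] at h
  rcases h with rfl | rfl | rfl | rfl | rfl | rfl | rfl | rfl | rfl | rfl | rfl | rfl <;> rfl

end roots

/-! ### Rigid networks: weights of roots and vertices of degree two -/

namespace PeriodicNetwork

variable {Λ : Submodule ℤ (EuclideanSpace ℝ (Fin 3))} {V : Type*} [AddAction Λ V]
variable {N : PeriodicNetwork Λ V}
variable {O : EuclideanSpace ℝ (Fin 3) ≃ₗᵢ[ℝ] EuclideanSpace ℝ (Fin 3)}
variable {t : N.QDart → ℝ} {u : N.QDart → Fin 3 → ℤ}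

/-- The form of `root_indicator` is 4 on ±r and 0 on the other roots, and its trace is |r|² - (3 -
|r|²) = 1. Summed against the tight frame it gives the frame constant times 1, so the total weight
of ±r is a quarter of that constant, for every r. -/
theorem IsRigid.weight (h : N.IsRigid O t u) : ∃ κ : ℝ, 0 < κ ∧ ∀ r : Fin 3 → ℤ,
    r 0 ^ 2 + r 1 ^ 2 + r 2 ^ 2 = 2 →
      ∑ d with u d = r ∨ u d = -r, t d = κ := by
  obtain ⟨κ, hκ, hf⟩ := h.frame
  refine ⟨κ / 4, by linarith, fun r hr => ?_⟩
  have h1 : ∀ d, (if u d = r ∨ u d = -r then t d else 0) * 4 =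
      ∑ i : Fin 3, ∑ j : Fin 3, ((r i : ℝ) * r j - if i = j then 1 - (r i : ℝ) ^ 2 else 0) *
        (t d * (u d i * u d j)) := by
    intro d
    have h2 := root_indicator hr (h.u_root d)
    have h3 : (if u d = r ∨ u d = -r then t d else 0) * 4 =
        t d * ((if u d = r ∨ u d = -r then 4 else 0 : ℤ) : ℝ) := by
      split_ifs <;> push_cast <;> ring
    rw [h3, ← h2]
    simp [Fin.sum_univ_three]
    ring
  have h4 : (∑ d with u d = r ∨ u d = -r, t d) * 4 = κ := by
    rw [Finset.sum_filter, Finset.sum_mul, Finset.sum_congr rfl fun d _ => h1 d, Finset.sum_comm]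
    have h5 : ∀ i : Fin 3, ∑ d, ∑ j : Fin 3,
        ((r i : ℝ) * r j - if i = j then 1 - (r i : ℝ) ^ 2 else 0) * (t d * (u d i * u d j)) =
        (2 * (r i : ℝ) ^ 2 - 1) * κ := by
      intro i
      rw [Finset.sum_comm]
      simp only [← Finset.mul_sum, hf]
      rw [Finset.sum_eq_single i]
      · rw [if_pos rfl, if_pos rfl]; ring
      · intro j _ hj; simp [hj.symm]
      · simp
    rw [Finset.sum_congr rfl fun i _ => h5 i, Fin.sum_univ_three]
    have hr' : (r 0 : ℝ) ^ 2 + r 1 ^ 2 + r 2 ^ 2 = 2 := by exact_mod_cast hr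
    linear_combination 2 * κ * hr'
  linarith

theorem IsRigid.exists_root (h : N.IsRigid O t u) {r : Fin 3 → ℤ}
    (hr : r 0 ^ 2 + r 1 ^ 2 + r 2 ^ 2 = 2) : ∃ d, u d = r := by
  obtain ⟨κ, hκ, hw⟩ := h.weight
  have h1 : (Finset.univ.filter fun d => u d = r ∨ u d = -r).Nonempty := by
    by_contra hne
    rw [Finset.not_nonempty_iff_eq_empty] at hne
    have := hw r hr
    rw [hne, Finset.sum_empty] at this
    exact hκ.ne this
  obtain ⟨d, hd⟩ := h1
  rcases (Finset.mem_filter.1 hd).2 with e | e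
  · exact ⟨d, e⟩
  · exact ⟨rev d, by rw [h.u_rev, e, neg_neg]⟩

theorem IsRigid.u_ne_zero (h : N.IsRigid O t u) (d : N.QDart) : u d ≠ 0 := fun e => by
  have := h.u_root d
  simp [e] at this

/-- At a vertex of degree two the two incident edges are opposite. -/
theorem IsRigid.eq_neg_of_deg_two (h : N.IsRigid O t u) {q : N.QVertex}
    (hq : (Finset.univ.filter fun d : N.QDart => src d = q).card = 2) {d : N.QDart}
    (hd : src d = q) : ∃ d', d' ≠ d ∧ src d' = q ∧ u d' = - u d ∧
      ∀ e, src e = q → e = d ∨ e = d' := by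
  obtain ⟨a, b, hab, hf⟩ := Finset.card_eq_two.1 hq
  have hmem : ∀ e, src e = q ↔ e = a ∨ e = b := fun e => by
    have : e ∈ (Finset.univ.filter fun d : N.QDart => src d = q) ↔ e = a ∨ e = b := by
      rw [hf]; simp
    simpa using this
  have hs := h.u_sum q
  rw [hf, Finset.sum_pair hab] at hs
  rcases (hmem d).1 hd with rfl | rfl
  · exact ⟨b, hab.symm, (hmem b).2 (Or.inr rfl), eq_neg_of_add_eq_zero_right hs,
      fun e he => (hmem e).1 he⟩
  · exact ⟨a, hab, (hmem a).2 (Or.inl rfl), eq_neg_of_add_eq_zero_left hs,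
      fun e he => ((hmem e).1 he).symm⟩

/-- If all degrees were two, the root would be constant up to sign along the connected network, but
every root occurs. -/
theorem IsRigid.exists_deg_ne_two (h : N.IsRigid O t u) :
    ∃ x : V, (N.graph.neighborSet x).ncard ≠ 2 := by
  by_contra hcon
  push Not at hcon
  have hdeg : ∀ x : V, (Finset.univ.filter fun d : N.QDart => src d = N.mkV x).card = 2 :=
    fun x => by rw [← ncard_neighborSet, hcon]
  obtain ⟨d₀, hd₀⟩ := h.exists_root (r := ![1, 1, 0]) (by decide)
  obtain ⟨d₁, hd₁⟩ := h.exists_root (r := ![1, -1, 0]) (by decide)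
  have two : ∀ x d d', src d = N.mkV x → src d' = N.mkV x → u d' = u d ∨ u d' = - u d := by
    intro x d d' hd hd'
    obtain ⟨e, _, _, hu, he⟩ := h.eq_neg_of_deg_two (hdeg x) hd
    rcases he d' hd' with rfl | rfl
    · exact Or.inl rfl
    · exact Or.inr hu
  obtain ⟨x₀, hx₀⟩ := mkV_surjective (src d₀)
  obtain ⟨x₁, hx₁⟩ := mkV_surjective (src d₁)
  have hall := N.eq_univ_of_closed (x := x₀)
    (A := {v | ∀ d, src d = N.mkV v → u d = u d₀ ∨ u d = - u d₀})
    (fun d hd => two x₀ d₀ d hx₀.symm hd) (by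
      intro a b ha hab d hd
      have h1 := ha (mkDart hab) rfl
      have h2 := two b (rev (mkDart hab)) d rfl hd
      rw [h.u_rev] at h2
      rcases h1 with h1 | h1 <;> rcases h2 with h2 | h2 <;> rw [h2, h1] <;> simp) x₁
  have := hall d₁ hx₁.symm
  rw [hd₀, hd₁] at this
  simp [funext_iff, Fin.forall_fin_succ] at this

/-- The two roots at the vertex are opposite, so it lies between its neighbours, dividing their
segment in the ratio of the two coefficients t. -/
theorem IsRigid.straight (h : N.IsRigid O t u) {x : V}
    (hx : (N.graph.neighborSet x).ncard = 2) : ∃ a b : V, N.graph.neighborSet x = {a, b} ∧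
      N.pos x ∈ openSegment ℝ (N.pos a) (N.pos b) := by
  obtain ⟨a, b, hab, hn⟩ := Set.ncard_eq_two.1 hx
  have ha : N.graph.Adj x a := by rw [← SimpleGraph.mem_neighborSet, hn]; simp
  have hb : N.graph.Adj x b := by rw [← SimpleGraph.mem_neighborSet, hn]; simp
  refine ⟨a, b, hn, ?_⟩
  obtain ⟨d', hne, _, hu, he⟩ := h.eq_neg_of_deg_two (q := N.mkV x)
    (by rw [← ncard_neighborSet, hx]) (d := mkDart ha) rfl
  have h1 : mkDart hb = d' :=
    (he (mkDart hb) rfl).resolve_left fun e => hab (mkDart_injective e).symm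
  subst h1
  have e1 := h.vec_eq (mkDart ha)
  have e2 := h.vec_eq (mkDart hb)
  have hOE : O (toE (-u (mkDart ha))) = - O (toE (u (mkDart ha))) := by
    rw [← map_neg]; congr 1; ext j; simp
  rw [hu, hOE, vec_mkDart, sub_eq_iff_eq_add] at e2
  rw [vec_mkDart, sub_eq_iff_eq_add] at e1
  set s := t (mkDart ha)
  set s' := t (mkDart hb)
  have hs : 0 < s := h.t_pos _
  have hs' : 0 < s' := h.t_pos _
  refine ⟨s' / (s + s'), s / (s + s'), by positivity, by positivity, by field_simp; ring, ?_⟩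
  rw [e1, e2]
  have h3 : s' / (s + s') + s / (s + s') = 1 := by field_simp; ring
  have h4 : s' / (s + s') * s = s / (s + s') * s' := by ring
  simp only [smul_add, smul_neg, smul_smul, h4]
  have : N.pos x = (s' / (s + s') + s / (s + s')) • N.pos x := by rw [h3, one_smul]
  conv_rhs => rw [this, add_smul]
  abel

/-- The action of the lattice on a disjoint union of copies of itself. -/
@[reducible] def copiesAction (Λ : Submodule ℤ (EuclideanSpace ℝ (Fin 3))) (k : ℕ) :
    AddAction Λ (Fin k × Λ) where
  vadd g x := (x.1, g + x.2)
  zero_vadd x := by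
    change (x.1, 0 + x.2) = x
    rw [zero_add]
  add_vadd g g' x := by
    change (x.1, g + g' + x.2) = (x.1, g + (g' + x.2))
    rw [add_assoc]

/-- Branch vertices are those of degree different from two. They form finitely many free orbits, so
copies of Λ parametrize them by a set in `Type`, whatever the universe of V. -/
theorem IsRigid.exists_branchMap (h : N.IsRigid O t u) :
    ∃ (W : Type) (_ : AddAction Λ W) (ι : W → V), IsBranchMap N ι ∧
      ∀ w, (N.graph.neighborSet (ι w)).ncard ≠ 2 := by
  have := N.finite_vertices
  let Q := {q : N.QVertex // ∃ x, N.mkV x = q ∧ (N.graph.neighborSet x).ncard ≠ 2}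
  obtain ⟨k, ⟨e⟩⟩ := Finite.exists_equiv_fin Q
  have hrep : ∀ i : Fin k, ∃ x, N.mkV x = (e.symm i : N.QVertex) ∧
      (N.graph.neighborSet x).ncard ≠ 2 := fun i => (e.symm i).2
  choose r hr hr2 using hrep
  have hinv : ∀ x y, N.mkV x = N.mkV y →
      (N.graph.neighborSet x).ncard = (N.graph.neighborSet y).ncard := fun x y hxy => by
    rw [ncard_neighborSet, ncard_neighborSet, hxy]
  let _ := copiesAction Λ k
  let ι : Fin k × Λ → V := fun p => p.2 +ᵥ r p.1
  have hι : ∀ w, (N.graph.neighborSet (ι w)).ncard ≠ 2 := fun w => by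
    rw [hinv (ι w) (r w.1) (mkV_vadd _ _)]; exact hr2 w.1
  have hmem : ∀ v, v ∉ Set.range ι → (N.graph.neighborSet v).ncard = 2 := by
    intro v hv
    by_contra hne
    refine hv ?_
    have h1 := hr (e ⟨N.mkV v, v, rfl, hne⟩)
    rw [e.symm_apply_apply] at h1
    obtain ⟨g, hg⟩ := mkV_eq_iff.1 h1
    exact ⟨(_, g), hg⟩
  refine ⟨Fin k × Λ, inferInstance, ι, ⟨?_, ?_, ?_, fun v hv => h.straight (hmem v hv)⟩, hι⟩
  · obtain ⟨x, hx⟩ := h.exists_deg_ne_two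
    by_contra hne
    exact hx (hmem x fun ⟨w, _⟩ => hne ⟨w⟩)
  · rintro ⟨i, g⟩ ⟨j, g'⟩ hij
    have h1 : N.mkV (r i) = N.mkV (r j) := by
      have := congrArg N.mkV hij
      simpa [ι] using this
    rw [hr, hr] at h1
    have h2 : i = j := e.symm.injective (Subtype.ext h1)
    subst h2
    have h3 : g = g' := N.vadd_left_cancel_of_eq (x := r i) hij
    rw [h3]
  · rintro g ⟨i, g'⟩
    exact add_vadd g g' (r i)

/-- Taking the first edge of each string is a bijection, so branch vertices keep their degree. -/
theorem ncard_smooth {W : Type*} [AddAction Λ W] {ι : W → V} (h : IsBranchMap N ι) (w : W) :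
    ((smooth h).graph.neighborSet w).ncard = (N.graph.neighborSet (ι w)).ncard := by
  have key : ∀ w' ∈ (smooth h).graph.neighborSet w, ∃ y,
      N.IsString (Set.range ι) (ι w) y (ι w') := fun w' hw' => hw'
  choose f hf using key
  refine Set.ncard_congr f (fun w' hw' => (hf w' hw').adj) (fun w₁ w₂ h₁ h₂ e => ?_) fun y hy => ?_
  · have a1 := hf w₁ h₁
    rw [e] at a1
    exact h.injective (h.isString_unique a1 (hf w₂ h₂))
  · obtain ⟨z, hz⟩ := h.exists_isString hy
    obtain ⟨w', rfl⟩ := hz.mem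
    exact ⟨w', ⟨y, hz⟩, h.isString_unique_start (hf w' _) hz⟩

end PeriodicNetwork

/-! ### Rigid networks without vertices of degree two are srs -/

namespace PeriodicNetwork

variable {Λ : Submodule ℤ (EuclideanSpace ℝ (Fin 3))} {V : Type*} [AddAction Λ V]
variable {N : PeriodicNetwork Λ V}
variable {O : EuclideanSpace ℝ (Fin 3) ≃ₗᵢ[ℝ] EuclideanSpace ℝ (Fin 3)}
variable {t : N.QDart → ℝ} {u : N.QDart → Fin 3 → ℤ}

theorem endpoints_edge (d : N.QDart) : N.endpoints (edge d) = s(src d, tgt d) := by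
  induction d using QDart.ind with
  | _ x y h => rfl

/-- Degree 0 contradicts connectedness, and degree 1 is impossible because nonzero roots sum to zero
at each vertex. So all degrees are at least 3, and this count meets the Betti number bound and the
twelve roots with no slack. -/
theorem IsRigid.card_eq (h : N.IsRigid O t u)
    (h2 : ∀ x, (N.graph.neighborSet x).ncard ≠ 2) :
    Nat.card N.QVertex = 4 ∧ Fintype.card N.QDart = 12 ∧ Function.Injective u ∧
      ∀ q, (Finset.univ.filter fun d : N.QDart => src d = q).card = 3 := by
  have := N.finite_vertices
  have := Fintype.ofFinite N.QVertex
  have hdeg : ∀ q, 3 ≤ (Finset.univ.filter fun d : N.QDart => src d = q).card := by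
    intro q
    obtain ⟨x, rfl⟩ := mkV_surjective q
    have hne2 := h2 x
    rw [ncard_neighborSet] at hne2
    have hne0 : (Finset.univ.filter fun d : N.QDart => src d = N.mkV x).card ≠ 0 := by
      intro h0
      rw [Finset.card_eq_zero] at h0
      have hx : ∀ y, ¬ N.graph.Adj x y := fun y hy => by
        have : mkDart hy ∈ (Finset.univ.filter fun d : N.QDart => src d = N.mkV x) := by simp
        rw [h0] at this
        simp at this
      obtain ⟨d, _⟩ := h.exists_root (r := ![1, 1, 0]) (by decide)
      induction d using QDart.ind with
      | _ a b hab =>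
        have := N.eq_univ_of_closed (A := {x}) (x := x) rfl
          (fun a b ha hab => by rw [Set.mem_singleton_iff.1 ha] at hab; exact absurd hab (hx b)) a
        rw [Set.mem_singleton_iff.1 this] at hab
        exact hx _ hab
    have hne1 : (Finset.univ.filter fun d : N.QDart => src d = N.mkV x).card ≠ 1 := by
      intro h1
      obtain ⟨d, hd⟩ := Finset.card_eq_one.1 h1
      have := h.u_sum (N.mkV x)
      rw [hd, Finset.sum_singleton] at this
      exact h.u_ne_zero d this
    omega
  have hsum : Fintype.card N.QDart =
      ∑ q, (Finset.univ.filter fun d : N.QDart => src d = q).card :=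
    Finset.card_eq_sum_card_fiberwise (f := src) (s := Finset.univ) (t := Finset.univ) (by simp)
  have hsub : rootFinset ⊆ Finset.univ.image u := fun r hr => by
    obtain ⟨d, rfl⟩ := h.exists_root (root_of_mem hr)
    exact Finset.mem_image_of_mem u (Finset.mem_univ d)
  have h12 := Finset.card_le_card hsub
  rw [card_rootFinset] at h12
  have himg : (Finset.univ.image u).card ≤ Fintype.card N.QDart := Finset.card_image_le
  have hle := h.card_le
  have h3 : 3 * Fintype.card N.QVertex ≤ Fintype.card N.QDart := by
    rw [hsum]
    have := Finset.sum_le_sum fun q (_ : q ∈ (Finset.univ : Finset N.QVertex)) => hdeg q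
    simpa [mul_comm] using this
  rw [Nat.card_eq_fintype_card] at hle ⊢
  -- With v vertices and D darts, 3v ≤ D ≤ 2v + 4 gives v ≤ 4, and 12 ≤ D gives v ≥ 4.
  have hQ : Fintype.card N.QVertex = 4 := by omega
  have hD : Fintype.card N.QDart = 12 := by omega
  refine ⟨hQ, hD, ?_, ?_⟩
  · have : (Finset.univ.image u).card = (Finset.univ : Finset N.QDart).card := by
      rw [Finset.card_univ]; omega
    rw [← Set.injOn_univ, ← Finset.coe_univ]
    exact Finset.injOn_of_card_image_eq this
  · have h4 : ∑ q : N.QVertex, 3 = ∑ q, (Finset.univ.filter fun d : N.QDart => src d = q).card := by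
      rw [← hsum, hD]; simp [hQ]
    intro q
    exact ((Finset.sum_eq_sum_iff_of_le fun q _ => hdeg q).1 h4 q (Finset.mem_univ q)).symm

/-- The third dart at a vertex of degree three. -/
theorem IsRigid.exists_third (h : N.IsRigid O t u) {q : N.QVertex}
    (hq : (Finset.univ.filter fun d : N.QDart => src d = q).card = 3) {d d' : N.QDart}
    (hd : src d = q) (hd' : src d' = q) (hne : d ≠ d') :
    ∃ e, src e = q ∧ u d + u d' + u e = 0 ∧ ∀ f, src f = q → f = d ∨ f = d' ∨ f = e := by
  have h1 : ({d, d'} : Finset N.QDart) ⊆ Finset.univ.filter fun d : N.QDart => src d = q := by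
    intro e he
    simp only [Finset.mem_insert, Finset.mem_singleton] at he
    rcases he with rfl | rfl <;> simp [hd, hd']
  have hc : ((Finset.univ.filter fun d : N.QDart => src d = q) \ {d, d'}).card = 1 := by
    rw [Finset.card_sdiff_of_subset h1, hq, Finset.card_pair hne]
  obtain ⟨e, he⟩ := Finset.card_eq_one.1 hc
  have hmem : ∀ f, src f = q → f = d ∨ f = d' ∨ f = e := by
    intro f hf
    by_contra hcon
    push Not at hcon
    have : f ∈ (Finset.univ.filter fun d : N.QDart => src d = q) \ {d, d'} := by
      simp [hf, hcon.1, hcon.2.1]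
    rw [he, Finset.mem_singleton] at this
    exact hcon.2.2 this
  have hesrc : src e = q := by
    have : e ∈ (Finset.univ.filter fun d : N.QDart => src d = q) \ {d, d'} := by rw [he]; simp
    simpa using (Finset.mem_sdiff.1 this).1
  refine ⟨e, hesrc, ?_, hmem⟩
  have hs := h.u_sum q
  rwa [← Finset.sum_sdiff h1, he, Finset.sum_singleton, Finset.sum_pair hne, add_comm] at hs

/-- Each root belongs to exactly one dart. So the equal weights of the pairs ±r become equal edge
lengths, and the relation between the three roots at a vertex controls the incidences. -/
theorem IsRigid.isSrs (h : N.IsRigid O t u)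
    (h2 : ∀ x, (N.graph.neighborSet x).ncard ≠ 2) : N.IsSrs := by
  obtain ⟨hQ, hD, hinj, hdeg⟩ := h.card_eq h2
  have hs0 : (0 : ℝ) < √2 := by positivity
  have hnorm : ∀ d, ‖O (toE (u d))‖ = √2 := fun d => by
    rw [O.norm_map, ← Real.sqrt_sq (norm_nonneg (toE (u d))), norm_toE_sq, h.u_root]
    norm_num
  have hvnorm : ∀ d, ‖vec d‖ = t d * √2 := fun d => by
    rw [h.vec_eq, norm_smul, hnorm, Real.norm_of_nonneg (h.t_pos d).le]
  have htrev : ∀ d, t (rev d) = t d := fun d => by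
    have h1 := hvnorm (rev d)
    rw [vec_rev, norm_neg, hvnorm] at h1
    exact (mul_right_cancel₀ hs0.ne' h1).symm
  obtain ⟨κ, hκ, hw⟩ := h.weight
  have ht : ∀ d, t d = κ / 2 := by
    intro d
    have h1 := hw (u d) (h.u_root d)
    have h3 : (Finset.univ.filter fun e => u e = u d ∨ u e = - u d) = {d, rev d} := by
      ext e
      simp only [Finset.mem_filter, Finset.mem_univ, true_and, Finset.mem_insert,
        Finset.mem_singleton]
      rw [← h.u_rev, hinj.eq_iff, hinj.eq_iff]
    rw [h3, Finset.sum_pair (rev_ne d).symm, htrev] at h1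
    linarith
  -- A loop contributes opposite roots at its vertex, so the third root there would be zero.
  have hloop : ∀ d : N.QDart, src d ≠ tgt d := by
    intro d hd
    obtain ⟨e, _, he, _⟩ := h.exists_third (hdeg (src d)) (d := d) (d' := rev d) rfl
      (by rw [src_rev, hd]) (rev_ne d).symm
    rw [h.u_rev, add_neg_cancel, zero_add] at he
    exact h.u_ne_zero e he
  have hpar : ∀ d d' : N.QDart, src d = src d' → tgt d = tgt d' → d = d' := by
    intro d d' hsrc htgt
    by_contra hne
    obtain ⟨e, he, hue, hall⟩ := h.exists_third (hdeg (src d)) (d := d) (d' := d') rfl hsrc.symm hne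
    obtain ⟨e', he', hue', hall'⟩ := h.exists_third (hdeg (tgt d)) (d := rev d) (d' := rev d')
      (src_rev d) (by rw [src_rev, htgt]) (fun e => hne (rev_involutive.injective e))
    -- For a double edge, the third roots at its two ends are opposite. As u is injective, the two
    -- third darts belong to one edge.
    have hee : e' = rev e := hinj (by
      rw [h.u_rev, h.u_rev] at hue'
      rw [h.u_rev]
      have a1 : u e' = u d + u d' := by
        have : u e' = (-u d + -u d' + u e') + (u d + u d') := by abel
        rw [this, hue', zero_add]
      have a2 : u e = -(u d + u d') := by
        have : u e = (u d + u d' + u e) - (u d + u d') := by abel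
        rw [this, hue, zero_sub]
      rw [a1, a2, neg_neg])
    have htge : tgt e = tgt d := by rw [← src_rev, ← hee, he']
    obtain ⟨x, hx⟩ := mkV_surjective (src d)
    -- All edges at either end then lead to the other end, so the connected quotient would have at
    -- most two vertices instead of four.
    have hcl := N.eq_univ_of_closed (A := {v | N.mkV v = src d ∨ N.mkV v = tgt d}) (x := x)
      (Or.inl hx) (by
        rintro a b ha hab
        have hab1 : tgt (mkDart hab) = N.mkV b := rfl
        rcases ha with ha | ha
        · right
          rw [← hab1]
          rcases hall (mkDart hab) ha with e1 | e1 | e1 <;> rw [e1]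
          · exact htgt.symm
          · exact htge
        · left
          rw [← hab1]
          rcases hall' (mkDart hab) ha with e1 | e1 | e1 <;> rw [e1]
          · exact tgt_rev d
          · rw [tgt_rev, hsrc]
          · rw [hee, tgt_rev, he])
    have := N.finite_vertices
    have := Fintype.ofFinite N.QVertex
    have hle : Fintype.card N.QVertex ≤ ({src d, tgt d} : Finset N.QVertex).card := by
      rw [← Finset.card_univ]
      refine Finset.card_le_card fun q _ => ?_
      obtain ⟨v, rfl⟩ := mkV_surjective q
      simpa using hcl v
    rw [Nat.card_eq_fintype_card] at hQ
    have := Finset.card_le_two (a := src d) (b := tgt d)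
    omega
  have hendinj : Function.Injective N.endpoints := by
    intro E E' he
    obtain ⟨d, rfl⟩ := edge_surjective E
    obtain ⟨d', rfl⟩ := edge_surjective E'
    rw [endpoints_edge, endpoints_edge, Sym2.eq_iff] at he
    rcases he with ⟨h1, h3⟩ | ⟨h1, h3⟩
    · rw [hpar d d' h1 h3]
    · rw [hpar d (rev d') (by rw [h1, src_rev]) (by rw [h3, tgt_rev]), edge_rev]
  refine ⟨fun x => ⟨?_, ?_⟩, ⟨hQ, hendinj, ?_⟩, ⟨κ / 2 * √2, fun x y hxy => ?_⟩, h.bcc⟩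
  · rw [ncard_neighborSet, hdeg]
  · rw [finsum_neighborSet x (fun d => -((√2)⁻¹ • O (toE (u d)))) _ fun y hxy => ?_]
    · have h1 : ∑ d with src d = N.mkV x, O (toE (u d)) = 0 := by
        rw [← map_sum]
        have : ∑ d with src d = N.mkV x, toE (u d) = 0 := by
          ext j
          have h3 := congrFun (h.u_sum (N.mkV x)) j
          rw [Finset.sum_apply] at h3
          simp only [WithLp.ofLp_sum, Finset.sum_apply, toE_apply, PiLp.zero_apply]
          rw [Pi.zero_apply] at h3
          exact_mod_cast h3
        rw [this, map_zero]
      rw [Finset.sum_neg_distrib, ← Finset.smul_sum, h1, smul_zero, neg_zero]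
    · have h1 : N.pos x - N.pos y = - vec (mkDart hxy) := by rw [vec_mkDart]; abel
      rw [h1, norm_neg, hvnorm, h.vec_eq, smul_neg, smul_smul]
      congr 2
      have := (h.t_pos (mkDart hxy)).ne'
      field_simp
  · have := N.finite_vertices
    have := N.finite_edges
    have := Fintype.ofFinite N.QVertex
    have := Fintype.ofFinite N.QEdge
    have hnd : ∀ E : N.QEdge, ¬ (N.endpoints E).IsDiag := fun E => by
      obtain ⟨d, rfl⟩ := edge_surjective E
      rw [endpoints_edge, Sym2.mk_isDiag_iff]
      exact hloop d
    let F : N.QEdge → {s : Sym2 N.QVertex // ¬ s.IsDiag} := fun E => ⟨N.endpoints E, hnd E⟩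
    have hFinj : Function.Injective F := fun E E' e => hendinj (congrArg Subtype.val e)
    have hcard := N.card_QDart_le_two_mul
    rw [Nat.card_eq_fintype_card] at hcard hQ
    have hcard2 : Fintype.card {s : Sym2 N.QVertex // ¬ s.IsDiag} = 6 := by
      rw [Sym2.card_subtype_not_diag, hQ]; rfl
    have hFsurj : Function.Surjective F := by
      -- Twelve darts need at least six edges, and K₄ has just six pairs of vertices.
      have h1 := Fintype.card_le_of_injective F hFinj
      exact ((Fintype.bijective_iff_injective_and_card F).2 ⟨hFinj, by omega⟩).2
    ext s
    constructor
    · rintro ⟨E, rfl⟩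
      exact hnd E
    · intro hs
      obtain ⟨E, hE⟩ := hFsurj ⟨s, hs⟩
      exact ⟨E, congrArg Subtype.val hE⟩
  · rw [dist_comm, dist_eq_norm, ← vec_mkDart hxy, hvnorm, ht]

/-- A network attaining the bound is a subdivision of an srs network. -/
theorem exists_srs_of_eq (N : PeriodicNetwork Λ V) [DiscreteTopology Λ] [IsZLattice ℝ Λ]
    (h : N.length ^ 3 / ZLattice.covolume Λ = 27 / √2) :
    ∃ (W : Type) (_ : AddAction Λ W) (M : PeriodicNetwork Λ W), M.IsSrs ∧ N.IsSubdivisionOf M := by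
  obtain ⟨O, t, u, hr⟩ := N.length_estimate.2 h
  obtain ⟨W, _, ι, hb, hdeg⟩ := hr.exists_branchMap
  refine ⟨W, inferInstance, smooth hb, ?_, isSubdivisionOf_smooth hb⟩
  -- The smoothed network has the same lattice and length, so it attains the bound as well and is
  -- rigid on its own account.
  obtain ⟨O', t', u', hr'⟩ := (smooth hb).length_estimate.2 (by rw [length_smooth, h])
  exact hr'.isSrs fun w => by rw [ncard_smooth]; exact hdeg w

end PeriodicNetwork

/-! ### Uniqueness of srs networks up to similarity -/

namespace PeriodicNetwork

variable {Λ : Submodule ℤ (EuclideanSpace ℝ (Fin 3))} {V : Type*} [AddAction Λ V]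
variable {N : PeriodicNetwork Λ V}

/-- A labelling of the vertices by the vertices of `K₄`, identifying the quotient with `K₄`, such
that the edge vectors are given by the labels of the end points. -/
structure IsK4Labelling (N : PeriodicNetwork Λ V) (lab : V → Fin 4)
    (E : Fin 4 → Fin 4 → EuclideanSpace ℝ (Fin 3)) : Prop where
  lab_eq_iff : ∀ x y, lab x = lab y ↔ ∃ g : Λ, g +ᵥ x = y
  surjective : Function.Surjective lab
  lab_ne : ∀ x y, N.graph.Adj x y → lab x ≠ lab y
  pos_sub : ∀ x y, N.graph.Adj x y → N.pos y - N.pos x = E (lab x) (lab y)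
  exists_adj : ∀ x j, j ≠ lab x → ∃ y, N.graph.Adj x y ∧ lab y = j

section labelling

variable {lab : V → Fin 4} {E : Fin 4 → Fin 4 → EuclideanSpace ℝ (Fin 3)}

theorem IsK4Labelling.ext_pos (h : IsK4Labelling N lab E) {x y : V} (hl : lab x = lab y)
    (hp : N.pos x = N.pos y) : x = y := by
  obtain ⟨g, rfl⟩ := (h.lab_eq_iff x y).1 hl
  rw [N.pos_vadd] at hp
  have : g = 0 := Subtype.ext (by simpa using hp.symm)
  rw [this, zero_vadd]

theorem IsK4Labelling.eq_of_adj (h : IsK4Labelling N lab E) {x y y' : V} (hy : N.graph.Adj x y)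
    (hy' : N.graph.Adj x y') (hl : lab y = lab y') : y = y' := by
  refine h.ext_pos hl ?_
  have h1 := h.pos_sub x y hy
  have h2 := h.pos_sub x y' hy'
  rw [← hl, ← h1] at h2
  exact (sub_left_inj.1 h2).symm

theorem IsK4Labelling.bijOn (h : IsK4Labelling N lab E) (x : V) :
    Set.BijOn lab (N.graph.neighborSet x) ((Finset.univ.erase (lab x) : Finset (Fin 4)) : Set (Fin 4)) := by
  refine ⟨fun y hy => by simpa using (h.lab_ne x y hy).symm, fun y hy y' hy' e =>
    h.eq_of_adj hy hy' e, fun j hj => ?_⟩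
  obtain ⟨y, hy, rfl⟩ := h.exists_adj x j (by simpa using hj)
  exact ⟨y, hy, rfl⟩

theorem IsK4Labelling.ncard (h : IsK4Labelling N lab E) (x : V) :
    (N.graph.neighborSet x).ncard = 3 := by
  rw [Set.ncard_congr (fun y _ => lab y) (t := ((Finset.univ.erase (lab x) : Finset (Fin 4)) : Set _))
    (fun y hy => (h.bijOn x).mapsTo hy) (fun y y' hy hy' e => (h.bijOn x).injOn hy hy' e)
    (fun j hj => by simpa using (h.bijOn x).surjOn hj), Set.ncard_coe_finset]
  simp

theorem IsK4Labelling.finsum (h : IsK4Labelling N lab E) (x : V) {l : ℝ}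
    (hl : ∀ i j, i ≠ j → ‖E i j‖ = l) :
    ∑ᶠ y ∈ N.graph.neighborSet x, (‖N.pos x - N.pos y‖)⁻¹ • (N.pos x - N.pos y) =
      - (l⁻¹ • ∑ j ∈ Finset.univ.erase (lab x), E (lab x) j) := by
  rw [finsum_mem_eq_of_bijOn lab (h.bijOn x) (g := fun j => - (l⁻¹ • E (lab x) j)),
    finsum_mem_coe_finset, Finset.sum_neg_distrib, Finset.smul_sum]
  intro y hy
  have h1 : N.pos x - N.pos y = - E (lab x) (lab y) := by rw [← h.pos_sub x y hy]; abel
  rw [h1, norm_neg, hl _ _ (h.lab_ne x y hy), smul_neg]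

theorem IsK4Labelling.quotientIsK4 (h : IsK4Labelling N lab E) : N.QuotientIsK4 := by
  have hl : ∀ x y, N.mkV x = N.mkV y ↔ lab x = lab y := fun x y => by
    rw [mkV_eq_iff, h.lab_eq_iff]
  refine ⟨?_, ?_, ?_⟩
  · let f : N.QVertex → Fin 4 := fun q => lab (Function.surjInv mkV_surjective q)
    have hf : ∀ x, f (N.mkV x) = lab x := fun x =>
      (hl _ _).1 (Function.surjInv_eq mkV_surjective _)
    have : Function.Bijective f := by
      constructor
      · intro q q' e
        obtain ⟨x, rfl⟩ := mkV_surjective q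
        obtain ⟨y, rfl⟩ := mkV_surjective q'
        rw [hf, hf] at e
        exact (hl x y).2 e
      · intro i
        obtain ⟨x, rfl⟩ := h.surjective i
        exact ⟨_, hf x⟩
    rw [Nat.card_congr (Equiv.ofBijective f this)]
    simp
  · have key : ∀ d d' : N.QDart, src d = src d' → tgt d = tgt d' → d = d' := by
      intro d d' h1 h2
      induction d using QDart.ind with
      | _ x y hxy =>
        obtain ⟨y', hxy', rfl⟩ := exists_dart_of_src (x := x) h1.symm
        have h3 : N.mkV y = N.mkV y' := h2
        have := h.eq_of_adj hxy hxy' ((hl _ _).1 h3)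
        subst this
        rfl
    intro e e' he
    obtain ⟨d, rfl⟩ := edge_surjective e
    obtain ⟨d', rfl⟩ := edge_surjective e'
    rw [endpoints_edge, endpoints_edge, Sym2.eq_iff] at he
    rcases he with ⟨h1, h2⟩ | ⟨h1, h2⟩
    · rw [key d d' h1 h2]
    · rw [key d (rev d') (by rw [h1, src_rev]) (by rw [h2, tgt_rev]), edge_rev]
  · ext s
    constructor
    · rintro ⟨e, rfl⟩
      obtain ⟨d, rfl⟩ := edge_surjective e
      induction d using QDart.ind with
      | _ x y hxy =>
        intro hd
        rw [endpoints_edge, Sym2.mk_isDiag_iff] at hd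
        exact h.lab_ne x y hxy ((hl x y).1 hd)
    · induction s using Sym2.ind with
      | _ q q' =>
        intro hs
        obtain ⟨x, rfl⟩ := mkV_surjective q
        obtain ⟨y, rfl⟩ := mkV_surjective q'
        have hne : lab y ≠ lab x := fun e => hs (by
          rw [Sym2.mk_isDiag_iff]; exact (hl x y).2 e.symm)
        obtain ⟨y', hxy, hy'⟩ := h.exists_adj x (lab y) hne
        refine ⟨edge (mkDart hxy), ?_⟩
        rw [endpoints_edge, src_mkDart, tgt_mkDart, (hl y' y).2 hy']

end labelling

section similar

variable {Λ' : Submodule ℤ (EuclideanSpace ℝ (Fin 3))} {V' : Type*} [AddAction Λ' V']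
variable {N' : PeriodicNetwork Λ' V'}
variable {lab : V → Fin 4} {E : Fin 4 → Fin 4 → EuclideanSpace ℝ (Fin 3)}
variable {lab' : V' → Fin 4} {E' : Fin 4 → Fin 4 → EuclideanSpace ℝ (Fin 3)}

/-- Labelled networks with similar edge vectors are similar. -/
theorem IsK4Labelling.similar (h : IsK4Labelling N lab E) (h' : IsK4Labelling N' lab' E') {c : ℝ}
    (hc : 0 < c) (A : EuclideanSpace ℝ (Fin 3) ≃ₗᵢ[ℝ] EuclideanSpace ℝ (Fin 3))
    (hE : ∀ i j, i ≠ j → E' i j = c • A (E i j)) :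
    N.IsSimilarTo N' ∧
      (Λ' : Set (EuclideanSpace ℝ (Fin 3))) = (fun x => c • A x) '' (Λ : Set _) := by
  obtain ⟨x₀⟩ := N.connected.nonempty
  obtain ⟨x₀', hx₀⟩ := h'.surjective (lab x₀)
  set b : EuclideanSpace ℝ (Fin 3) := N'.pos x₀' - c • A (N.pos x₀) with hb
  -- Vertices correspond when they have the same label and similar positions. A label and a position
  -- determine a vertex, and the relation propagates along edges, so by connectedness it is the
  -- graph of a bijection.
  let Rel : V → V' → Prop := fun x x' => lab' x' = lab x ∧ N'.pos x' = c • A (N.pos x) + b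
  have rel₀ : Rel x₀ x₀' := ⟨hx₀, by rw [hb]; abel⟩
  have uniqR : ∀ {x x' x''}, Rel x x' → Rel x x'' → x' = x'' := fun h1 h2 =>
    h'.ext_pos (h1.1.trans h2.1.symm) (h1.2.trans h2.2.symm)
  have uniqL : ∀ {x y x'}, Rel x x' → Rel y x' → x = y := by
    intro x y x' h1 h2
    refine h.ext_pos (h1.1.symm.trans h2.1) ?_
    have := add_right_cancel (h1.2.symm.trans h2.2)
    exact A.injective (smul_right_injective _ hc.ne' this)
  have stepR : ∀ {x y x'}, Rel x x' → N.graph.Adj x y → ∃ y', N'.graph.Adj x' y' ∧ Rel y y' := by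
    intro x y x' hr hxy
    have hne := h.lab_ne x y hxy
    obtain ⟨y', hy', hl⟩ := h'.exists_adj x' (lab y) (by rw [hr.1]; exact hne.symm)
    refine ⟨y', hy', hl, ?_⟩
    have h1 := h'.pos_sub x' y' hy'
    rw [hl, hr.1, hE _ _ hne, ← h.pos_sub x y hxy, hr.2, sub_eq_iff_eq_add] at h1
    rw [h1, map_sub, smul_sub]
    abel
  have stepL : ∀ {x x' y'}, Rel x x' → N'.graph.Adj x' y' → ∃ y, N.graph.Adj x y ∧ Rel y y' := by
    intro x x' y' hr hxy
    have hne := h'.lab_ne x' y' hxy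
    obtain ⟨y, hy, hl⟩ := h.exists_adj x (lab' y') (by rw [← hr.1]; exact hne.symm)
    refine ⟨y, hy, hl.symm, ?_⟩
    have h1 := h'.pos_sub x' y' hxy
    rw [hr.1, ← hl, hE _ _ (h.lab_ne x y hy), ← h.pos_sub x y hy, hr.2, sub_eq_iff_eq_add] at h1
    rw [h1, map_sub, smul_sub]
    abel
  have exR : ∀ x, ∃ x', Rel x x' := N.eq_univ_of_closed (A := {x | ∃ x', Rel x x'}) ⟨x₀', rel₀⟩
    fun a b ⟨a', ha⟩ hab => (stepR ha hab).imp fun _ h => h.2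
  have exL : ∀ x', ∃ x, Rel x x' := N'.eq_univ_of_closed (A := {x' | ∃ x, Rel x x'}) ⟨x₀, rel₀⟩
    fun a b ⟨a', ha⟩ hab => (stepL ha hab).imp fun _ h => h.2
  choose f hf using exR
  have hbij : Function.Bijective f := by
    refine ⟨fun x y e => uniqL (hf x) (e ▸ hf y), fun x' => ?_⟩
    obtain ⟨x, hx⟩ := exL x'
    exact ⟨x, uniqR (hf x) hx⟩
  let ψ : N.graph ≃g N'.graph :=
    { toEquiv := Equiv.ofBijective f hbij
      map_rel_iff' := by
        intro x y
        change N'.graph.Adj (f x) (f y) ↔ N.graph.Adj x y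
        constructor
        · intro hxy
          obtain ⟨z, hz, hr⟩ := stepL (hf x) hxy
          rwa [uniqL (hf y) hr]
        · intro hxy
          obtain ⟨z, hz, hr⟩ := stepR (hf x) hxy
          rwa [uniqR (hf y) hr] }
  -- Lattice vectors are the differences of positions of vertices with equal labels, which the
  -- correspondence preserves up to the similarity.
  have hlat : (Λ' : Set (EuclideanSpace ℝ (Fin 3))) = (fun x => c • A x) '' (Λ : Set _) := by
    ext w
    constructor
    · intro hw
      obtain ⟨y, hy⟩ := exL ((⟨w, hw⟩ : Λ') +ᵥ x₀')
      have h1 : lab' ((⟨w, hw⟩ : Λ') +ᵥ x₀') = lab' x₀' := ((h'.lab_eq_iff _ _).2 ⟨_, rfl⟩).symm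
      obtain ⟨g, rfl⟩ := (h.lab_eq_iff x₀ y).1 (by rw [← hy.1, h1, hx₀])
      refine ⟨g, g.2, ?_⟩
      have h2 := hy.2
      rw [N'.pos_vadd, N.pos_vadd, rel₀.2, map_add, smul_add] at h2
      have h3 : w = (c • A (N.pos x₀) + b + w) - (c • A (N.pos x₀) + b) := by abel
      rw [h3]
      erw [h2]
      simp only
      abel
    · rintro ⟨g, hg, rfl⟩
      have h1 := hf ((⟨g, hg⟩ : Λ) +ᵥ x₀)
      have h2 : lab ((⟨g, hg⟩ : Λ) +ᵥ x₀) = lab x₀ := ((h.lab_eq_iff _ _).2 ⟨_, rfl⟩).symm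
      obtain ⟨w, hw⟩ := (h'.lab_eq_iff x₀' (f ((⟨g, hg⟩ : Λ) +ᵥ x₀))).1 (by rw [h1.1, h2, hx₀])
      have h3 := h1.2
      rw [← hw, N'.pos_vadd, N.pos_vadd, rel₀.2, map_add, smul_add] at h3
      have h4 : (w : EuclideanSpace ℝ (Fin 3)) = c • A g := by
        have h5 : (w : EuclideanSpace ℝ (Fin 3)) =
          (c • A (N.pos x₀) + b + w) - (c • A (N.pos x₀) + b) := by abel
        rw [h5, h3]
        abel
      simp only
      rw [← h4]
      exact w.2
  refine ⟨⟨c, A, b, ψ, hc, hlat, fun x => (hf x).2, fun g g' x hg => ?_⟩, hlat⟩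
  refine uniqR (hf (g +ᵥ x)) ⟨?_, ?_⟩
  · rw [((h'.lab_eq_iff (ψ x) (g' +ᵥ ψ x)).2 ⟨g', rfl⟩).symm, ((h.lab_eq_iff x (g +ᵥ x)).2 ⟨g, rfl⟩).symm]
    exact (hf x).1
  · rw [N'.pos_vadd, N.pos_vadd, hg, map_add, smul_add]
    change N'.pos (f x) + _ = _
    rw [(hf x).2]
    abel

end similar

/-- Twice the edge vectors of the model srs network. -/
def srsU : Fin 4 → Fin 4 → Fin 3 → ℤ :=
  ![![0, ![0, 1, -1], ![-1, 0, 1], ![1, -1, 0]],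
    ![![0, -1, 1], 0, ![1, 1, 0], ![-1, 0, -1]],
    ![![1, 0, -1], ![-1, -1, 0], 0, ![0, 1, 1]],
    ![![-1, 1, 0], ![1, 0, 1], ![0, -1, -1], 0]]

/-- Since K₄ has no multiple edges, a dart of the quotient is determined by its ordered pair of end
points, so its vector is a function of the two labels. -/
theorem exists_labelling (hN : N.QuotientIsK4) : ∃ lab E, IsK4Labelling N lab E := by
  obtain ⟨hcard, hinj, hrange⟩ := hN
  have := N.finite_vertices
  let π : N.QVertex ≃ Fin 4 := Finite.equivFinOfCardEq hcard
  have hnd : ∀ d : N.QDart, src d ≠ tgt d := fun d hd => by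
    have : N.endpoints (edge d) ∈ Set.range N.endpoints := ⟨_, rfl⟩
    rw [hrange, endpoints_edge] at this
    exact this (by rw [Sym2.mk_isDiag_iff]; exact hd)
  have huniq : ∀ d d' : N.QDart, src d = src d' → tgt d = tgt d' → d' = d := by
    intro d d' h1 h2
    have : edge d = edge d' := hinj (by rw [endpoints_edge, endpoints_edge, h1, h2])
    refine (edge_eq_iff.1 this).resolve_right fun e => hnd d ?_
    rw [h1, e, src_rev]
  let E : Fin 4 → Fin 4 → EuclideanSpace ℝ (Fin 3) := fun i j =>
    if h : ∃ d : N.QDart, π (src d) = i ∧ π (tgt d) = j then vec h.choose else 0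
  have hE : ∀ d : N.QDart, E (π (src d)) (π (tgt d)) = vec d := by
    intro d
    have h : ∃ d' : N.QDart, π (src d') = π (src d) ∧ π (tgt d') = π (tgt d) := ⟨d, rfl, rfl⟩
    simp only [E]
    rw [dif_pos h]
    rw [huniq d h.choose (π.injective h.choose_spec.1.symm) (π.injective h.choose_spec.2.symm)]
  refine ⟨fun x => π (N.mkV x), E, fun x y => ?_, ?_, fun x y hxy e => ?_, fun x y hxy => ?_,
    fun x j hj => ?_⟩
  · rw [π.injective.eq_iff, mkV_eq_iff]
  · exact π.surjective.comp mkV_surjective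
  · exact hnd (mkDart hxy) (π.injective e)
  · exact (hE (mkDart hxy)).symm
  · have hmem : s(N.mkV x, π.symm j) ∈ Set.range N.endpoints := by
      rw [hrange]
      intro hd
      rw [Sym2.mk_isDiag_iff] at hd
      exact hj (by rw [hd, π.apply_symm_apply])
    obtain ⟨e, he⟩ := hmem
    obtain ⟨d, rfl⟩ := edge_surjective e
    have : ∃ d : N.QDart, src d = N.mkV x ∧ tgt d = π.symm j := by
      rw [endpoints_edge, Sym2.eq_iff] at he
      rcases he with ⟨h1, h2⟩ | ⟨h1, h2⟩
      · exact ⟨d, h1, h2⟩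
      · exact ⟨rev d, by rw [src_rev, h2], by rw [tgt_rev, h1]⟩
    obtain ⟨d, h1, h2⟩ := this
    obtain ⟨y, hy, rfl⟩ := exists_dart_of_src h1
    exact ⟨y, hy, by rw [← tgt_mkDart hy, h2, π.apply_symm_apply]⟩

/-- Six vectors with the balancing relations of an equilateral `K₄` are determined up to similarity. -/
theorem exists_similarity {E : Fin 4 → Fin 4 → EuclideanSpace ℝ (Fin 3)} {l : ℝ} (hl : 0 < l)
    (hnorm : ∀ i j, i ≠ j → ‖E i j‖ = l) (hanti : ∀ i j, i ≠ j → E j i = - E i j)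
    (hsum : ∀ i, ∑ j ∈ Finset.univ.erase i, E i j = 0) :
    ∃ A : EuclideanSpace ℝ (Fin 3) ≃ₗᵢ[ℝ] EuclideanSpace ℝ (Fin 3),
      ∀ i j, i ≠ j → E i j = (√2 * l) • A ((1 / 2 : ℝ) • toE (srsU i j)) := by
  have hs2 : √2 * √2 = (2 : ℝ) := Real.mul_self_sqrt (by norm_num)
  have hs0 : (0 : ℝ) < √2 := by positivity
  set a := E 0 1 with ha
  set b := E 0 2 with hb
  set d := E 1 2 with hd
  have e0 : a + b + E 0 3 = 0 := by
    have := hsum 0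
    rw [show (Finset.univ.erase 0 : Finset (Fin 4)) = {1, 2, 3} by decide] at this
    simpa [add_assoc] using this
  have e1 : - a + d + E 1 3 = 0 := by
    have := hsum 1
    rw [show (Finset.univ.erase 1 : Finset (Fin 4)) = {0, 2, 3} by decide] at this
    simpa [add_assoc, hanti 0 1 (by decide)] using this
  have e2 : - b - d + E 2 3 = 0 := by
    have := hsum 2
    rw [show (Finset.univ.erase 2 : Finset (Fin 4)) = {0, 1, 3} by decide] at this
    simpa [add_assoc, hanti 0 2 (by decide), hanti 1 2 (by decide), sub_eq_add_neg] using this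
  -- Balancing at the vertices 0, 1, 2 expresses everything by a, b, d. The six equal lengths then
  -- determine the inner products of a, b, d.
  have h03 : E 0 3 = - a - b := by
    rw [← sub_eq_zero, ← e0]; abel
  have h13 : E 1 3 = a - d := by
    rw [← sub_eq_zero, ← e1]; abel
  have h23 : E 2 3 = b + d := by
    rw [← sub_eq_zero, ← e2]; abel
  have sq : ∀ i j, i ≠ j → (inner ℝ (E i j) (E i j) : ℝ) = l ^ 2 := fun i j hij => by
    rw [real_inner_self_eq_norm_sq, hnorm i j hij]
  have haa := sq 0 1 (by decide)
  have hbb := sq 0 2 (by decide)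
  have hdd := sq 1 2 (by decide)
  have hab := sq 0 3 (by decide)
  have had := sq 1 3 (by decide)
  have hbd := sq 2 3 (by decide)
  rw [← ha] at haa
  rw [← hb] at hbb
  rw [← hd] at hdd
  rw [h03] at hab
  rw [h13] at had
  rw [h23] at hbd
  simp only [inner_add_left, inner_add_right, inner_sub_left, inner_sub_right, inner_neg_left,
    inner_neg_right, real_inner_comm a b, real_inner_comm a d, real_inner_comm b d, haa, hbb, hdd]
    at hab had hbd
  have iab : (inner ℝ a b : ℝ) = - l ^ 2 / 2 := by linarith
  have iad : (inner ℝ a d : ℝ) = l ^ 2 / 2 := by linarith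
  have ibd : (inner ℝ b d : ℝ) = - l ^ 2 / 2 := by linarith
  have iba : (inner ℝ b a : ℝ) = - l ^ 2 / 2 := by rw [real_inner_comm]; exact iab
  have ida : (inner ℝ d a : ℝ) = l ^ 2 / 2 := by rw [real_inner_comm]; exact iad
  have idb : (inner ℝ d b : ℝ) = - l ^ 2 / 2 := by rw [real_inner_comm]; exact ibd
  set k : ℝ := √2 * l with hk
  have hk0 : 0 < k := by positivity
  have hkk : k * k = 2 * l ^ 2 := by rw [hk]; linear_combination l ^ 2 * hs2
  -- The solution of 2a = v₁ - v₂, 2b = v₂ - v₀, 2d = v₀ + v₁, which are the relations read off from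
  -- `srsU`. The vectors are orthogonal of length √2 l, so they are the images of the coordinate
  -- vectors.
  let v : Fin 3 → EuclideanSpace ℝ (Fin 3) := ![d - a - b, d + a + b, b + d - a]
  have hv : ∀ i j, (inner ℝ (v i) (v j) : ℝ) = if i = j then k * k else 0 := by
    intro i j
    rw [hkk]
    fin_cases i <;> fin_cases j <;>
      simp only [v, Fin.isValue, Fin.zero_eta, Fin.mk_one, Fin.reduceFinMk, Matrix.cons_val,
        Matrix.cons_val_zero, Matrix.cons_val_one,
        inner_add_left, inner_add_right, inner_sub_left, inner_sub_right, haa, hbb, hdd, iab, iad,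
        ibd, iba, ida, idb, Fin.reduceEq, if_true, if_false] <;> norm_num <;> ring
  have hon : Orthonormal ℝ fun i => k⁻¹ • v i := by
    rw [orthonormal_iff_ite]
    intro i j
    rw [inner_smul_left, inner_smul_right, hv]
    split_ifs
    · simp
      field_simp
    · simp
  let bs := basisOfLinearIndependentOfCardEqFinrank hon.linearIndependent (by simp)
  have hbs : ∀ i, bs i = k⁻¹ • v i := fun i => by simp [bs]
  let f : OrthonormalBasis (Fin 3) ℝ (EuclideanSpace ℝ (Fin 3)) := bs.toOrthonormalBasis (by
    have : (bs : Fin 3 → _) = fun i => k⁻¹ • v i := funext hbs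
    rw [this]; exact hon)
  have hf : ∀ i, f i = k⁻¹ • v i := fun i => by simp [f, hbs]
  let A := (EuclideanSpace.basisFun (Fin 3) ℝ).equiv f (Equiv.refl _)
  have hA : ∀ u : Fin 3 → ℤ, k • A ((1 / 2 : ℝ) • toE u) =
      (1 / 2 : ℝ) • ((u 0 : ℝ) • v 0 + (u 1 : ℝ) • v 1 + (u 2 : ℝ) • v 2) := by
    intro u
    have h1 : toE u = ∑ i, (u i : ℝ) • EuclideanSpace.basisFun (Fin 3) ℝ i := by
      rw [← (EuclideanSpace.basisFun (Fin 3) ℝ).sum_repr (toE u)]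
      simp
    rw [map_smul, h1, map_sum, smul_comm, Fin.sum_univ_three]
    congr 1
    have h2 : ∀ i, A (EuclideanSpace.basisFun (Fin 3) ℝ i) = k⁻¹ • v i := fun i => by
      rw [← hf]; exact (EuclideanSpace.basisFun (Fin 3) ℝ).equiv_apply_basis f (Equiv.refl _) i
    have h3 : ∀ (r : ℝ) (w : EuclideanSpace ℝ (Fin 3)), k • r • k⁻¹ • w = r • w := fun r w => by
      rw [smul_comm k, smul_inv_smul₀ hk0.ne']
    simp only [map_smul, h2, smul_add, h3]
  refine ⟨A, fun i j hij => ?_⟩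
  rw [hA]
  have h10 := hanti 0 1 (by decide)
  have h20 := hanti 0 2 (by decide)
  have h21 := hanti 1 2 (by decide)
  have h30 := hanti 0 3 (by decide)
  have h31 := hanti 1 3 (by decide)
  have h32 := hanti 2 3 (by decide)
  rw [h03] at h30
  rw [h13] at h31
  rw [h23] at h32
  fin_cases i <;> fin_cases j <;> first
    | exact absurd rfl hij
    | (simp only [Fin.isValue, Fin.zero_eta, Fin.mk_one, Fin.reduceFinMk, h03, h13, h23, h10, h20,
        h21, h30, h31, h32, ← ha, ← hb, ← hd, srsU, v, Matrix.cons_val, Matrix.cons_val_zero,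
        Matrix.cons_val_one]
       push_cast
       module)

/-- The Steiner condition with equal lengths says that the edge vectors at each vertex sum to zero,
so `exists_similarity` puts them in the standard form. -/
theorem IsSrs.exists_frame (h : N.IsSrs) : ∃ (lab : V → Fin 4) (c : ℝ)
    (A : EuclideanSpace ℝ (Fin 3) ≃ₗᵢ[ℝ] EuclideanSpace ℝ (Fin 3)), 0 < c ∧
      IsK4Labelling N lab fun i j => c • A ((1 / 2 : ℝ) • toE (srsU i j)) := by
  obtain ⟨hst, hK4, ⟨l, hl⟩, _⟩ := h
  obtain ⟨lab, E, hE⟩ := exists_labelling hK4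
  have hex : ∀ i j, i ≠ j → ∃ x y, N.graph.Adj x y ∧ lab x = i ∧ lab y = j := by
    intro i j hij
    obtain ⟨x, rfl⟩ := hE.surjective i
    obtain ⟨y, hy, rfl⟩ := hE.exists_adj x j hij.symm
    exact ⟨x, y, hy, rfl, rfl⟩
  have hnorm : ∀ i j, i ≠ j → ‖E i j‖ = l := by
    intro i j hij
    obtain ⟨x, y, hxy, rfl, rfl⟩ := hex i j hij
    rw [← hE.pos_sub x y hxy, ← dist_eq_norm, dist_comm, hl x y hxy]
  have hl0 : 0 < l := by
    obtain ⟨x, y, hxy, _⟩ := hex 0 1 (by decide)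
    rw [← hl x y hxy]
    exact dist_pos.2 (N.pos_ne x y hxy)
  have hanti : ∀ i j, i ≠ j → E j i = - E i j := by
    intro i j hij
    obtain ⟨x, y, hxy, rfl, rfl⟩ := hex i j hij
    rw [← hE.pos_sub x y hxy, ← hE.pos_sub y x hxy.symm]
    abel
  have hsum : ∀ i, ∑ j ∈ Finset.univ.erase i, E i j = 0 := by
    intro i
    obtain ⟨x, rfl⟩ := hE.surjective i
    have h1 := hE.finsum x hnorm
    rw [(hst x).2, eq_comm, neg_eq_zero] at h1
    exact (smul_eq_zero.1 h1).resolve_left (inv_ne_zero hl0.ne')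
  obtain ⟨A, hA⟩ := exists_similarity hl0 hnorm hanti hsum
  refine ⟨lab, √2 * l, A, by positivity, hE.lab_eq_iff, hE.surjective, hE.lab_ne,
    fun x y hxy => ?_, hE.exists_adj⟩
  rw [hE.pos_sub x y hxy, hA _ _ (hE.lab_ne x y hxy)]

theorem IsSrs.isSimilarTo {Λ' : Submodule ℤ (EuclideanSpace ℝ (Fin 3))} {V' : Type*}
    [AddAction Λ' V'] {N' : PeriodicNetwork Λ' V'} (h : N.IsSrs) (h' : N'.IsSrs) :
    N.IsSimilarTo N' := by
  obtain ⟨lab, c, A, hc, hE⟩ := h.exists_frame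
  obtain ⟨lab', c', A', hc', hE'⟩ := h'.exists_frame
  refine (hE.similar hE' (c := c' / c) (div_pos hc' hc) (A.symm.trans A') fun i j _ => ?_).1
  rw [LinearIsometryEquiv.trans_apply, map_smul A.symm, A.symm_apply_apply, map_smul A' c,
    smul_smul, div_mul_cancel₀ _ hc.ne']

end PeriodicNetwork

/-! ### The model srs network and its length -/

namespace PeriodicNetwork

/-- The coefficients, with respect to `bccVec`, of the lattice translation along an edge of the
model srs network. -/
def srsShiftCoeff : Fin 4 → Fin 4 → Fin 3 → ℤ :=
  ![![0, 0, 0, 0],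
    ![0, 0, ![0, 0, 1], ![0, -1, 0]],
    ![0, ![0, 0, -1], 0, ![1, 0, 0]],
    ![0, ![0, 1, 0], ![-1, 0, 0], 0]]

/-- The generators of the body-centred cubic lattice. -/
def bccGen (m : Fin 3) : bccLattice :=
  ⟨bccVec m, by rw [bccLattice_eq_span]; exact Submodule.subset_span ⟨m, rfl⟩⟩

/-- The lattice translation along an edge of the model srs network. -/
def srsShift (i j : Fin 4) : bccLattice := ∑ m, srsShiftCoeff i j m • bccGen m

theorem srsShift_swap (i j : Fin 4) : srsShift j i = - srsShift i j := by
  have : ∀ i j m, srsShiftCoeff j i m = - srsShiftCoeff i j m := by decide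
  simp only [srsShift, this i j, neg_smul, Finset.sum_neg_distrib]

/-- The positions of the model srs network. -/
def srsPos (x : Fin 4 × bccLattice) : EuclideanSpace ℝ (Fin 3) :=
  (1 / 2 : ℝ) • toE (srsU 0 x.1) + x.2

theorem bccVec_eq_toE : bccVec = fun m => toE (![![-1, 1, 1], ![1, -1, 1], ![1, 1, -1]] m) := by
  funext m
  fin_cases m <;> ext k <;> fin_cases k <;> simp [bccVec, toE]

/-- A finite check over the integers, after doubling: the tabulated translations complete the
differences of the representatives to the prescribed edge vectors. -/
theorem srsPos_sub {i j : Fin 4} (hij : i ≠ j) (g : bccLattice) :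
    srsPos (j, g + srsShift i j) - srsPos (i, g) = (1 / 2 : ℝ) • toE (srsU i j) := by
  have key : ∀ i j : Fin 4, i ≠ j → ∀ m : Fin 3, srsU i j m = srsU 0 j m - srsU 0 i m +
      2 * (srsShiftCoeff i j 0 * (![-1, 1, 1] : Fin 3 → ℤ) m +
        srsShiftCoeff i j 1 * (![1, -1, 1] : Fin 3 → ℤ) m +
        srsShiftCoeff i j 2 * (![1, 1, -1] : Fin 3 → ℤ) m) := by decide
  have h1 : ((srsShift i j : bccLattice) : EuclideanSpace ℝ (Fin 3)) =
      ∑ m, (srsShiftCoeff i j m : ℝ) • bccVec m := by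
    simp [srsShift, bccGen, Int.cast_smul_eq_zsmul]
  ext m
  have h2 := congrArg (fun a : ℤ => (a : ℝ)) (key i j hij m)
  push_cast at h2
  simp only [srsPos, Submodule.coe_add, h1, bccVec_eq_toE, Fin.sum_univ_three, PiLp.sub_apply,
    PiLp.add_apply, PiLp.smul_apply, toE, smul_eq_mul, Matrix.cons_val, Matrix.cons_val_zero,
    Matrix.cons_val_one]
  rw [h2]
  ring

theorem inner_srsU {i j k : Fin 4} (hij : i ≠ j) (hik : i ≠ k) (hjk : j ≠ k) :
    (inner ℝ (toE (srsU i j)) (toE (srsU i k)) : ℝ) = -1 := by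
  have key : ∀ i j k : Fin 4, i ≠ j → i ≠ k → j ≠ k →
    srsU i j 0 * srsU i k 0 + srsU i j 1 * srsU i k 1 + srsU i j 2 * srsU i k 2 = -1 := by decide
  rw [inner_toE]
  have h2 := congrArg (fun a : ℤ => (a : ℝ)) (key i j k hij hik hjk)
  push_cast at h2
  simpa [Fin.sum_univ_three, toE] using h2

theorem norm_srsU {i j : Fin 4} (hij : i ≠ j) : ‖toE (srsU i j)‖ ^ 2 = 2 := by
  have key : ∀ i j : Fin 4, i ≠ j → srsU i j 0 ^ 2 + srsU i j 1 ^ 2 + srsU i j 2 ^ 2 = 2 := by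
    decide
  rw [norm_toE_sq]
  exact_mod_cast key i j hij

/-- The graph of the model srs network. -/
def srsGraph : SimpleGraph (Fin 4 × bccLattice) where
  Adj x y := x.1 ≠ y.1 ∧ y.2 = x.2 + srsShift x.1 y.1
  symm := ⟨fun x y h => ⟨h.1.symm, by rw [srsShift_swap x.1 y.1, h.2]; abel⟩⟩
  loopless := ⟨fun x h => h.1 rfl⟩

theorem srsGraph_adj (g : bccLattice) {i j : Fin 4} (h : i ≠ j) :
    srsGraph.Adj (i, g) (j, g + srsShift i j) := ⟨h, rfl⟩

theorem srsShift_zero (j : Fin 4) : srsShift 0 j = 0 := by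
  have : ∀ j m, srsShiftCoeff 0 j m = 0 := by decide
  simp [srsShift, this]

theorem srsGraph_reachable_zero (g : bccLattice) (i : Fin 4) :
    srsGraph.Reachable (0, g) (i, g) := by
  by_cases h : 0 = i
  · rw [h]
  · have := srsGraph_adj g h
    rw [srsShift_zero, add_zero] at this
    exact this.reachable

/-- The star at vertex 0 is a spanning tree with trivial translations. The three other edges close
the fundamental cycles, and their translations are the lattice generators up to orientation. -/
theorem srsGraph_reachable_gen (m : Fin 3) : ∃ i j : Fin 4, i ≠ j ∧ srsShift i j = bccGen m := by
  have : ∀ m : Fin 3, ∃ i j : Fin 4, i ≠ j ∧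
      srsShiftCoeff i j 0 = (if 0 = m then 1 else 0) ∧ srsShiftCoeff i j 1 = (if 1 = m then 1 else 0) ∧
      srsShiftCoeff i j 2 = (if 2 = m then 1 else 0) := by decide
  obtain ⟨i, j, hij, h0, h1, h2⟩ := this m
  refine ⟨i, j, hij, ?_⟩
  rw [srsShift, Fin.sum_univ_three, h0, h1, h2]
  fin_cases m <;> simp

theorem srsGraph_reachable_add (h g : bccLattice) : srsGraph.Reachable (0, g) (0, g + h) := by
  obtain ⟨h, hh⟩ := h
  have hh' := hh
  rw [bccLattice_eq_span] at hh'
  revert g hh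
  induction hh' using Submodule.span_induction with
  | mem x hx =>
    obtain ⟨m, rfl⟩ := hx
    intro g _
    obtain ⟨i, j, hij, e⟩ := srsGraph_reachable_gen m
    have h1 := srsGraph_adj g hij
    rw [e] at h1
    exact (srsGraph_reachable_zero g i).trans (h1.reachable.trans
      (srsGraph_reachable_zero (g + bccGen m) j).symm)
  | zero =>
    intro g hh
    have : (⟨0, hh⟩ : bccLattice) = 0 := rfl
    rw [this, add_zero]
  | add x y hx hy ihx ihy =>
    intro g hh
    rw [← bccLattice_eq_span] at hx hy
    have : (⟨x + y, hh⟩ : bccLattice) = ⟨x, hx⟩ + ⟨y, hy⟩ := rfl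
    rw [this, ← add_assoc]
    exact (ihx g hx).trans (ihy _ hy)
  | smul a x hx ih =>
    rw [← bccLattice_eq_span] at hx
    have hz : ∀ (a : ℕ) (g : bccLattice),
        srsGraph.Reachable (0, g) (0, g + a • (⟨x, hx⟩ : bccLattice)) := by
      intro a
      induction a with
      | zero => intro g; rw [zero_smul, add_zero]
      | succ a iha =>
        intro g
        rw [succ_nsmul, ← add_assoc]
        exact (iha g).trans (ih _ hx)
    intro g hh
    have : (⟨a • x, hh⟩ : bccLattice) = a • ⟨x, hx⟩ := rfl
    rw [this]
    obtain ⟨k, rfl | rfl⟩ := a.eq_nat_or_neg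
    · rw [natCast_zsmul]; exact hz k g
    · have h1 := hz k (g + -(k : ℤ) • (⟨x, hx⟩ : bccLattice))
      rw [neg_smul, natCast_zsmul, neg_add_cancel_right] at h1
      rw [neg_smul, natCast_zsmul]
      exact h1.symm

/-- The model srs network. -/
def srsNetwork : @PeriodicNetwork 3 bccLattice (Fin 4 × bccLattice) (copiesAction bccLattice 4) :=
  let _ := copiesAction bccLattice 4
  { graph := srsGraph
    pos := srsPos
    connected :=
      { preconnected := fun ⟨i, g⟩ ⟨j, h⟩ => by
          have h1 := srsGraph_reachable_add (h - g) g
          rw [add_sub_cancel] at h1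
          exact (srsGraph_reachable_zero g i).symm.trans (h1.trans (srsGraph_reachable_zero h j))
        nonempty := ⟨(0, 0)⟩ }
    adj_vadd := fun g x y h => ⟨h.1, by
      change g + y.2 = g + x.2 + srsShift x.1 y.1
      rw [h.2, add_assoc]⟩
    pos_vadd := fun g x => by
      change (1 / 2 : ℝ) • toE (srsU 0 x.1) + ((g + x.2 : bccLattice) : EuclideanSpace ℝ (Fin 3)) = _
      rw [Submodule.coe_add, srsPos]
      abel
    pos_ne := by
      rintro ⟨i, g⟩ ⟨j, h⟩ ⟨hij, e⟩ hp
      simp only at hij e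
      subst e
      have h1 := srsPos_sub hij g
      rw [← hp, sub_self, eq_comm, smul_eq_zero] at h1
      have h2 := norm_srsU hij
      rw [h1.resolve_left (by norm_num)] at h2
      simp at h2
    star_embedded := by
      rintro ⟨i, g⟩ ⟨j, h⟩ ⟨k, h'⟩ ⟨hij, e⟩ ⟨hik, e'⟩ hne
      simp only at hij e hik e'
      subst e e'
      have hjk : j ≠ k := fun e => hne (by rw [e])
      refine Set.Subset.antisymm ?_ (Set.singleton_subset_iff.2
        ⟨left_mem_segment _ _ _, left_mem_segment _ _ _⟩)
      rw [segment_eq_image', segment_eq_image', srsPos_sub hij, srsPos_sub hik]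
      rintro w ⟨⟨a, ha, rfl⟩, ⟨b, hb, hab⟩⟩
      simp only [add_right_inj] at hab
      -- Distinct edge vectors at a vertex form an obtuse angle. Pairing with the first one yields a
      -- = -b/2 for nonnegative a and b, so a = 0.
      have h1 := congrArg (fun w => (inner ℝ (toE (srsU i j)) w : ℝ)) hab
      simp only [inner_smul_right, inner_srsU hij hik hjk, real_inner_self_eq_norm_sq,
        norm_srsU hij] at h1
      have : a = 0 := by linarith [ha.1, hb.1]
      simp [this]
    finite_vertices := by
      refine Finite.of_surjective (fun i : Fin 4 => (Quotient.mk'' (i, (0 : bccLattice)) :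
        AddAction.orbitRel.Quotient bccLattice (Fin 4 × bccLattice))) fun q => ?_
      induction q using Quotient.inductionOn' with
      | h x =>
        refine ⟨x.1, (Quotient.sound' ?_).symm⟩
        refine ⟨x.2, ?_⟩
        change (x.1, x.2 + 0) = x
        rw [add_zero]
    finite_edges := by
      refine Finite.of_surjective (fun p : {p : Fin 4 × Fin 4 // p.1 ≠ p.2} =>
        (Quotient.mk _ ⟨s((p.1.1, 0), (p.1.2, 0 + srsShift p.1.1 p.1.2)), srsGraph_adj 0 p.2⟩ :
          Quotient (edgeOrbitSetoid bccLattice srsGraph))) fun q => ?_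
      induction q using Quotient.inductionOn with
      | h e =>
        obtain ⟨e, he⟩ := e
        induction e using Sym2.ind with
        | _ x y =>
          refine ⟨⟨(x.1, y.1), he.1⟩, Quotient.sound ⟨x.2, ?_⟩⟩
          simp only [Sym2.map_mk]
          have h1 : x.2 +ᵥ (x.1, (0 : bccLattice)) = x := by
            change (x.1, x.2 + 0) = x
            rw [add_zero]
          have h2 : x.2 +ᵥ (y.1, 0 + srsShift x.1 y.1) = y := by
            change (y.1, x.2 + (0 + srsShift x.1 y.1)) = y
            rw [zero_add, ← he.2]
          rw [h1, h2] }

theorem isK4Labelling_srsNetwork :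
    @IsK4Labelling _ _ (copiesAction bccLattice 4) srsNetwork Prod.fst
      fun i j => (1 / 2 : ℝ) • toE (srsU i j) := by
  let _ := copiesAction bccLattice 4
  refine ⟨fun x y => ⟨fun h => ⟨y.2 - x.2, ?_⟩, ?_⟩, fun i => ⟨(i, 0), rfl⟩, fun x y h => h.1, ?_,
    fun x j hj => ⟨(j, x.2 + srsShift x.1 j), ⟨hj.symm, rfl⟩, rfl⟩⟩
  · change (x.1, y.2 - x.2 + x.2) = y
    rw [sub_add_cancel, h]
  · rintro ⟨g, rfl⟩
    rfl
  · rintro ⟨i, g⟩ ⟨j, h⟩ ⟨hij, e⟩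
    simp only at hij e
    subst e
    exact srsPos_sub hij g

theorem norm_half_srsU {i j : Fin 4} (hij : i ≠ j) : ‖(1 / 2 : ℝ) • toE (srsU i j)‖ = 1 / √2 := by
  have h : ‖toE (srsU i j)‖ = √2 := by rw [← norm_srsU hij, Real.sqrt_sq (norm_nonneg _)]
  have hs2 : √2 * √2 = (2 : ℝ) := Real.mul_self_sqrt (by norm_num)
  rw [norm_smul, h, eq_div_iff (by positivity), mul_assoc, hs2]
  norm_num

theorem isSrs_srsNetwork : @IsSrs _ _ (copiesAction bccLattice 4) srsNetwork := by
  let _ := copiesAction bccLattice 4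
  have h := isK4Labelling_srsNetwork
  refine ⟨fun x => ⟨h.ncard x, ?_⟩, h.quotientIsK4, ⟨1 / √2, fun x y hxy => ?_⟩,
    1, LinearIsometryEquiv.refl ℝ _, one_pos, ?_⟩
  · rw [h.finsum x fun i j => norm_half_srsU]
    have key : ∀ i, ∀ m, ∑ j ∈ Finset.univ.erase i, srsU i j m = 0 := by decide
    have : ∑ j ∈ Finset.univ.erase x.1, (1 / 2 : ℝ) • toE (srsU x.1 j) = 0 := by
      rw [← Finset.smul_sum]
      ext m
      have h2 := congrArg (fun a : ℤ => (a : ℝ)) (key x.1 m)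
      push_cast at h2
      simp only [PiLp.smul_apply, WithLp.ofLp_sum, Finset.sum_apply, toE]
      rw [h2]
      simp
    rw [this, smul_zero, neg_zero]
  · rw [dist_comm, dist_eq_norm, h.pos_sub x y hxy, norm_half_srsU (h.lab_ne x y hxy)]
  · simp

variable {Λ : Submodule ℤ (EuclideanSpace ℝ (Fin 3))} {V : Type*} [AddAction Λ V]
variable {N : PeriodicNetwork Λ V}

theorem QuotientIsK4.card_QEdge (h : N.QuotientIsK4) : Nat.card N.QEdge = 6 := by
  obtain ⟨hcard, hinj, hrange⟩ := h
  have := N.finite_vertices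
  have := Fintype.ofFinite N.QVertex
  rw [Nat.card_congr (Equiv.ofInjective _ hinj), hrange]
  change Nat.card {s : Sym2 N.QVertex // ¬ s.IsDiag} = 6
  rw [Nat.card_eq_fintype_card, Sym2.card_subtype_not_diag, ← Nat.card_eq_fintype_card, hcard]
  rfl

/-- An srs network attains the bound. -/
theorem IsSrs.length_eq (h : N.IsSrs) :
    N.length ^ 3 / ZLattice.covolume Λ = 27 / √2 := by
  have hs2 : √2 * √2 = (2 : ℝ) := Real.mul_self_sqrt (by norm_num)
  have hs0 : (0 : ℝ) < √2 := by positivity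
  obtain ⟨lab, c, A, hc, hE⟩ := h.exists_frame
  let _ := copiesAction bccLattice 4
  -- The similarity from the model carries the standard bcc lattice onto Λ itself, so V = 4c³. The
  -- six edges have length c/√2.
  have hlat := (IsK4Labelling.similar (hE := fun i j _ => rfl) isK4Labelling_srsNetwork hE hc A).2
  let T : EuclideanSpace ℝ (Fin 3) ≃L[ℝ] EuclideanSpace ℝ (Fin 3) :=
    A.toContinuousLinearEquiv.trans (ContinuousLinearEquiv.smulLeft (Units.mk0 c hc.ne'))
  have hT : (T : EuclideanSpace ℝ (Fin 3) →ₗ[ℝ] EuclideanSpace ℝ (Fin 3)) =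
      c • A.toLinearIsometry.toLinearMap := by
    ext x
    rfl
  have hcov : ZLattice.covolume Λ = c ^ 3 * 4 := by
    rw [covolume_image T hlat, covolume_bccLattice, hT, LinearMap.det_smul, abs_mul,
      ← LinearMap.normDet_eq_abs_det A.toLinearIsometry.toLinearMap,
      LinearIsometry.normDet_eq_one, finrank_euclideanSpace_fin, abs_of_pos (by positivity), mul_one]
  have hlen : ∀ e : N.QEdge, N.qEdgeLength e = c * (1 / √2) := by
    intro e
    obtain ⟨d, rfl⟩ := edge_surjective e
    induction d using QDart.ind with
    | _ x y hxy =>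
      rw [norm_vec, vec_mkDart, hE.pos_sub x y hxy, norm_smul, A.norm_map,
        norm_half_srsU (hE.lab_ne x y hxy), Real.norm_of_nonneg hc.le]
  have hL : N.length = 6 * (c * (1 / √2)) := by
    have := N.finite_edges
    have := Fintype.ofFinite N.QEdge
    rw [length, finsum_eq_sum_of_fintype, Finset.sum_congr rfl fun e _ => hlen e, Finset.sum_const,
      Finset.card_univ, ← Nat.card_eq_fintype_card, h.2.1.card_QEdge, nsmul_eq_mul]
    norm_num
  rw [hL, hcov]
  field_simp
  linear_combination (-108 : ℝ) * hs2

end PeriodicNetwork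

end

/-! ### The theorem -/

theorem theoremA :
    -- the estimate and its equality case, for every triply periodic network
    (∀ (Λ : Submodule ℤ (EuclideanSpace ℝ (Fin 3))) [DiscreteTopology Λ] [IsZLattice ℝ Λ]
      (V : Type*) [AddAction Λ V] (N : PeriodicNetwork Λ V),
      27 / √2 ≤ N.length ^ 3 / ZLattice.covolume Λ ∧
      (N.length ^ 3 / ZLattice.covolume Λ = 27 / √2 ↔
        ∃ (W : Type) (_ : AddAction Λ W) (M : PeriodicNetwork Λ W),
          M.IsSrs ∧ N.IsSubdivisionOf M)) ∧
    -- the srs network exists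
    (∃ (Λ : Submodule ℤ (EuclideanSpace ℝ (Fin 3))) (_ : DiscreteTopology Λ) (_ : IsZLattice ℝ Λ)
      (W : Type) (_ : AddAction Λ W) (M : PeriodicNetwork Λ W), M.IsSrs) ∧
    -- the srs network is unique up to similarity
    (∀ (Λ Λ' : Submodule ℤ (EuclideanSpace ℝ (Fin 3)))
      [DiscreteTopology Λ] [IsZLattice ℝ Λ] [DiscreteTopology Λ'] [IsZLattice ℝ Λ']
      (W W' : Type*) [AddAction Λ W] [AddAction Λ' W']
      (M : PeriodicNetwork Λ W) (M' : PeriodicNetwork Λ' W'),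
      M.IsSrs → M'.IsSrs → M.IsSimilarTo M') := by
  refine ⟨fun Λ _ _ V _ N => ⟨N.length_estimate.1, N.exists_srs_of_eq, ?_⟩, ?_, ?_⟩
  · rintro ⟨W, _, M, hM, hN⟩
    rw [PeriodicNetwork.length_eq_of_isSubdivisionOf hN]
    exact hM.length_eq
  · exact ⟨bccLattice, inferInstance, inferInstance, Fin 4 × bccLattice, PeriodicNetwork.copiesAction bccLattice 4,
      PeriodicNetwork.srsNetwork, PeriodicNetwork.isSrs_srsNetwork⟩
  · intro Λ Λ' _ _ _ _ W W' _ _ M M' hM hM'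
    exact hM.isSimilarTo hM'
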